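/- Let $\Bbbk$ be an algebraically closed field. All algebras are unital associative finite dimensional $\Bbbk$-algebras. An algebra $A$ is *basic* if $A/\operatorname{rad}A\simeq\Bbbk^s$ for some $s$. An algebra $A$ is *nodal* if there is a hereditary algebra $H$ such that (1) $\operatorname{rad}H\subseteq A\subseteq H$ ($A$ a unital subalgebra), (2) $\operatorname{rad}A=\operatorname{rad}H$, (3) $\operatorname{length}_A(H\otimes_AU)\le2$ for each simple left $A$-module $U$. Let $B$ be a basic algebra, $\bar B=B/\operatorname{rad}B=\prod_{c=1}^m\bar B_c$ with $\bar B_c\simeq\Bbbk$, and let $1=\sum_c\varepsilon_c$ be a decomposition into orthogonal idempotents such that $\varepsilon_c$ is mapped to the unit of $\bar B_c$; put $B_c=\varepsilon_cB$. * *Gluing* the components $\bar B_i$ and $\bar B_j$ ($i\ne j$) gives the preimage in $B$ of the subalgebra $\{\lambda\in\bar B\mid\lambda_i=\lambda_j\}$. Its simple components are one new component $\{(\lambda,\lambda)\}\subset\bar B_i\times\bar B_j$ and the $\bar B_c$ with $c\ne i,j$. * *Blowing up* the component $\bar B_i$ gives the preimage in $B'=\operatorname{End}_B\bigl(2B_i\oplus\bigoplus_{c\ne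 i}B_c\bigr)$ of the subalgebra of those elements of $B'/\operatorname{rad}B'\simeq\operatorname{Mat}(2,\Bbbk)\times\prod_{c\ne i}\Bbbk$ whose component in $\operatorname{Mat}(2,\Bbbk)$ is a diagonal matrix. Its simple components are two new components (the diagonal entries) and the $\bar B_c$ with $c\ne i$. For pairwise different indices $i_1,\dots,i_{r+s},j_1,\dots,j_r$ of simple components of $B$, the *suitable sequence of gluings and blowings up* defined by them constructs algebras $A_0=B,A_1,\dots,A_{r+s}$, where $A_k$ is obtained from $A_{k-1}$ by gluing the components $\bar B_{i_k}$ and $\bar B_{j_k}$ if $k\le r$, and by blowing up the component $\bar B_{i_k}$ if $k>r$. The result is $A_{r+s}$. The relation defined by the sequence is the symmetric relation $\sim$ on the set of indices of the components for which $i_k\sim j_k$ and $j_k\sim i_k$ for $k\le r$, $i_k\sim i_k$ for $r<k\le r+s$, and no other indices are related. **Theorem.** Let $A$ be a basic finite dimensional algebra over $\Bbbk$. The following are equivalent: 1. $A$ is nodal. 2. $A$ is isomorphic to an algebra obtained from a basic hereditary algebra by a suitable sequence of gluings and blowings up of simple components. 3. $A$ is given by a quiver and a relation: there are a finite quiver $\Gamma$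 without oriented cycles and a symmetric relation $\sim$ on the set of its vertices, with $\#\{j\mid i\sim j\}\le1$ for each vertex $i$, such that $A$ is isomorphic to an algebra obtained from the path algebra $\Bbbk\Gamma$ (whose simple components correspond to the vertices of $\Gamma$) by a suitable sequence of gluings and blowings up that defines the relation $\sim$. -/

import Mathlib

open scoped TensorProduct

noncomputable section

namespace Nodal

universe u v

/-! ### Basic, hereditary and nodal algebras -/

/-- A `k`-algebra is *basic* if its quotient by the radical is isomorphic to `k ^ s` for some `s`. -/
def IsBasic (k : Type u) [Field k] (A : Type v) [Ring A] [Algebra k A] : Prop :=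
  ∃ s : ℕ, Nonempty ((A ⧸ Ring.jacobson A) ≃ₐ[k] (Fin s → k))

/-- A ring is (left) *hereditary* if all its left ideals are projective. (For finite dimensional
algebras left hereditary and right hereditary are the same.) -/
def IsHereditary (R : Type v) [Ring R] : Prop :=
  ∀ I : Ideal R, Module.Projective R I

section Induced

variable {A : Type v} {H : Type u} [Ring A] [Ring H] (f : A →+* H)
  (U : Type v) [AddCommGroup U] [Module A U]

/-- The relations `(h a) ⊗ u = h ⊗ (a u)` which have to be imposed on `H ⊗[ℤ] U` in order to get
the tensor product `H ⊗_A U`; here `H` is a right `A`-module through `f : A → H`. -/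
def balancing : Submodule H (H ⊗[ℤ] U) :=
  Submodule.span H
    {x | ∃ (h : H) (a : A) (u : U), x = (h * f a) ⊗ₜ[ℤ] u - h ⊗ₜ[ℤ] (a • u)}

/-- The left `H`-module `H ⊗_A U` for a ring homomorphism `f : A → H` (of noncommutative rings) and
a left `A`-module `U`. -/
abbrev Induced : Type max u v := (H ⊗[ℤ] U) ⧸ balancing f U

/-- The length of `H ⊗_A U` considered as an `A`-module (through `f`). -/
def inducedLength : ℕ∞ :=
  letI : Module A (Induced f U) := Module.compHom (Induced f U) f
  Module.length A (Induced f U)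

end Induced

/-- A `k`-algebra `A` is *nodal* if it embeds into a finite dimensional hereditary algebra `H` in
such a way that `rad H ⊆ A ⊆ H`, `rad A = rad H` and the `A`-module `H ⊗_A U` is of length at
most `2` for every simple `A`-module `U`. -/
def IsNodal (k : Type u) [Field k] (A : Type v) [Ring A] [Algebra k A] : Prop :=
  ∃ (H : Type u) (_ : Ring H) (_ : Algebra k H) (f : A →ₐ[k] H),
    FiniteDimensional k H ∧ IsHereditary H ∧ Function.Injective f ∧
    (Ring.jacobson H : Set H) ⊆ Set.range f ∧
    f '' (Ring.jacobson A : Set A) = (Ring.jacobson H : Set H) ∧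
    ∀ (U : Type v) [AddCommGroup U] [Module A U], IsSimpleModule A U →
      inducedLength f.toRingHom U ≤ 2

/-! ### Algebras with marked simple components -/

/-- A `k`-algebra `B` with a homomorphism to a product of copies of `k`. It is used for basic
algebras `B`, when this homomorphism is the projection `B → B / rad B = ∏ B_c`, `B_c = k`, onto
the product of the simple components; the components are indexed by the type `comp`. -/
structure MarkedAlgebra (k : Type u) [Field k] where
  /-- the algebra -/
  alg : Type u
  [ring : Ring alg]
  [algebra : Algebra k alg]
  /-- the indices of the simple components -/
  comp : Type
  [fintype : Fintype comp]
  [decEq : DecidableEq comp]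
  /-- the projection onto the product of the simple components -/
  proj : alg →ₐ[k] (comp → k)

attribute [instance] MarkedAlgebra.ring MarkedAlgebra.algebra MarkedAlgebra.fintype
  MarkedAlgebra.decEq

namespace MarkedAlgebra

variable {k : Type u} [Field k]

/-- `B` is a basic finite dimensional algebra and `B.proj` identifies `B / rad B` with `∏ k`. -/
structure IsBasic (B : MarkedAlgebra k) : Prop where
  finite : FiniteDimensional k B.alg
  surjective : Function.Surjective B.proj
  ker_eq : RingHom.ker B.proj = Ring.jacobson B.alg

/-! #### Gluing -/

/-- The subalgebra of `∏ k` consisting of all tuples `x` such that `x i = x j`. -/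
def equalSubalgebra (k : Type u) [Field k] {ι : Type} (i j : ι) : Subalgebra k (ι → k) :=
  AlgHom.equalizer (Pi.evalAlgHom k (fun _ : ι => k) i) (Pi.evalAlgHom k (fun _ : ι => k) j)

/-- The algebra obtained from `B` by *gluing* the components `i` and `j`: the preimage in `B` of
the algebra of all tuples `x ∈ B / rad B` such that `x i = x j`. Its simple components are
the new component `{(x, x)} ⊆ B_i × B_j`, indexed by `none`, and the components of `B` other than
`i` and `j`. -/
def glue (B : MarkedAlgebra k) (i j : B.comp) : MarkedAlgebra k where
  alg := (equalSubalgebra k i j).comap B.proj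
  comp := Option {c : B.comp // c ≠ i ∧ c ≠ j}
  proj := AlgHom.comp
    (AlgHom.pi fun x : Option {c : B.comp // c ≠ i ∧ c ≠ j} =>
      Pi.evalAlgHom k (fun _ : B.comp => k) (x.elim i Subtype.val))
    (B.proj.comp ((equalSubalgebra k i j).comap B.proj).val)

/-- The identification of the components of `B` other than `i`, `j` with components of the
algebra obtained by gluing `i` and `j`; the components `i` and `j` do not survive. -/
def glueKeep (B : MarkedAlgebra k) (i j : B.comp) (c : B.comp) : Option (B.glue i j).comp :=
  if h : c ≠ i ∧ c ≠ j then some (some ⟨c, h⟩) else none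

/-! #### Blowing up -/

/-- A decomposition `1 = ∑ ε_c` into orthogonal idempotents that correspond to the simple components
of `B`. (If `B` is basic, they are primitive, and `ε_c B` is the indecomposable projective right
module `B_c` that corresponds to the component `c`.) -/
structure IsDecomposition (B : MarkedAlgebra k) (ε : B.comp → B.alg) : Prop where
  complete : CompleteOrthogonalIdempotents ε
  proj_eq : ∀ c, B.proj (ε c) = Pi.single c 1

/-- The index set of the summands of `2 B_i ⊕ ⨁_{c ≠ i} B_c`. -/
abbrev BlowIndex {ι : Type} (i : ι) : Type := {c : ι // c ≠ i} ⊕ Fin 2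

/-- The component of `B` that corresponds to a summand of `2 B_i ⊕ ⨁_{c ≠ i} B_c`. -/
def BlowIndex.under {ι : Type} {i : ι} : BlowIndex i → ι :=
  Sum.elim Subtype.val fun _ => i

/-- The right `B`-module `P = 2 B_i ⊕ ⨁_{c ≠ i} B_c`, where `B_c = ε_c B`. -/
abbrev BlowModule (B : MarkedAlgebra k) (ε : B.comp → B.alg) (i : B.comp) : Type u :=
  (x : BlowIndex i) → Submodule.span (B.alg)ᵐᵒᵖ {ε x.under}

/-- The algebra `B' = End_B P`. -/
def BlowEnd (B : MarkedAlgebra k) (ε : B.comp → B.alg) (i : B.comp) : Type u :=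
  Module.End (B.alg)ᵐᵒᵖ (B.BlowModule ε i)

instance (B : MarkedAlgebra k) (ε : B.comp → B.alg) (i : B.comp) : Ring (B.BlowEnd ε i) :=
  inferInstanceAs (Ring (Module.End (B.alg)ᵐᵒᵖ (B.BlowModule ε i)))

instance (B : MarkedAlgebra k) (ε : B.comp → B.alg) (i : B.comp) : Algebra k (B.BlowEnd ε i) :=
  inferInstanceAs (Algebra k (Module.End (B.alg)ᵐᵒᵖ (B.BlowModule ε i)))

/-- An element of `B'` as an endomorphism of `P`. -/
def BlowEnd.toEnd {B : MarkedAlgebra k} {ε : B.comp → B.alg} {i : B.comp} (φ : B.BlowEnd ε i) :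
    Module.End (B.alg)ᵐᵒᵖ (B.BlowModule ε i) := φ

/-- The generator `ε_c` of the summand with number `y` of the module `P`. -/
def blowGen (B : MarkedAlgebra k) (ε : B.comp → B.alg) (i : B.comp) (y : BlowIndex i) :
    B.BlowModule ε i :=
  Pi.single y ⟨ε y.under, Submodule.mem_span_singleton_self _⟩

/-- The entries of the matrix over `B` that corresponds to an endomorphism of `P`: its action from
the summand `y` to the summand `x` is the multiplication from the left by this entry. -/
def blowEntry (B : MarkedAlgebra k) (ε : B.comp → B.alg) (i : B.comp)
    (φ : B.BlowEnd ε i) (x y : BlowIndex i) : B.alg :=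
  (φ.toEnd (B.blowGen ε i y) x : B.alg)

section

variable {B : MarkedAlgebra k} {ε : B.comp → B.alg} {i : B.comp}

theorem IsDecomposition.eq_mul (hε : B.IsDecomposition ε) {c : B.comp} {b : B.alg}
    (hb : b ∈ Submodule.span (B.alg)ᵐᵒᵖ {ε c}) : b = ε c * b := by
  obtain ⟨a, rfl⟩ := Submodule.mem_span_singleton.1 hb
  rw [MulOpposite.smul_eq_mul_unop, ← mul_assoc, (hε.complete.idem c).eq]

theorem blowEntry_mul (hε : B.IsDecomposition ε)
    (φ ψ : B.BlowEnd ε i) (x y : BlowIndex i) :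
    B.blowEntry ε i (φ * ψ) x y =
      ∑ z, B.blowEntry ε i φ x z * B.blowEntry ε i ψ z y := by
  have key : ψ.toEnd (B.blowGen ε i y) =
      ∑ z, MulOpposite.op (B.blowEntry ε i ψ z y) • B.blowGen ε i z := by
    funext w
    apply Subtype.ext
    rw [Finset.sum_apply, Finset.sum_eq_single w]
    · simp only [Pi.smul_apply, blowGen, Pi.single_eq_same, Submodule.coe_smul,
        MulOpposite.smul_eq_mul_unop, MulOpposite.unop_op]
      exact hε.eq_mul (ψ.toEnd (B.blowGen ε i y) w).2
    · intro z _ hz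
      simp [blowGen, Pi.single_eq_of_ne (Ne.symm hz)]
    · simp
  have h2 : (φ * ψ).toEnd (B.blowGen ε i y) =
      ∑ z, MulOpposite.op (B.blowEntry ε i ψ z y) • φ.toEnd (B.blowGen ε i z) := by
    change φ.toEnd (ψ.toEnd (B.blowGen ε i y)) = _
    rw [key, map_sum]
    simp only [map_smul]
  rw [blowEntry, h2, Finset.sum_apply]
  simp [blowEntry, MulOpposite.smul_eq_mul_unop]

theorem proj_blowEntry_mul (hε : B.IsDecomposition ε)
    (φ ψ : B.BlowEnd ε i) (x y z : BlowIndex i) (c : B.comp) :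
    z.under ≠ c → B.proj (B.blowEntry ε i φ x z * B.blowEntry ε i ψ z y) c = 0 := by
  intro hz
  have h : B.blowEntry ε i ψ z y = ε z.under * B.blowEntry ε i ψ z y :=
    hε.eq_mul (ψ.toEnd (B.blowGen ε i y) z).2
  rw [h]
  simp [hε.proj_eq, Pi.single_eq_of_ne (Ne.symm hz)]

end

/-- The projection of `B' = End_B P` onto its semisimple quotient
`B' / rad B' = (∏_{c ≠ i} k) × Mat(2, k)`, given by reducing the entries of the matrix of an
endomorphism of `P` modulo the radical of `B`. -/
def blowReduce (B : MarkedAlgebra k) (ε : B.comp → B.alg) (hε : B.IsDecomposition ε)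
    (i : B.comp) :
    B.BlowEnd ε i →ₐ[k]
      (({c : B.comp // c ≠ i} → k) × Matrix (Fin 2) (Fin 2) k) :=
  AlgHom.ofLinearMap
    { toFun := fun φ : B.BlowEnd ε i =>
        (fun c => B.proj (B.blowEntry ε i φ (.inl c) (.inl c)) c,
          Matrix.of fun s t => B.proj (B.blowEntry ε i φ (.inr s) (.inr t)) i)
      map_add' := by
        intro φ ψ
        have h : ∀ x y, B.blowEntry ε i (φ + ψ) x y =
          B.blowEntry ε i φ x y + B.blowEntry ε i ψ x y := fun _ _ => rfl
        ext <;> simp [h]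
      map_smul' := by
        intro r φ
        have h : ∀ x y, B.blowEntry ε i (r • φ) x y = r • B.blowEntry ε i φ x y :=
          fun _ _ => rfl
        ext <;> simp [h] }
    (by
      have h1 : ∀ x y : BlowIndex i, B.blowEntry ε i 1 x y = if x = y then ε x.under else 0 := by
        intro x y
        change (B.blowGen ε i y x : B.alg) = _
        by_cases h : x = y
        · subst h
          simp only [blowGen, Pi.single_eq_same, if_true]
        · simp only [blowGen, Pi.single_eq_of_ne h, if_neg h, ZeroMemClass.coe_zero]
      ext a b
      · change B.proj (B.blowEntry ε i 1 (.inl a) (.inl a)) a = 1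
        rw [h1, if_pos rfl, hε.proj_eq]
        exact Pi.single_eq_same _ _
      · change B.proj (B.blowEntry ε i 1 (.inr a) (.inr b)) i = (1 : Matrix _ _ k) a b
        rw [h1, Matrix.one_apply]
        by_cases h : a = b
        · subst h
          rw [if_pos rfl, if_pos rfl, hε.proj_eq]
          exact Pi.single_eq_same _ _
        · rw [if_neg (fun e => h (Sum.inr.inj e)), if_neg h, map_zero, Pi.zero_apply])
    (by
      intro φ ψ
      have hcomp : ∀ (c : {c : B.comp // c ≠ i}) (z : BlowIndex i), z ≠ .inl c → z.under ≠ c := by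
        rintro c (d | s) hz
        · intro h
          exact hz (congrArg Sum.inl (Subtype.ext h))
        · exact Ne.symm c.2
      ext a b
      · change B.proj (B.blowEntry ε i (φ * ψ) (.inl a) (.inl a)) a =
          B.proj (B.blowEntry ε i φ (.inl a) (.inl a)) a *
            B.proj (B.blowEntry ε i ψ (.inl a) (.inl a)) a
        rw [blowEntry_mul hε, map_sum, Finset.sum_apply, Finset.sum_eq_single (.inl a)]
        · rw [map_mul, Pi.mul_apply]
        · intro z _ hz
          exact proj_blowEntry_mul hε φ ψ _ _ z a (hcomp a z hz)
        · simp
      · change B.proj (B.blowEntry ε i (φ * ψ) (.inr a) (.inr b)) i =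
          ∑ s, B.proj (B.blowEntry ε i φ (.inr a) (.inr s)) i *
            B.proj (B.blowEntry ε i ψ (.inr s) (.inr b)) i
        rw [blowEntry_mul hε, map_sum, Finset.sum_apply, Fintype.sum_sum_type,
          Finset.sum_eq_zero, zero_add]
        · simp only [map_mul, Pi.mul_apply]
        · intro c _
          exact proj_blowEntry_mul hε φ ψ _ _ (.inl c) i c.2)

/-- The subalgebra of `(∏_{c ≠ i} k) × Mat(2, k)` of all tuples with diagonal matrix part. -/
def diagonalSubalgebra (k : Type u) [Field k] (κ : Type) :
    Subalgebra k ((κ → k) × Matrix (Fin 2) (Fin 2) k) :=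
  ((Matrix.diagonalAlgHom k : (Fin 2 → k) →ₐ[k] Matrix (Fin 2) (Fin 2) k).range).comap
    (AlgHom.snd k (κ → k) (Matrix (Fin 2) (Fin 2) k))

/-- The underlying algebra of the blowing up of the component `i` of `B`: the preimage in
`B' = End_B P` of the algebra of all tuples in `B' / rad B'` whose component in `Mat(2, k)` is a
diagonal matrix. -/
def blowSubalgebra (B : MarkedAlgebra k) (ε : B.comp → B.alg) (hε : B.IsDecomposition ε)
    (i : B.comp) : Subalgebra k (B.BlowEnd ε i) :=
  (diagonalSubalgebra k {c : B.comp // c ≠ i}).comap (B.blowReduce ε hε i)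

/-- The tuple of entries of an element of the previous subalgebra. -/
def diagonalEntries (k : Type u) [Field k] (κ : Type) :
    diagonalSubalgebra k κ →ₐ[k] (κ ⊕ Fin 2 → k) :=
  AlgHom.ofLinearMap
    { toFun := fun a => Sum.elim a.1.1 fun s => a.1.2 s s
      map_add' := by
        intro a b
        ext (c | s) <;> simp
      map_smul' := by
        intro r a
        ext (c | s) <;> simp }
    (by ext (c | s) <;> simp)
    (by
      rintro ⟨a, d, hd⟩ ⟨b, e, he⟩
      have hd' : a.2 = Matrix.diagonal d := hd.symm
      have he' : b.2 = Matrix.diagonal e := he.symm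
      ext (c | s) <;> simp [hd', he'])

/-- The projection of the blowing up of the component `i` of `B` onto the product of its
simple components: those of `B` other than `i` and two new ones, the diagonal entries. -/
def blowProj (B : MarkedAlgebra k) (ε : B.comp → B.alg) (hε : B.IsDecomposition ε)
    (i : B.comp) : B.blowSubalgebra ε hε i →ₐ[k] (BlowIndex i → k) :=
  (diagonalEntries k {c : B.comp // c ≠ i}).comp
    (((B.blowReduce ε hε i).comp (B.blowSubalgebra ε hε i).val).codRestrict
      (diagonalSubalgebra k {c : B.comp // c ≠ i}) fun a => a.2)

/-- The algebra obtained from `B` by *blowing up* the component `i`. Its simple components are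
those of `B` other than `i` and two new ones, indexed by `Fin 2`. -/
def blowUp (B : MarkedAlgebra k) (ε : B.comp → B.alg) (hε : B.IsDecomposition ε) (i : B.comp) :
    MarkedAlgebra k where
  alg := B.blowSubalgebra ε hε i
  comp := BlowIndex i
  proj := B.blowProj ε hε i

/-- The identification of the components of `B` other than `i` with components of the algebra
obtained by blowing up `i`; the component `i` does not survive. -/
def blowKeep (B : MarkedAlgebra k) (ε : B.comp → B.alg) (hε : B.IsDecomposition ε)
    (i c : B.comp) : Option (B.blowUp ε hε i).comp :=
  if h : c ≠ i then some (Sum.inl ⟨c, h⟩ : BlowIndex i) else none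

/-! #### Suitable sequences of gluings and blowings up -/

/-- `SuitableStep B gl bl C old`: the algebra `C` is obtained from `B` by first gluing the
components `i` and `j` for all pairs `(i, j)` in the list `gl` and then blowing up the components
in the list `bl`, one after another; both lists are written with the latest operation first. At
each step the operation is applied to components that come from components of `B` not involved
before. The partial map `old` indicates which component of `C` is identified with a given component
of `B` (and is `none` on those components that have been glued or blown up). -/
inductive SuitableStep (B : MarkedAlgebra k) :
    List (B.comp × B.comp) → List B.comp →
      (C : MarkedAlgebra k) → (B.comp → Option C.comp) → Prop
  | start : SuitableStep B [] [] B some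
  | glue {gl : List (B.comp × B.comp)} {C : MarkedAlgebra k} {old : B.comp → Option C.comp}
      {i j : B.comp} {a b : C.comp} :
      SuitableStep B gl [] C old → i ≠ j → old i = some a → old j = some b →
      SuitableStep B ((i, j) :: gl) [] (C.glue a b) (fun c => (old c).bind (C.glueKeep a b))
  | blowUp {gl : List (B.comp × B.comp)} {bl : List B.comp} {C : MarkedAlgebra k}
      {old : B.comp → Option C.comp} {i : B.comp} {a : C.comp}
      (ε : C.comp → C.alg) (hε : C.IsDecomposition ε) :
      SuitableStep B gl bl C old → old i = some a →
      SuitableStep B gl (i :: bl) (C.blowUp ε hε a)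
        (fun c => (old c).bind (C.blowKeep ε hε a))

/-- The algebra `A` is isomorphic to an algebra obtained from `B` by the suitable sequence of
gluings of the pairs in `gl` and blowings up of the components in `bl`. All components
that occur in these lists are pairwise different. -/
def SuitablyObtained (B : MarkedAlgebra k) (gl : List (B.comp × B.comp)) (bl : List B.comp)
    (A : Type v) [Ring A] [Algebra k A] : Prop :=
  (gl.map Prod.fst ++ bl ++ gl.map Prod.snd).Nodup ∧
    ∃ (C : MarkedAlgebra k) (old : B.comp → Option C.comp),
      SuitableStep B gl bl C old ∧ Nonempty (A ≃ₐ[k] C.alg)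

end MarkedAlgebra

/-- The symmetric relation given by a suitable sequence: `i ∼ j` and `j ∼ i` if
`i` and `j` are glued, `i ∼ i` if `i` is blown up. -/
def seqRel {ι : Type} (gl : List (ι × ι)) (bl : List ι) (x y : ι) : Prop :=
  (x, y) ∈ gl ∨ (y, x) ∈ gl ∨ (x = y ∧ x ∈ bl)

/-! ### Path algebras -/

/-- A finite quiver: finitely many vertices and arrows. -/
structure FinQuiver where
  /-- the vertices -/
  vert : Type
  [fintype : Fintype vert]
  [decEq : DecidableEq vert]
  [quiver : Quiver.{0} vert]
  finite_arrows : ∀ a b : vert, Finite (a ⟶ b)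

attribute [instance] FinQuiver.fintype FinQuiver.decEq FinQuiver.quiver

/-- A quiver has no oriented cycles: every path from a vertex to itself is empty. -/
def FinQuiver.Acyclic (Γ : FinQuiver) : Prop :=
  ∀ (a : Γ.vert) (p : Quiver.Path a a), p = Quiver.Path.nil

/-- All paths of a quiver, with arbitrary source and target. -/
abbrev FinQuiver.Paths (Γ : FinQuiver) : Type := Σ a b : Γ.vert, Quiver.Path a b

/-- The path algebra `k Γ`: the vector space with the basis of all paths of `Γ`. -/
def PathAlgebra (k : Type u) [Field k] (Γ : FinQuiver) : Type u := Γ.Paths →₀ k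

namespace PathAlgebra

variable {k : Type u} [Field k] {Γ : FinQuiver}

instance : AddCommGroup (PathAlgebra k Γ) := inferInstanceAs (AddCommGroup (Γ.Paths →₀ k))

instance : Module k (PathAlgebra k Γ) := inferInstanceAs (Module k (Γ.Paths →₀ k))

/-- The basis element that corresponds to a path. -/
def ofPath (k : Type u) [Field k] {Γ : FinQuiver} (p : Γ.Paths) : PathAlgebra k Γ :=
  Finsupp.single p (1 : k)

/-- The empty path at a vertex. -/
def nilPath (a : Γ.vert) : Γ.Paths := ⟨a, a, Quiver.Path.nil⟩

/-- The product `p q` of paths: the path `q` followed by the path `p` if the target of `q` is the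
source of `p`, and `0` otherwise. -/
def pathMul (k : Type u) [Field k] {Γ : FinQuiver} (p q : Γ.Paths) : PathAlgebra k Γ :=
  if h : q.2.1 = p.1 then
    ofPath k ⟨q.1, p.2.1, (q.2.2.cast rfl h).comp p.2.2⟩
  else 0

/-- The bilinear extension of the multiplication of paths. -/
def mulLin (k : Type u) [Field k] (Γ : FinQuiver) :
    PathAlgebra k Γ →ₗ[k] PathAlgebra k Γ →ₗ[k] PathAlgebra k Γ :=
  Finsupp.lift (PathAlgebra k Γ →ₗ[k] PathAlgebra k Γ) k Γ.Paths fun p =>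
    Finsupp.lift (PathAlgebra k Γ) k Γ.Paths fun q => pathMul k p q

instance : Mul (PathAlgebra k Γ) := ⟨fun f g => mulLin k Γ f g⟩

instance : One (PathAlgebra k Γ) := ⟨∑ a : Γ.vert, ofPath k (nilPath a)⟩

theorem mul_def (f g : PathAlgebra k Γ) : f * g = mulLin k Γ f g := rfl

theorem one_def : (1 : PathAlgebra k Γ) = ∑ a : Γ.vert, ofPath k (nilPath a) := rfl

theorem lift_ofPath {M : Type*} [AddCommGroup M] [Module k M] (F : Γ.Paths → M) (p : Γ.Paths) :
    Finsupp.lift M k Γ.Paths F (Finsupp.single p (1 : k)) = F p := by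
  simp

theorem ofPath_mul (p q : Γ.Paths) : ofPath k p * ofPath k q = pathMul k p q := by
  have h1 : mulLin k Γ (ofPath k p) =
      Finsupp.lift (PathAlgebra k Γ) k Γ.Paths fun q => pathMul k p q :=
    lift_ofPath _ _
  rw [mul_def, h1]
  exact lift_ofPath _ _

theorem pathMul_of_ne (p q : Γ.Paths) (h : q.2.1 ≠ p.1) : pathMul k p q = 0 := dif_neg h

theorem pathMul_comp {a b c : Γ.vert} (p : Quiver.Path b c) (q : Quiver.Path a b) :
    pathMul k (⟨b, c, p⟩ : Γ.Paths) ⟨a, b, q⟩ = ofPath k ⟨a, c, q.comp p⟩ := by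
  simp [pathMul]

@[elab_as_elim]
theorem induction {P : PathAlgebra k Γ → Prop} (f : PathAlgebra k Γ) (zero : P 0)
    (add : ∀ f g, P f → P g → P (f + g)) (path : ∀ (r : k) (p : Γ.Paths), P (r • ofPath k p)) :
    P f := by
  refine Finsupp.induction_linear (motive := P) f zero add fun p r => ?_
  have h : (Finsupp.single p r : Γ.Paths →₀ k) = (r • ofPath k p : PathAlgebra k Γ) := by
    change _ = r • (Finsupp.single p (1 : k) : Γ.Paths →₀ k)
    rw [Finsupp.smul_single, smul_eq_mul, mul_one]
  rw [h]
  exact path r p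

theorem add_mul' (f g h : PathAlgebra k Γ) : (f + g) * h = f * h + g * h := by
  simp only [mul_def, map_add, LinearMap.add_apply]

theorem mul_add' (f g h : PathAlgebra k Γ) : f * (g + h) = f * g + f * h := by
  simp only [mul_def, map_add]

theorem zero_mul' (f : PathAlgebra k Γ) : 0 * f = 0 := by
  simp only [mul_def, map_zero, LinearMap.zero_apply]

theorem mul_zero' (f : PathAlgebra k Γ) : f * 0 = 0 := by
  simp only [mul_def, map_zero]

theorem smul_mul' (r : k) (f g : PathAlgebra k Γ) : (r • f) * g = r • (f * g) := by
  simp only [mul_def, map_smul, LinearMap.smul_apply]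

theorem mul_smul' (r : k) (f g : PathAlgebra k Γ) : f * (r • g) = r • (f * g) := by
  simp only [mul_def, map_smul]

theorem one_mul' (f : PathAlgebra k Γ) : 1 * f = f := by
  induction f using induction with
  | zero => exact mul_zero' _
  | add f g hf hg => rw [mul_add', hf, hg]
  | path r p =>
    rw [mul_smul', one_def, mul_def, map_sum, LinearMap.sum_apply, Finset.sum_eq_single p.2.1]
    · obtain ⟨a, b, p⟩ := p
      rw [← mul_def, ofPath_mul, nilPath, pathMul_comp, Quiver.Path.comp_nil]
    · intro c _ hc
      rw [← mul_def, ofPath_mul, pathMul_of_ne]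
      exact Ne.symm hc
    · simp

theorem mul_one' (f : PathAlgebra k Γ) : f * 1 = f := by
  induction f using induction with
  | zero => exact zero_mul' _
  | add f g hf hg => rw [add_mul', hf, hg]
  | path r p =>
    rw [smul_mul', one_def, mul_def, map_sum, Finset.sum_eq_single p.1]
    · obtain ⟨a, b, p⟩ := p
      rw [← mul_def, ofPath_mul, nilPath, pathMul_comp, Quiver.Path.nil_comp]
    · intro c _ hc
      rw [← mul_def, ofPath_mul, pathMul_of_ne]
      exact hc
    · simp

theorem assoc_path (p q r : Γ.Paths) :
    pathMul k p q * ofPath k r = ofPath k p * pathMul k q r := by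
  obtain ⟨a, b, p⟩ := p
  obtain ⟨c, d, q⟩ := q
  obtain ⟨e, f, r⟩ := r
  by_cases h : d = a
  · subst h
    by_cases h' : f = c
    · subst h'
      rw [pathMul_comp, pathMul_comp, ofPath_mul, ofPath_mul, pathMul_comp, pathMul_comp,
        Quiver.Path.comp_assoc]
    · rw [pathMul_comp, ofPath_mul, pathMul_of_ne _ _ h', pathMul_of_ne _ _ h', mul_zero']
  · rw [pathMul_of_ne _ _ h, zero_mul']
    by_cases h' : f = c
    · subst h'
      rw [pathMul_comp, ofPath_mul, pathMul_of_ne _ _ h]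
    · rw [pathMul_of_ne _ _ h', mul_zero']

theorem mul_assoc' (f g h : PathAlgebra k Γ) : f * g * h = f * (g * h) := by
  induction f using induction with
  | zero => simp only [zero_mul']
  | add f₁ f₂ h₁ h₂ => simp only [add_mul', h₁, h₂]
  | path r p =>
    induction g using induction with
    | zero => simp only [zero_mul', mul_zero']
    | add g₁ g₂ h₁ h₂ => simp only [add_mul', mul_add', h₁, h₂]
    | path s q =>
      induction h using induction with
      | zero => simp only [mul_zero']
      | add g₁ g₂ h₁ h₂ => simp only [mul_add', h₁, h₂]
      | path t w =>
        simp only [smul_mul', mul_smul', ofPath_mul, assoc_path]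

instance : Ring (PathAlgebra k Γ) :=
  { (inferInstance : AddCommGroup (PathAlgebra k Γ)) with
    mul := (· * ·)
    one := 1
    left_distrib := mul_add'
    right_distrib := add_mul'
    zero_mul := zero_mul'
    mul_zero := mul_zero'
    mul_assoc := mul_assoc'
    one_mul := one_mul'
    mul_one := mul_one' }

instance : Algebra k (PathAlgebra k Γ) := Algebra.ofModule smul_mul' mul_smul'

/-- The coefficients of the empty paths, as a linear map. -/
def nilCoeffLin (k : Type u) [Field k] (Γ : FinQuiver) : PathAlgebra k Γ →ₗ[k] (Γ.vert → k) :=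
  LinearMap.pi fun a => (Finsupp.lapply (nilPath a) : (Γ.Paths →₀ k) →ₗ[k] k)

theorem nilCoeffLin_ofPath (p : Γ.Paths) (a : Γ.vert) [Decidable (p = nilPath a)] :
    nilCoeffLin k Γ (ofPath k p) a = if p = nilPath a then 1 else 0 := by
  classical
  change (Finsupp.single p (1 : k) : Γ.Paths →₀ k) (nilPath a) = _
  rw [Finsupp.single_apply]

theorem nilCoeff_pathMul (p q : Γ.Paths) :
    nilCoeffLin k Γ (pathMul k p q) =
      nilCoeffLin k Γ (ofPath k p) * nilCoeffLin k Γ (ofPath k q) := by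
  classical
  funext x
  rw [Pi.mul_apply, nilCoeffLin_ofPath, nilCoeffLin_ofPath]
  by_cases hp : p = nilPath x
  · by_cases hq : q = nilPath x
    · subst hp hq
      rw [nilPath, pathMul_comp, nilCoeffLin_ofPath]
      simp [nilPath]
    · rw [if_pos hp, if_neg hq, mul_zero]
      subst hp
      obtain ⟨a, b, q⟩ := q
      by_cases h : b = x
      · subst h
        rw [nilPath, pathMul_comp, nilCoeffLin_ofPath, if_neg]
        simpa using hq
      · rw [pathMul_of_ne _ _ h, map_zero, Pi.zero_apply]
  · rw [if_neg hp, zero_mul]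
    obtain ⟨a, b, p⟩ := p
    obtain ⟨c, d, q⟩ := q
    by_cases h : d = a
    · subst h
      rw [pathMul_comp, nilCoeffLin_ofPath, if_neg]
      rintro hx
      apply hp
      obtain ⟨rfl, hx⟩ := Sigma.mk.inj hx
      obtain ⟨rfl, hx⟩ := Sigma.mk.inj (eq_of_heq hx)
      have hl := congrArg Quiver.Path.length (eq_of_heq hx)
      rw [Quiver.Path.length_comp, Quiver.Path.length_nil] at hl
      have hq : q.length = 0 := by omega
      have hp' : p.length = 0 := by omega
      obtain rfl := Quiver.Path.eq_of_length_zero q hq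
      rw [Quiver.Path.eq_nil_of_length_zero p hp']
      rfl
    · rw [pathMul_of_ne _ _ h, map_zero, Pi.zero_apply]

theorem nilCoeff_mul (f g : PathAlgebra k Γ) :
    nilCoeffLin k Γ (f * g) = nilCoeffLin k Γ f * nilCoeffLin k Γ g := by
  induction f using induction with
  | zero => simp
  | add f₁ f₂ h₁ h₂ => simp only [add_mul, map_add, h₁, h₂]
  | path r p =>
    induction g using induction with
    | zero => simp
    | add g₁ g₂ h₁ h₂ => simp only [mul_add, map_add, h₁, h₂]
    | path s q =>
      simp only [smul_mul_assoc, mul_smul_comm, map_smul, ofPath_mul, nilCoeff_pathMul]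

/-- The homomorphism `k Γ → k Γ / J = ∏ k` that annihilates all arrows: it maps an element to
the tuple of its coefficients at the empty paths. -/
def nilCoeff (k : Type u) [Field k] (Γ : FinQuiver) : PathAlgebra k Γ →ₐ[k] (Γ.vert → k) :=
  AlgHom.ofLinearMap (nilCoeffLin k Γ)
    (by
      classical
      funext x
      rw [one_def, map_sum, Finset.sum_apply, Finset.sum_eq_single x]
      · rw [nilCoeffLin_ofPath, if_pos rfl]
        rfl
      · intro y _ hy
        rw [nilCoeffLin_ofPath, if_neg]
        intro h
        exact hy (congrArg Sigma.fst h)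
      · simp)
    nilCoeff_mul

end PathAlgebra

/-- The path algebra of a quiver; its simple components are indexed by the vertices. -/
abbrev pathMarked (k : Type u) [Field k] (Γ : FinQuiver) : MarkedAlgebra k where
  alg := PathAlgebra k Γ
  comp := Γ.vert
  proj := PathAlgebra.nilCoeff k Γ

/-- `A` is isomorphic to an algebra obtained from a basic hereditary algebra by a suitable
sequence of gluings and blowings up of components. -/
def IsObtainedFromHereditary (k : Type u) [Field k] (A : Type v) [Ring A] [Algebra k A] : Prop :=
  ∃ H : MarkedAlgebra k, H.IsBasic ∧ IsHereditary H.alg ∧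
    ∃ (gl : List (H.comp × H.comp)) (bl : List H.comp), H.SuitablyObtained gl bl A

/-- `A` is given by the quiver `Γ` and the relation `rel` on its vertices: it is isomorphic to
an algebra obtained from the path algebra of `Γ` by a suitable sequence of gluings and blowings up
which defines the relation `rel`. -/
def IsGivenBy (k : Type u) [Field k] (Γ : FinQuiver) (rel : Γ.vert → Γ.vert → Prop)
    (A : Type v) [Ring A] [Algebra k A] : Prop :=
  ∃ (gl : List (Γ.vert × Γ.vert)) (bl : List Γ.vert),
    (∀ x y, rel x y ↔ seqRel gl bl x y) ∧ (pathMarked k Γ).SuitablyObtained gl bl A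

end Nodal

end

/-!
# Nodal algebras as gluings and blowings up of hereditary algebras

Nodality of a basic algebra `D` is encoded by a *model* (`IsModel`): a finite dimensional hereditary
algebra `H` with semisimple quotient `π : H → Q`, and an embedding of `D` into `H` as the preimage
of a subalgebra `k ^ comp` of `Q` such that the idempotents `e_x` of `k ^ comp` generate left ideals
`Q e_x` of dimension at most two. Here `Q e_x` is `H ⊗ U` for the simple `D`-module `U` number `x`,
so a basic algebra is nodal if and only if it has a model (`exists_isModel_of_isNodal`,
`IsModel.isNodal`). A component is called a *line* (`IsLine`) if `Q e_x` is one-dimensional.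

**Gluings and blowings up of hereditary algebras are nodal.** A basic hereditary algebra is a model
of itself in which all components are lines. Two lines can be glued (`IsModel.glue`): `H` is the
same, and the new left ideal is the sum of two one-dimensional ones. A line can be blown up
(`IsModel.blowUp`): `H` is replaced by a corner of a matrix ring over `H`, which is hereditary
(`IsHereditary.matrix`, `IsHereditary.corner`), and each of the two new components generates a
column of a `2 × 2` matrix ring. In a suitable sequence every operation is applied to components
that have not been touched before, and untouched components remain lines
(`SuitableStep.exists_isModel`).

**Nodal algebras are obtained from path algebras.** Both operations can be reversed. Since `k` is
algebraically closed, a component `x` which is not a line is of one of two kinds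
(`exists_isSplit_or_isDouble`). If `e_x Q e_x` is two-dimensional, `e_x` is a sum of two orthogonal
idempotents that generate one-dimensional left ideals; the preimage in `H` of the larger product of
fields has these as components, and `D` is obtained from it by gluing them
(`IsModel.isRebuilt_of_split`). Otherwise `e_x` is equivalent to another `e_y`; the corner of `D`
in which the component `y` is deleted has a model in which `x` is a line, and `D` is its blowing up
at `x` (`IsModel.isRebuilt_of_double`). For the latter the equivalence of idempotents is lifted
from `Q` to `H` (`exists_lift_equivalence`), which turns the elements of `D` into matrices over the
corner (`exists_markedIso_blowUp`). As blowings up come last in a suitable sequence, they are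
reversed at first, and then the gluings (`IsModel.exists_isRebuilt`). When all components are lines,
`k ^ comp = Q`, so `D = H` is a basic hereditary algebra.

**Basic hereditary algebras and quivers.** Basic hereditary algebras are the path algebras of
finite quivers without oriented cycles. For the path algebra the radical is the direct sum of the
left ideals generated by the arrows, so it is projective, and a basic algebra with projective
radical is hereditary (`MarkedAlgebra.IsBasic.isHereditary`). Conversely, if the radical is
projective, a basis of the radical modulo its square, adapted to the idempotents, generates it
freely, and this identifies the algebra with a path algebra
(`MarkedAlgebra.IsBasic.exists_markedIso_pathMarked`).
-/

noncomputable section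

namespace Nodal

universe u v

/-! ### Hereditary rings -/

section Hereditary

variable {R : Type*} [Ring R]

theorem IsHereditary.of_ringEquiv {S : Type*} [Ring S] (φ : R ≃+* S) (hR : IsHereditary R) :
    IsHereditary S := by
  intro I
  have := hR (I.comap φ)
  have := RingHomInvPair.of_ringEquiv φ
  have := RingHomInvPair.symm (φ : R →+* S) (φ.symm : S →+* R)
  refine Module.Projective.of_equiv (M := I.comap φ) (σ := (φ : R →+* S))
    (σ' := (φ.symm : S →+* R)) ?_
  exact
    { toFun := fun x => ⟨φ x.1, x.2⟩
      invFun := fun y => ⟨φ.symm y.1, by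
        change φ (φ.symm y.1) ∈ I
        rw [φ.apply_symm_apply]
        exact y.2⟩
      map_add' := fun x y => Subtype.ext (by simp)
      map_smul' := fun r x => Subtype.ext (by simp)
      left_inv := fun x => Subtype.ext (by simp)
      right_inv := fun x => Subtype.ext (by simp) }

/-- Every submodule of a finite power of a hereditary ring is projective: the projection to one
factor splits off a left ideal. -/
theorem IsHereditary.submodule_pi (hR : IsHereditary R) (n : ℕ) (N : Submodule R (Fin n → R)) :
    Module.Projective R N := by
  induction n with
  | zero =>
    have : Subsingleton N := ⟨fun x y => Subtype.ext (Subsingleton.elim _ _)⟩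
    infer_instance
  | succ n ih =>
    let p : N →ₗ[R] R := (LinearMap.proj 0).comp N.subtype
    let t : (Fin n → R) →ₗ[R] (Fin (n + 1) → R) :=
      LinearMap.pi fun i => Fin.cases 0 (fun j => LinearMap.proj j) i
    have ht0 : ∀ v, t v 0 = 0 := fun v => rfl
    have hts : ∀ v j, t v (Fin.succ j) = v j := fun v j => rfl
    have hN' := ih (N.comap t)
    have hI := hR (LinearMap.range p)
    obtain ⟨s, hs⟩ := LinearMap.exists_rightInverse_of_surjective p.rangeRestrict
      (LinearMap.range_rangeRestrict p)
    have hps : ∀ y, p (s y) = y.1 := fun y => congrArg Subtype.val (LinearMap.congr_fun hs y)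
    have hd : ∀ x : N, t (fun j => (x - s (p.rangeRestrict x)).1 (Fin.succ j)) =
        (x - s (p.rangeRestrict x)).1 := by
      intro x
      funext i
      refine Fin.cases ?_ (fun j => ?_) i
      · rw [ht0]
        have := hps (p.rangeRestrict x)
        change (s _).1 0 = x.1 0 at this
        simp [this]
      · rw [hts]
    refine Module.Projective.of_split (M := N.comap t × LinearMap.range p)
      (LinearMap.prod
        { toFun := fun x => ⟨fun j => (x - s (p.rangeRestrict x)).1 (Fin.succ j), by
            rw [Submodule.mem_comap, hd]
            exact Subtype.prop _⟩
          map_add' := fun x y => by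
            apply Subtype.ext
            funext j
            simp only [map_add, Submodule.coe_sub, Submodule.coe_add, Pi.sub_apply, Pi.add_apply]
            abel
          map_smul' := fun r x => by
            apply Subtype.ext
            funext j
            simp [mul_sub] }
        p.rangeRestrict)
      (LinearMap.coprod (t.submoduleComap N) s) ?_
    ext1 x
    apply Subtype.ext
    change t (fun j => (x - s (p.rangeRestrict x)).1 (Fin.succ j)) +
      (s (p.rangeRestrict x)).1 = x.1
    rw [hd]
    simp

theorem IsHereditary.matrix (hR : IsHereditary R) (X : Type*) [Fintype X] [DecidableEq X] :
    IsHereditary (Matrix X X R) := by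
  intro L
  cases isEmpty_or_nonempty X with
  | inl h =>
    have : Subsingleton L := ⟨fun x y => Subtype.ext (Subsingleton.elim _ _)⟩
    infer_instance
  | inr h =>
    obtain ⟨o⟩ := h
    -- the module of rows of matrices from `L`
    let N : Submodule R (X → R) :=
      { carrier := {v | Matrix.of (fun i => if i = o then v else 0) ∈ L}
        zero_mem' := by
          change Matrix.of _ ∈ L
          convert L.zero_mem
          ext i j
          simp
        add_mem' := fun {v w} hv hw => by
          change Matrix.of _ ∈ L
          convert L.add_mem hv hw
          ext i j
          by_cases h : i = o <;> simp [h]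
        smul_mem' := fun r v hv => by
          change Matrix.of _ ∈ L
          convert L.mul_mem_left (Matrix.diagonal fun _ => r) hv
          ext i j
          by_cases h : i = o <;> simp [h] }
    have hrow : ∀ M ∈ L, ∀ i, M i ∈ N := by
      intro M hM i
      change Matrix.of _ ∈ L
      convert L.mul_mem_left (Matrix.single o i 1) hM
      ext a b
      by_cases h : a = o
      · subst h
        simp
      · simp [h]
    have hN : Module.Projective R N := by
      let φ := LinearEquiv.funCongrLeft R R (Fintype.equivFin X).symm
      have := hR.submodule_pi _ (N.map φ.toLinearMap)
      exact Module.Projective.of_equiv (φ.submoduleMap N).symm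
    obtain ⟨s, hs⟩ := Module.projective_def'.1 hN
    have hs' : ∀ v : N, ∀ j, (s v).sum (fun n r => r * n.1 j) = v.1 j := by
      intro v j
      have h := congrFun (congrArg Subtype.val (LinearMap.congr_fun hs v)) j
      rw [LinearMap.comp_apply, Finsupp.linearCombination_apply, Finsupp.sum, Submodule.coe_sum,
        Finset.sum_apply] at h
      exact h
    let S : L →ₗ[Matrix X X R] (N →₀ Matrix X X R) :=
      { toFun := fun M => ∑ i, Finsupp.mapRange (Matrix.singleAddMonoidHom i o) (map_zero _)
          (s ⟨M.1 i, hrow M.1 M.2 i⟩)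
        map_add' := fun M M' => by
          rw [← Finset.sum_add_distrib]
          refine Finset.sum_congr rfl fun i _ => ?_
          rw [← Finsupp.mapRange_add (map_add _), ← map_add]
          rfl
        map_smul' := fun A M => by
          have h : ∀ i, s ⟨(A • M).1 i, hrow _ (A • M).2 i⟩ =
              ∑ j, A i j • s ⟨M.1 j, hrow M.1 M.2 j⟩ := by
            intro i
            simp only [← map_smul]
            rw [← map_sum]
            congr 1
            apply Subtype.ext
            funext l
            simp [Matrix.mul_apply]
          ext n a b
          simp only [h]
          simp [Finsupp.finsetSum_apply, Matrix.sum_apply, Matrix.single_apply, Matrix.mul_apply]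
          by_cases hb : o = b <;> simp [hb] }
    refine Module.Projective.of_split S (Finsupp.linearCombination (Matrix X X R)
      fun n : N => (⟨Matrix.of fun i => if i = o then n.1 else 0, n.2⟩ : L)) ?_
    ext M i j
    change L.subtype (Finsupp.linearCombination _ _ (∑ i, Finsupp.mapRange _ _ _)) i j = _
    rw [map_sum, map_sum, Matrix.sum_apply, Finset.sum_eq_single i]
    · rw [Finsupp.linearCombination_apply, Finsupp.sum_mapRange_index (by simp), Finsupp.sum,
        map_sum, Matrix.sum_apply]
      refine Eq.trans ?_ (hs' ⟨M.1 i, hrow M.1 M.2 i⟩ j)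
      refine Finset.sum_congr rfl fun n _ => ?_
      simp [Matrix.mul_apply, Matrix.single_apply]
    · intro a _ ha
      rw [Finsupp.linearCombination_apply, Finsupp.sum_mapRange_index (by simp), Finsupp.sum,
        map_sum, Matrix.sum_apply]
      refine Finset.sum_eq_zero fun n _ => ?_
      simp [Matrix.mul_apply, ha]
    · simp

end Hereditary

section Corner

variable {R : Type*} [Ring R] {e : R}

/-- The map `r ↦ e r e` from `R` to the corner ring `e R e`. -/
def toCorner (he : IsIdempotentElem e) : R →+ he.Corner where
  toFun r := ⟨e * r * e, r, rfl⟩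
  map_zero' := Subtype.ext (by simp; rfl)
  map_add' x y := Subtype.ext <|
    show e * (x + y) * e = e * x * e + e * y * e by rw [mul_add, add_mul]

theorem toCorner_val (he : IsIdempotentElem e) (r : R) : (toCorner he r).1 = e * r * e := rfl

variable (he : IsIdempotentElem e)

theorem corner_mul_left (x : he.Corner) : e * x.1 = x.1 :=
  ((Subsemigroup.mem_corner_iff he).1 x.2).1

theorem corner_mul_right (x : he.Corner) : x.1 * e = x.1 :=
  ((Subsemigroup.mem_corner_iff he).1 x.2).2

@[simp] theorem corner_val_mul (x y : he.Corner) : (x * y).1 = x.1 * y.1 := rfl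
@[simp] theorem corner_val_zero : (0 : he.Corner).1 = 0 := rfl
@[simp] theorem corner_val_add (x y : he.Corner) : (x + y).1 = x.1 + y.1 := rfl

theorem corner_ext {x y : he.Corner} (h : x.1 = y.1) : x = y := Subtype.ext h

instance {k : Type*} [CommRing k] [Algebra k R] : SMul k he.Corner :=
  ⟨fun c x => ⟨c • x.1, c • x.1, by simp [corner_mul_left, corner_mul_right]⟩⟩

@[simp] theorem corner_val_smul {k : Type*} [CommRing k] [Algebra k R] (c : k) (x : he.Corner) :
    (c • x).1 = c • x.1 := rfl

instance {k : Type*} [CommRing k] [Algebra k R] : Module k he.Corner where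
  one_smul x := corner_ext he (by simp)
  mul_smul a b x := corner_ext he (by simp [mul_smul])
  smul_zero a := corner_ext he (by simp)
  smul_add a x y := corner_ext he (by simp)
  add_smul a b x := corner_ext he (by simp [add_smul])
  zero_smul x := corner_ext he (by simp)

instance {k : Type*} [CommRing k] [Algebra k R] : Algebra k he.Corner :=
  Algebra.ofModule (fun c x y => corner_ext he (by simp)) (fun c x y => corner_ext he (by simp))

/-- The inclusion of a corner ring, as a linear map. -/
def cornerVal (k : Type*) [CommRing k] [Algebra k R] : he.Corner →ₗ[k] R where
  toFun x := x.1
  map_add' _ _ := rfl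
  map_smul' _ _ := rfl

instance {k : Type*} [Field k] [Algebra k R] [FiniteDimensional k R] :
    FiniteDimensional k he.Corner :=
  FiniteDimensional.of_injective (cornerVal he k) Subtype.val_injective

/-- For a left ideal `I` of `e R e` the epimorphism from a sum of copies of `R e` to `R I` splits,
as `R I` is projective. Multiplying the splitting by `e` gives a splitting for `I`. -/
theorem IsHereditary.corner (hR : IsHereditary R) : IsHereditary he.Corner := by
  intro I
  set L : Ideal R := Submodule.span R (Subtype.val '' (I : Set he.Corner)) with hL
  have hmem : ∀ i : I, i.1.1 ∈ L := fun i => Submodule.subset_span ⟨i.1, i.2, rfl⟩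
  have := hR L
  let g : (I →₀ R) →ₗ[R] L := Finsupp.linearCombination R fun i : I => (⟨i.1.1, hmem i⟩ : L)
  have hg : Function.Surjective g := by
    rw [← LinearMap.range_eq_top, Finsupp.range_linearCombination, ← top_le_iff]
    rintro ⟨x, hx⟩ -
    have key : ∀ x (hx : x ∈ L), (⟨x, hx⟩ : L) ∈
        Submodule.span R (Set.range fun i : I => (⟨i.1.1, hmem i⟩ : L)) := by
      intro x hx
      induction hx using Submodule.span_induction with
      | mem x h =>
        obtain ⟨y, hy, rfl⟩ := h
        exact Submodule.subset_span ⟨⟨y, hy⟩, rfl⟩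
      | zero => exact Submodule.zero_mem _
      | add x y hx hy h1 h2 => exact Submodule.add_mem _ h1 h2
      | smul a x hx h => exact Submodule.smul_mem _ a h
    exact key x hx
  obtain ⟨s, hs⟩ := LinearMap.exists_rightInverse_of_surjective g (LinearMap.range_eq_top.2 hg)
  let S : I →ₗ[he.Corner] (I →₀ he.Corner) :=
    { toFun := fun i => Finsupp.mapRange (toCorner he) (map_zero _) (s ⟨i.1.1, hmem i⟩)
      map_add' := fun i j => by
        have : (⟨(i + j).1.1, hmem _⟩ : L) = ⟨i.1.1, hmem i⟩ + ⟨j.1.1, hmem j⟩ := rfl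
        rw [this, map_add]
        exact Finsupp.mapRange_add (map_add _) _ _
      map_smul' := fun a i => by
        have : (⟨(a • i).1.1, hmem _⟩ : L) = a.1 • ⟨i.1.1, hmem i⟩ := rfl
        rw [this, map_smul]
        ext j
        have : (s ⟨i.1.1, hmem i⟩) = e • (s ⟨i.1.1, hmem i⟩) := by
          rw [← map_smul]
          congr 1
          exact Subtype.ext (corner_mul_left he _).symm
        rw [this]
        apply corner_ext
        simp [toCorner_val, ← mul_assoc, corner_mul_left, corner_mul_right, he.eq] }
  refine Module.Projective.of_split S (Finsupp.linearCombination he.Corner fun i : I => i) ?_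
  ext i
  have h1 := congrArg Subtype.val (LinearMap.congr_fun hs ⟨i.1.1, hmem i⟩)
  simp only [LinearMap.comp_apply, LinearMap.id_apply, g, Finsupp.linearCombination_apply,
    Finsupp.sum, Submodule.coe_sum, Submodule.coe_smul, smul_eq_mul] at h1
  apply corner_ext
  change cornerVal he ℤ ((Finsupp.linearCombination he.Corner (fun i : I => i)
    (Finsupp.mapRange (toCorner he) (map_zero _) (s ⟨i.1.1, hmem i⟩)) : I).1) = i.1.1
  rw [Finsupp.linearCombination_apply, Finsupp.sum_mapRange_index (by simp), Finsupp.sum,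
    Submodule.coe_sum, map_sum]
  conv_rhs => rw [← corner_mul_left he, ← h1, Finset.mul_sum]
  refine Finset.sum_congr rfl fun j _ => ?_
  change e * _ * e * j.1.1 = _
  rw [mul_assoc, corner_mul_left, mul_assoc]

end Corner

/-! ### Nil ideals and basic algebras -/

section Nil

variable {R : Type*} [Ring R]

theorem mem_jacobson_of_forall_isNilpotent {x : R} (h : ∀ y, IsNilpotent (y * x)) :
    x ∈ Ring.jacobson R := by
  rw [← Ideal.jacobson_bot, Ideal.mem_jacobson_iff]
  intro y
  obtain ⟨z, hz⟩ := (h y).isUnit_one_add.exists_left_inv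
  refine ⟨z, ?_⟩
  rw [Ideal.mem_bot, ← sub_eq_zero.2 hz]
  noncomm_ring

theorem isNilpotent_of_mem_jacobson [IsArtinianRing R] {x : R} (hx : x ∈ Ring.jacobson R) :
    IsNilpotent x := by
  obtain ⟨n, hn⟩ := IsSemiprimaryRing.isNilpotent (R := R)
  exact ⟨n, by simpa [hn] using Ideal.pow_mem_pow hx n⟩

/-- If `S` has no nonzero nilpotent ideals (in the form: `z S z = 0` implies `z = 0`) and the kernel
of an epimorphism `R → S` is nil, then this kernel is the radical of `R`. -/
theorem jacobson_eq_ker [IsArtinianRing R] {S : Type*} [Ring S] (π : R →+* S)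
    (hπ : Function.Surjective π) (hnil : ∀ r, π r = 0 → IsNilpotent r)
    (hS : ∀ z : S, (∀ w, z * w * z = 0) → z = 0) : Ring.jacobson R = RingHom.ker π := by
  apply le_antisymm
  · obtain ⟨n, hn⟩ := IsSemiprimaryRing.isNilpotent (R := R)
    have key : ∀ m, ∀ x ∈ Ring.jacobson R ^ (m + 1), π x = 0 := by
      intro m
      induction hd : n - m using Nat.strong_induction_on generalizing m with
      | _ d ih =>
        intro x hx
        by_cases hm : n ≤ m
        · have : x ∈ Ring.jacobson R ^ n := Ideal.pow_le_pow_right (by omega) hx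
          rw [hn] at this
          rw [(Submodule.mem_bot R).1 this, map_zero]
        · apply hS
          intro w
          obtain ⟨r, rfl⟩ := hπ w
          rw [← map_mul, ← map_mul]
          refine ih (n - (m + 1)) (by omega) (m + 1) rfl _ ?_
          rw [Ideal.IsTwoSided.pow_succ]
          have h1 : x ∈ Ring.jacobson R := Ideal.pow_le_self (by omega) hx
          exact Ideal.mul_mem_mul (Ideal.mul_mem_right _ _ h1) hx
    intro x hx
    refine key 0 x ?_
    rwa [zero_add, Submodule.pow_one]
  · intro x hx
    refine mem_jacobson_of_forall_isNilpotent fun y => hnil _ ?_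
    rw [map_mul, (RingHom.mem_ker).1 hx, mul_zero]

theorem semiprime_quotient_jacobson [IsArtinianRing R] (z : R ⧸ Ring.jacobson R)
    (h : ∀ w, z * w * z = 0) : z = 0 := by
  have : z ∈ Ring.jacobson (R ⧸ Ring.jacobson R) := by
    refine mem_jacobson_of_forall_isNilpotent fun y => ⟨2, ?_⟩
    rw [pow_two, mul_assoc, ← mul_assoc z, h, mul_zero]
  rwa [Ring.jacobson_quotient_jacobson] at this

end Nil

namespace MarkedAlgebra

variable {k : Type u} [Field k] {B : MarkedAlgebra k}

theorem isBasic_of_nil [FiniteDimensional k B.alg] (hs : Function.Surjective B.proj)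
    (hnil : ∀ b, B.proj b = 0 → IsNilpotent b) : B.IsBasic := by
  have := IsArtinianRing.of_finite k B.alg
  refine ⟨inferInstance, hs, ?_⟩
  rw [jacobson_eq_ker B.proj.toRingHom hs hnil]
  · rfl
  · intro z hz
    have := hz 1
    rw [mul_one] at this
    exact funext fun c => mul_self_eq_zero.1 (congrFun this c)

theorem IsBasic.isNilpotent (hB : B.IsBasic) {b : B.alg} (hb : B.proj b = 0) : IsNilpotent b := by
  have := hB.finite
  have := IsArtinianRing.of_finite k B.alg
  apply isNilpotent_of_mem_jacobson
  rw [← hB.ker_eq]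
  exact hb

theorem IsBasic.exists_ker_pow_eq_bot (hB : B.IsBasic) : ∃ n, RingHom.ker B.proj ^ n = ⊥ := by
  have := hB.finite
  have := IsArtinianRing.of_finite k B.alg
  rw [hB.ker_eq]
  exact IsSemiprimaryRing.isNilpotent

theorem IsBasic.exists_isDecomposition (hB : B.IsBasic) : ∃ ε, B.IsDecomposition ε := by
  obtain ⟨ε, h1, h2⟩ := CompleteOrthogonalIdempotents.lift_of_isNilpotent_ker
    (f := B.proj.toRingHom) (fun x hx => hB.isNilpotent hx)
    (CompleteOrthogonalIdempotents.single fun _ : B.comp => k) (fun i => hB.surjective _)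
  exact ⟨ε, h1, fun c => congrFun h2 c⟩

theorem IsDecomposition.proj_apply {ε : B.comp → B.alg} (hε : B.IsDecomposition ε) (c d : B.comp) :
    B.proj (ε c) d = if d = c then 1 else 0 := by
  rw [hε.proj_eq, Pi.single_apply]

theorem IsDecomposition.proj_mul_sub {ε : B.comp → B.alg} (hε : B.IsDecomposition ε) (r : B.alg)
    (c : B.comp) : B.proj (r * ε c - B.proj r c • ε c) = 0 := by
  funext d
  by_cases h : d = c
  · subst h; simp [hε.proj_apply]
  · simp [hε.proj_apply, h]

/-- A finite dimensional basic algebra is hereditary if its radical is projective. By induction, a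
left ideal `I` is contained in a projective left ideal `I + R x` such that `(I + R x) / I` is a
simple module `R / 𝔪`, and Schanuel's lemma applies since `𝔪`, which is the sum of `(rad R) ε` and
`R (1 - ε)`, is projective. -/
theorem IsBasic.isHereditary (hB : B.IsBasic)
    (hJ : Module.Projective B.alg (RingHom.ker B.proj)) : IsHereditary B.alg := by
  have := hB.finite
  have hnoeth : IsNoetherianRing B.alg := IsNoetherianRing.of_finite k B.alg
  obtain ⟨ε, hε⟩ := hB.exists_isDecomposition
  obtain ⟨N, hN⟩ := hB.exists_ker_pow_eq_bot
  intro I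
  induction I using WellFoundedGT.induction with
  | ind I ih =>
  by_cases hI : I = ⊤
  · subst hI
    exact Module.Projective.of_equiv (Submodule.topEquiv (R := B.alg) (M := B.alg)).symm
  classical
  -- an element `x` of some `ε c * B` outside `I` such that `(rad B) * x` is contained in `I`
  have hex : ∃ n, RingHom.ker B.proj ^ n ≤ I := ⟨N, by rw [hN]; exact bot_le⟩
  obtain ⟨n, hn⟩ : ∃ n, Nat.find hex = n + 1 := by
    refine Nat.exists_eq_succ_of_ne_zero fun h => ?_
    have := Nat.find_spec hex
    rw [h, Submodule.pow_zero, Ideal.one_eq_top, top_le_iff] at this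
    exact hI this
  have h1 : ¬ RingHom.ker B.proj ^ n ≤ I := Nat.find_min hex (by omega)
  have h2 : RingHom.ker B.proj ^ (n + 1) ≤ I := hn ▸ Nat.find_spec hex
  obtain ⟨x₀, hx₀, hx₀I⟩ := Set.not_subset.1 h1
  obtain ⟨c, hc⟩ : ∃ c, ε c * x₀ ∉ I := by
    by_contra! h
    apply hx₀I
    rw [← one_mul x₀, ← hε.complete.complete, Finset.sum_mul]
    exact I.sum_mem fun c _ => h c
  set x := ε c * x₀ with hx
  have hJx : ∀ j, B.proj j = 0 → j * x ∈ I := by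
    intro j hj
    apply h2
    rw [Ideal.IsTwoSided.pow_succ]
    exact Ideal.mul_mem_mul hj (Ideal.mul_mem_left _ _ hx₀)
  have hcx : ∀ r, r * x = B.proj r c • x + (r * ε c - B.proj r c • ε c) * x := by
    intro r
    have : ε c * x = x := by rw [hx, ← mul_assoc, (hε.complete.idem c).eq]
    rw [sub_mul, mul_assoc r, smul_mul_assoc, this]
    abel
  have hsub : ∀ r, B.proj (r * ε c - B.proj r c • ε c) = 0 := fun r => hε.proj_mul_sub r c
  have hann : ∀ r, r * x ∈ I ↔ B.proj r c = 0 := by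
    intro r
    rw [hcx, I.add_mem_iff_left (hJx _ (hsub r))]
    constructor
    · intro h
      by_contra h0
      apply hc
      have := I.smul_of_tower_mem (B.proj r c)⁻¹ h
      rwa [smul_smul, inv_mul_cancel₀ h0, one_smul] at this
    · intro h
      rw [h, zero_smul]
      exact I.zero_mem
  set I' : Ideal B.alg := I ⊔ Ideal.span {x} with hI'
  have hI'p : Module.Projective B.alg I' := by
    apply ih
    refine lt_of_le_of_ne le_sup_left fun h => hc ?_
    rw [h]
    exact Ideal.mem_sup_right (Ideal.mem_span_singleton_self x)
  let g : (B.alg × I) →ₗ[B.alg] I' :=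
    LinearMap.coprod
      ((LinearMap.toSpanSingleton B.alg B.alg x).codRestrict I' fun r =>
        Ideal.mem_sup_right (Ideal.mem_span_singleton'.2 ⟨r, rfl⟩))
      (Submodule.inclusion le_sup_left)
  have hg : ∀ r i, (g (r, i)).1 = r * x + i.1 := fun r i => rfl
  obtain ⟨s, hs⟩ := LinearMap.exists_rightInverse_of_surjective g (by
    rw [LinearMap.range_eq_top]
    rintro ⟨y, hy⟩
    obtain ⟨i, hi, z, hz, rfl⟩ := Submodule.mem_sup.1 hy
    obtain ⟨r, rfl⟩ := Ideal.mem_span_singleton'.1 hz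
    exact ⟨(r, ⟨i, hi⟩), Subtype.ext (by rw [hg]; exact add_comm _ _)⟩)
  -- the annihilator of `x` modulo `I`
  let 𝔪 : Ideal B.alg :=
    RingHom.ker ((Pi.evalRingHom (fun _ : B.comp => k) c).comp B.proj.toRingHom)
  have hm : ∀ r, r ∈ 𝔪 ↔ B.proj r c = 0 := fun r => Iff.rfl
  have h𝔪 : Module.Projective B.alg 𝔪 := by
    refine Module.Projective.of_split (M := RingHom.ker B.proj × B.alg)
      (LinearMap.prod
        ((LinearMap.toSpanSingleton B.alg B.alg (ε c)).restrict (p := 𝔪) (q := RingHom.ker B.proj)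
          (fun r hr => by
            have := hsub r
            rw [(hm r).1 hr, zero_smul, sub_zero] at this
            exact this))
        ((LinearMap.toSpanSingleton B.alg B.alg (1 - ε c)).comp 𝔪.subtype))
      (LinearMap.coprod
        ((LinearMap.toSpanSingleton B.alg B.alg (ε c)).restrict (p := RingHom.ker B.proj) (q := 𝔪)
          (fun r hr => by
            rw [hm]
            change B.proj (r * ε c) c = 0
            rw [map_mul, (RingHom.mem_ker).1 hr, zero_mul, Pi.zero_apply]))
        ((LinearMap.toSpanSingleton B.alg B.alg (1 - ε c)).codRestrict 𝔪 (fun r => by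
            rw [hm]
            change B.proj (r * (1 - ε c)) c = 0
            simp [hε.proj_apply]))) ?_
    ext r
    have he := (hε.complete.idem c).eq
    change r.1 * ε c * ε c + r.1 * (1 - ε c) * (1 - ε c) = r.1
    rw [mul_assoc, he, mul_assoc, (hε.complete.idem c).one_sub.eq]
    noncomm_ring
  -- the kernel of the epimorphism `B × I → I'` is isomorphic to `𝔪`
  let κ : LinearMap.ker g →ₗ[B.alg] 𝔪 :=
    ((LinearMap.fst B.alg B.alg I).comp (LinearMap.ker g).subtype).codRestrict 𝔪 fun r => by
      rw [hm, ← hann]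
      have := congrArg Subtype.val r.2
      change (g (r.1.1, r.1.2)).1 = 0 at this
      rw [hg, add_eq_zero_iff_eq_neg] at this
      change r.1.1 * x ∈ I
      rw [this]
      exact I.neg_mem r.1.2.2
  let ν : 𝔪 →ₗ[B.alg] LinearMap.ker g :=
    (LinearMap.prod 𝔪.subtype
      ((-(LinearMap.toSpanSingleton B.alg B.alg x).comp 𝔪.subtype).codRestrict I fun r =>
        I.neg_mem ((hann _).2 r.2))).codRestrict (LinearMap.ker g) fun r => by
      rw [LinearMap.mem_ker]
      apply Subtype.ext
      change r.1 * x + - (r.1 * x) = 0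
      exact add_neg_cancel _
  have hker : Module.Projective B.alg (LinearMap.ker g) := by
    refine Module.Projective.of_split κ ν ?_
    ext1 r
    apply Subtype.ext
    refine Prod.ext rfl (Subtype.ext ?_)
    have := congrArg Subtype.val r.2
    change (g (r.1.1, r.1.2)).1 = 0 at this
    rw [hg, add_comm, add_eq_zero_iff_eq_neg] at this
    exact this.symm
  have hprod : Module.Projective B.alg (B.alg × I) := by
    refine Module.Projective.of_split (M := I' × LinearMap.ker g)
      (LinearMap.prod g ((LinearMap.id - s.comp g).codRestrict (LinearMap.ker g) fun y => by
        rw [LinearMap.mem_ker]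
        have := LinearMap.congr_fun hs (g y)
        simp only [LinearMap.comp_apply, LinearMap.id_apply] at this
        simp [this]))
      (LinearMap.coprod s (LinearMap.ker g).subtype) ?_
    apply LinearMap.ext
    intro y
    change s (g y) + (y - s (g y)) = y
    abel
  exact Module.Projective.of_split (LinearMap.inr B.alg B.alg I) (LinearMap.snd B.alg B.alg I)
    (LinearMap.ext fun _ => rfl)

end MarkedAlgebra

/-! ### Path algebras of acyclic quivers -/

namespace PathAlgebra

variable {k : Type u} [Field k] {Γ : FinQuiver}

/-- All arrows of a quiver. -/
abbrev Arrows (Γ : FinQuiver) : Type := Σ a b : Γ.vert, (a ⟶ b)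

instance : Finite (Arrows Γ) :=
  have := Γ.finite_arrows
  inferInstance

instance : Fintype (Arrows Γ) := Fintype.ofFinite _

/-- An arrow as an element of the path algebra. -/
def ofArrow (k : Type u) [Field k] (α : Arrows Γ) : PathAlgebra k Γ :=
  ofPath k ⟨α.1, α.2.1, α.2.2.toPath⟩

theorem ofPath_cons {a b c : Γ.vert} (p : Quiver.Path a b) (e : b ⟶ c) :
    ofPath k (⟨a, c, p.cons e⟩ : Γ.Paths) = ofArrow k ⟨b, c, e⟩ * ofPath k ⟨a, b, p⟩ := by
  rw [ofArrow, ofPath_mul, pathMul_comp]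
  rfl

theorem nilPath_mul {a b : Γ.vert} (p : Quiver.Path a b) :
    ofPath k (nilPath b) * ofPath k ⟨a, b, p⟩ = ofPath k ⟨a, b, p⟩ := by
  rw [ofPath_mul, nilPath, pathMul_comp, Quiver.Path.comp_nil]

theorem nilPath_mul_nilPath (a : Γ.vert) :
    ofPath k (nilPath a) * ofPath k (nilPath a) = ofPath k (nilPath a) :=
  nilPath_mul _

theorem nilPath_mul_ofArrow (α : Arrows Γ) :
    ofPath k (nilPath α.2.1) * ofArrow k α = ofArrow k α :=
  nilPath_mul _

theorem nilCoeff_nilPath (a b : Γ.vert) :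
    nilCoeff k Γ (ofPath k (nilPath a)) b = if b = a then 1 else 0 := by
  classical
  refine (nilCoeffLin_ofPath (nilPath a) b).trans ?_
  by_cases h : b = a
  · subst h; simp
  · rw [if_neg h, if_neg]
    intro h'
    exact h (congrArg Sigma.fst h').symm

theorem nilCoeff_of_length_pos {a b : Γ.vert} (p : Quiver.Path a b) (hp : 0 < p.length) :
    nilCoeff k Γ (ofPath k ⟨a, b, p⟩) = 0 := by
  classical
  funext c
  refine (nilCoeffLin_ofPath _ c).trans ?_
  rw [if_neg]
  · rfl
  · intro h
    obtain ⟨rfl, h⟩ := Sigma.mk.inj h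
    obtain ⟨rfl, h⟩ := Sigma.mk.inj (eq_of_heq h)
    rw [eq_of_heq h] at hp
    exact absurd hp (lt_irrefl 0)

theorem nilCoeff_ofArrow (α : Arrows Γ) : nilCoeff k Γ (ofArrow k α) = 0 :=
  nilCoeff_of_length_pos _ (by simp)

/-- The family `(x_α)` such that a path `p` of positive length is `∑ x_α α`: if `α` is the first
arrow of `p`, then `x_α` is the rest of `p`, and the other `x_β` are zero. -/
def pathTail (k : Type u) [Field k] : {a b : Γ.vert} → Quiver.Path a b → Arrows Γ → PathAlgebra k Γ
  | _, _, .nil => 0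
  | _, _, .cons (b := b) (c := c) p e => by
    classical
    exact if p.length = 0 then Pi.single ⟨b, c, e⟩ (ofPath k (nilPath c))
      else fun α => ofArrow k ⟨b, c, e⟩ * pathTail k p α

theorem pathTail_cons {a b c : Γ.vert} (p : Quiver.Path a b) (e : b ⟶ c) (hp : p.length ≠ 0)
    (α : Arrows Γ) : pathTail k (p.cons e) α = ofArrow k ⟨b, c, e⟩ * pathTail k p α := by
  rw [pathTail, if_neg hp]

open Classical in
theorem pathTail_arrow {b c : Γ.vert} (e : b ⟶ c) :
    pathTail k e.toPath = Pi.single (⟨b, c, e⟩ : Arrows Γ) (ofPath k (nilPath c)) := by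
  rw [Quiver.Hom.toPath, pathTail, if_pos Quiver.Path.length_nil]

/-- Induction on paths of positive length. -/
theorem posPath_induction {a : Γ.vert}
    {P : ∀ (b : Γ.vert) (p : Quiver.Path a b), 0 < p.length → Prop}
    (arrow : ∀ b (e : a ⟶ b), P b e.toPath (by simp))
    (cons : ∀ b c (p : Quiver.Path a b) (e : b ⟶ c) (hp : 0 < p.length), P b p hp →
      P c (p.cons e) (by simp))
    {b : Γ.vert} (p : Quiver.Path a b) (hp : 0 < p.length) : P b p hp := by
  induction p with
  | nil => exact absurd hp (lt_irrefl 0)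
  | cons p e ih =>
    rcases Nat.eq_zero_or_pos p.length with h | h
    · obtain rfl := Quiver.Path.eq_of_length_zero p h
      obtain rfl := Quiver.Path.eq_nil_of_length_zero p h
      exact arrow _ e
    · exact cons _ _ p e h (ih h)

theorem sum_pathTail {a b : Γ.vert} (p : Quiver.Path a b) (hp : 0 < p.length) :
    ∑ α, pathTail k p α * ofArrow k α = ofPath k ⟨a, b, p⟩ := by
  classical
  induction p, hp using posPath_induction with
  | arrow b e =>
    rw [Finset.sum_eq_single ⟨_, _, e⟩]
    · rw [pathTail_arrow, Pi.single_eq_same]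
      exact nilPath_mul_ofArrow ⟨_, _, e⟩
    · intro β _ h
      rw [pathTail_arrow, Pi.single_eq_of_ne h, zero_mul]
    · simp
  | cons b c p e hp ih =>
    rw [ofPath_cons, ← ih, Finset.mul_sum]
    simp only [pathTail_cons p e hp.ne', mul_assoc]

theorem pathTail_mul_nilPath {a b : Γ.vert} (p : Quiver.Path a b) (α : Arrows Γ) :
    pathTail k p α * ofPath k (nilPath α.2.1) = pathTail k p α := by
  classical
  rcases Nat.eq_zero_or_pos p.length with h | h
  · obtain rfl := Quiver.Path.eq_of_length_zero p h
    obtain rfl := Quiver.Path.eq_nil_of_length_zero p h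
    rw [pathTail]
    exact zero_mul (ofPath k (nilPath α.2.1))
  induction p, h using posPath_induction with
  | arrow b e =>
    rw [pathTail_arrow]
    by_cases h : α = ⟨_, _, e⟩
    · subst h
      rw [Pi.single_eq_same, nilPath_mul_nilPath]
    · rw [Pi.single_eq_of_ne h, zero_mul]
  | cons b c p e hp ih => rw [pathTail_cons p e hp.ne', mul_assoc, ih]

theorem nilPath_mul_pathTail {a b : Γ.vert} (p : Quiver.Path a b) (hp : 0 < p.length)
    (α : Arrows Γ) : ofPath k (nilPath b) * pathTail k p α = pathTail k p α := by
  classical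
  induction p, hp using posPath_induction with
  | arrow b e =>
    rw [pathTail_arrow]
    by_cases h : α = ⟨_, _, e⟩
    · subst h
      rw [Pi.single_eq_same, nilPath_mul_nilPath]
    · rw [Pi.single_eq_of_ne h, mul_zero]
  | cons b c p e hp ih =>
    rw [pathTail_cons p e hp.ne', ← mul_assoc]
    congr 1
    exact nilPath_mul_ofArrow ⟨_, _, e⟩

theorem pathTail_comp {a b c : Γ.vert} (q : Quiver.Path a b) (p : Quiver.Path b c)
    (hq : 0 < q.length) (α : Arrows Γ) :
    pathTail k (q.comp p) α = ofPath k ⟨b, c, p⟩ * pathTail k q α := by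
  induction p with
  | nil => exact (nilPath_mul_pathTail q hq α).symm
  | cons p e ih =>
    rw [Quiver.Path.comp_cons, pathTail_cons _ _ (by rw [Quiver.Path.length_comp]; omega), ih,
      ofPath_cons, mul_assoc]

/-- The linear extension of `pathTail`. -/
def tail (k : Type u) [Field k] (Γ : FinQuiver) :
    PathAlgebra k Γ →ₗ[k] (Arrows Γ → PathAlgebra k Γ) :=
  Finsupp.lift (Arrows Γ → PathAlgebra k Γ) k Γ.Paths fun p => pathTail k p.2.2

theorem tail_ofPath {a b : Γ.vert} (p : Quiver.Path a b) :
    tail k Γ (ofPath k ⟨a, b, p⟩) = pathTail k p :=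
  lift_ofPath _ _

theorem tail_nilPath (a : Γ.vert) : tail k Γ (ofPath k (nilPath a)) = 0 :=
  (tail_ofPath (Quiver.Path.nil : Quiver.Path a a)).trans (by rw [pathTail])

theorem eq_add_sum_tail (x : PathAlgebra k Γ) :
    x = ∑ a, nilCoeff k Γ x a • ofPath k (nilPath a) + ∑ α, tail k Γ x α * ofArrow k α := by
  induction x using induction with
  | zero => simp
  | add f g hf hg =>
    conv_lhs => rw [hf, hg]
    simp only [map_add, Pi.add_apply, add_smul, add_mul, Finset.sum_add_distrib]
    abel
  | path r p =>
    obtain ⟨a, b, p⟩ := p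
    rw [map_smul, map_smul]
    simp only [Pi.smul_apply, smul_eq_mul, mul_smul, smul_mul_assoc, ← Finset.smul_sum, ← smul_add]
    congr 1
    rcases Nat.eq_zero_or_pos p.length with h | h
    · obtain rfl := Quiver.Path.eq_of_length_zero p h
      obtain rfl := Quiver.Path.eq_nil_of_length_zero p h
      change ofPath k (nilPath a) = ∑ b, nilCoeff k Γ (ofPath k (nilPath a)) b • _ +
        ∑ α, tail k Γ (ofPath k (nilPath a)) α * _
      rw [tail_nilPath, Finset.sum_eq_single a]
      · simp [nilCoeff_nilPath]
      · intro c _ hc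
        simp [nilCoeff_nilPath, hc]
      · simp
    · rw [nilCoeff_of_length_pos p h, tail_ofPath, sum_pathTail p h]
      simp

theorem tail_mul_nilPath (x : PathAlgebra k Γ) (α : Arrows Γ) :
    tail k Γ x α * ofPath k (nilPath α.2.1) = tail k Γ x α := by
  induction x using induction with
  | zero => simp
  | add f g hf hg => simp only [map_add, Pi.add_apply, add_mul, hf, hg]
  | path r p => rw [map_smul, Pi.smul_apply, smul_mul_assoc, tail_ofPath, pathTail_mul_nilPath]

theorem tail_mul_of_length_pos (x : PathAlgebra k Γ) {a b : Γ.vert} (q : Quiver.Path a b)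
    (hq : 0 < q.length) (α : Arrows Γ) :
    tail k Γ (x * ofPath k ⟨a, b, q⟩) α = x * tail k Γ (ofPath k ⟨a, b, q⟩) α := by
  induction x using induction with
  | zero => simp
  | add f g hf hg => simp only [map_add, Pi.add_apply, add_mul, hf, hg]
  | path r p =>
    obtain ⟨c, d, p⟩ := p
    rw [smul_mul_assoc, map_smul, Pi.smul_apply, smul_mul_assoc, ofPath_mul]
    congr 1
    by_cases h : b = c
    · subst h
      rw [pathMul_comp, tail_ofPath, tail_ofPath, pathTail_comp q p hq]
    · rw [pathMul_of_ne _ _ h, map_zero, Pi.zero_apply, tail_ofPath,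
        ← nilPath_mul_pathTail q hq, ← mul_assoc, ofPath_mul, pathMul_of_ne _ _ h, zero_mul]

theorem tail_mul (x y : PathAlgebra k Γ) (hy : nilCoeff k Γ y = 0) (α : Arrows Γ) :
    tail k Γ (x * y) α = x * tail k Γ y α := by
  have key : ∀ y, tail k Γ (x * y) α =
      x * tail k Γ y α + ∑ a, nilCoeff k Γ y a • tail k Γ (x * ofPath k (nilPath a)) α := by
    intro y
    induction y using induction with
    | zero => simp
    | add f g hf hg =>
      simp only [mul_add, map_add, Pi.add_apply, hf, hg, add_smul, Finset.sum_add_distrib]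
      abel
    | path r p =>
      obtain ⟨a, b, p⟩ := p
      rw [mul_smul_comm, map_smul, map_smul, map_smul]
      simp only [Pi.smul_apply, smul_eq_mul, mul_smul, mul_smul_comm, ← Finset.smul_sum, ← smul_add]
      congr 1
      rcases Nat.eq_zero_or_pos p.length with h | h
      · obtain rfl := Quiver.Path.eq_of_length_zero p h
        obtain rfl := Quiver.Path.eq_nil_of_length_zero p h
        change tail k Γ (x * ofPath k (nilPath a)) α = x * tail k Γ (ofPath k (nilPath a)) α +
          ∑ b, nilCoeff k Γ (ofPath k (nilPath a)) b • _
        rw [tail_nilPath, Finset.sum_eq_single a]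
        · simp [nilCoeff_nilPath]
        · intro c _ hc
          simp [nilCoeff_nilPath, hc]
        · simp
      · rw [tail_mul_of_length_pos x p h, nilCoeff_of_length_pos p h]
        simp
  rw [key, hy]
  simp

/-- The ideal of all paths of positive length is projective: it is the direct sum of the left
ideals generated by the arrows. -/
theorem projective_ker_nilCoeff :
    Module.Projective (PathAlgebra k Γ) (RingHom.ker (nilCoeff k Γ)) := by
  refine Module.Projective.of_split (M := Arrows Γ → PathAlgebra k Γ)
    { toFun := fun x => tail k Γ x.1
      map_add' := fun x y => map_add _ _ _
      map_smul' := fun r x => funext fun α => tail_mul r x.1 x.2 α }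
    ((Fintype.linearCombination (PathAlgebra k Γ) (ofArrow k)).codRestrict
      (RingHom.ker (nilCoeff k Γ)) fun x => by
        rw [Fintype.linearCombination_apply]
        exact Ideal.sum_mem _ fun α _ => Ideal.mul_mem_left _ _ (nilCoeff_ofArrow α)) ?_
  ext1 x
  apply Subtype.ext
  have h := eq_add_sum_tail x.1
  rw [(RingHom.mem_ker).1 x.2] at h
  simp only [Pi.zero_apply, zero_smul, Finset.sum_const_zero, zero_add] at h
  exact h.symm

theorem finite_path (hΓ : Γ.Acyclic) (a b : Γ.vert) : Finite (Quiver.Path a b) := by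
  have hwf : WellFounded fun c d : Γ.vert => ∃ p : Quiver.Path c d, 0 < p.length := by
    refine @Finite.wellFounded_of_trans_of_irrefl _ _ _
      ⟨fun c d e ⟨p, hp⟩ ⟨q, hq⟩ => ⟨p.comp q, by rw [Quiver.Path.length_comp]; omega⟩⟩
      ⟨fun c ⟨p, hp⟩ => ?_⟩
    rw [hΓ c p] at hp
    exact absurd hp (lt_irrefl 0)
  have := Γ.finite_arrows
  induction b using hwf.induction with
  | _ b ih =>
  have h1 : ∀ x : Arrows Γ, Finite {p : Quiver.Path a b //
      ∃ (h : x.2.1 = b) (q : Quiver.Path a x.1),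
      p = q.cons (h ▸ x.2.2)} := by
    rintro ⟨c, d, e⟩
    by_cases h : d = b
    · subst h
      have := ih c ⟨e.toPath, by simp⟩
      exact Finite.of_surjective (fun q : Quiver.Path a c => ⟨q.cons e, rfl, q, rfl⟩)
        fun ⟨p, _, q, hq⟩ => ⟨q, Subtype.ext hq.symm⟩
    · have : IsEmpty {p : Quiver.Path a b // ∃ (h : d = b) (q : Quiver.Path a c),
          p = q.cons (h ▸ e)} := ⟨fun ⟨_, h', _⟩ => h h'⟩
      infer_instance
  have h2 : Finite {p : Quiver.Path a b // p.length = 0} := by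
    refine @Finite.of_subsingleton _ ⟨fun ⟨p, hp⟩ ⟨q, hq⟩ => Subtype.ext ?_⟩
    obtain rfl := Quiver.Path.eq_of_length_zero p hp
    exact (hΓ _ p).trans (hΓ _ q).symm
  refine Finite.of_surjective (fun x : {p : Quiver.Path a b // p.length = 0} ⊕ (Σ x : Arrows Γ,
    {p : Quiver.Path a b // ∃ (h : x.2.1 = b) (q : Quiver.Path a x.1), p = q.cons (h ▸ x.2.2)}) =>
      Sum.elim Subtype.val (fun y => y.2.1) x) ?_
  intro p
  cases p with
  | nil => exact ⟨.inl ⟨.nil, rfl⟩, rfl⟩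
  | cons q e => exact ⟨.inr ⟨⟨_, _, e⟩, ⟨q.cons e, rfl, q, rfl⟩⟩, rfl⟩

theorem finite_paths (hΓ : Γ.Acyclic) : Finite Γ.Paths :=
  have := finite_path hΓ
  inferInstance

theorem finiteDimensional (hΓ : Γ.Acyclic) : FiniteDimensional k (PathAlgebra k Γ) := by
  have := finite_paths hΓ
  exact inferInstanceAs (Module.Finite k (Γ.Paths →₀ k))

/-- The span of the paths of length at least `n`. -/
def longPaths (k : Type u) [Field k] (Γ : FinQuiver) (n : ℕ) : Submodule k (PathAlgebra k Γ) :=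
  Submodule.span k (ofPath k '' {p | n ≤ p.2.2.length})

theorem mul_mem_longPaths {m n : ℕ} {x y : PathAlgebra k Γ} (hx : x ∈ longPaths k Γ m)
    (hy : y ∈ longPaths k Γ n) : x * y ∈ longPaths k Γ (m + n) := by
  induction hx using Submodule.span_induction with
  | zero => rw [zero_mul]; exact Submodule.zero_mem _
  | add x x' _ _ h h' => rw [add_mul]; exact Submodule.add_mem _ h h'
  | smul r x _ h => rw [smul_mul_assoc]; exact Submodule.smul_mem _ r h
  | mem x hx =>
    induction hy using Submodule.span_induction with
    | zero => rw [mul_zero]; exact Submodule.zero_mem _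
    | add x x' _ _ h h' => rw [mul_add]; exact Submodule.add_mem _ h h'
    | smul r x _ h => rw [mul_smul_comm]; exact Submodule.smul_mem _ r h
    | mem y hy =>
      obtain ⟨⟨a, b, p⟩, hp, rfl⟩ := hx
      obtain ⟨⟨c, d, q⟩, hq, rfl⟩ := hy
      rw [ofPath_mul]
      by_cases h : d = a
      · subst h
        rw [pathMul_comp]
        refine Submodule.subset_span ⟨_, ?_, rfl⟩
        simp only [Set.mem_ofPred_eq, Quiver.Path.length_comp] at hp hq ⊢
        omega
      · rw [pathMul_of_ne _ _ h]
        exact Submodule.zero_mem _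

theorem mem_longPaths_one {x : PathAlgebra k Γ} (hx : nilCoeff k Γ x = 0) :
    x ∈ longPaths k Γ 1 := by
  have key : ∀ x, x - ∑ a, nilCoeff k Γ x a • ofPath k (nilPath a) ∈ longPaths k Γ 1 := by
    intro x
    induction x using induction with
    | zero => simp
    | add f g hf hg =>
      convert Submodule.add_mem _ hf hg using 1
      simp only [map_add, Pi.add_apply, add_smul, Finset.sum_add_distrib]
      abel
    | path r p =>
      rw [map_smul]
      simp only [Pi.smul_apply, smul_eq_mul, mul_smul, ← Finset.smul_sum, ← smul_sub]
      apply Submodule.smul_mem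
      obtain ⟨a, b, p⟩ := p
      rcases Nat.eq_zero_or_pos p.length with h | h
      · obtain rfl := Quiver.Path.eq_of_length_zero p h
        obtain rfl := Quiver.Path.eq_nil_of_length_zero p h
        change ofPath k (nilPath a) - ∑ b, nilCoeff k Γ (ofPath k (nilPath a)) b • _ ∈ _
        rw [Finset.sum_eq_single a]
        · simp [nilCoeff_nilPath]
        · intro c _ hc
          simp [nilCoeff_nilPath, hc]
        · simp
      · rw [nilCoeff_of_length_pos p h]
        simp only [Pi.zero_apply, zero_smul, Finset.sum_const_zero, sub_zero]
        exact Submodule.subset_span ⟨_, h, rfl⟩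
  have := key x
  rw [hx] at this
  simpa using this

theorem isNilpotent_of_nilCoeff_eq_zero (hΓ : Γ.Acyclic) {x : PathAlgebra k Γ}
    (hx : nilCoeff k Γ x = 0) : IsNilpotent x := by
  have := finite_paths hΓ
  obtain ⟨N, hN⟩ := (Set.finite_range fun p : Γ.Paths => p.2.2.length).bddAbove
  have hpow : ∀ n, x ^ (n + 1) ∈ longPaths k Γ (n + 1) := by
    intro n
    induction n with
    | zero => simpa using mem_longPaths_one hx
    | succ n ih => rw [pow_succ]; exact mul_mem_longPaths ih (mem_longPaths_one hx)
  refine ⟨N + 1, ?_⟩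
  have h := hpow N
  have hempty : {p : Γ.Paths | N + 1 ≤ p.2.2.length} = ∅ := by
    ext p
    have : p.2.2.length ≤ N := hN ⟨p, rfl⟩
    simp only [Set.mem_ofPred_eq, Set.mem_empty_iff_false, iff_false]
    omega
  rw [longPaths, hempty, Set.image_empty, Submodule.span_empty] at h
  exact (Submodule.mem_bot k).1 h

theorem nilCoeff_surjective : Function.Surjective (nilCoeff k Γ) := by
  intro t
  refine ⟨∑ a, t a • ofPath k (nilPath a), ?_⟩
  funext b
  simp [map_sum, nilCoeff_nilPath]

end PathAlgebra

theorem pathMarked_isBasic {k : Type u} [Field k] {Γ : FinQuiver} (hΓ : Γ.Acyclic) :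
    (pathMarked k Γ).IsBasic := by
  have : FiniteDimensional k (pathMarked k Γ).alg := PathAlgebra.finiteDimensional hΓ
  exact MarkedAlgebra.isBasic_of_nil PathAlgebra.nilCoeff_surjective
    fun b hb => PathAlgebra.isNilpotent_of_nilCoeff_eq_zero hΓ hb

theorem pathMarked_isHereditary {k : Type u} [Field k] {Γ : FinQuiver} (hΓ : Γ.Acyclic) :
    IsHereditary (pathMarked k Γ).alg :=
  (pathMarked_isBasic hΓ).isHereditary PathAlgebra.projective_ker_nilCoeff

/-! ### Basic hereditary algebras are path algebras -/

/-- An isomorphism of algebras together with a compatible bijection between the simple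
components. -/
structure MarkedIso {k : Type u} [Field k] (B C : MarkedAlgebra k) where
  /-- the isomorphism of algebras -/
  equiv : B.alg ≃ₐ[k] C.alg
  /-- the bijection of simple components -/
  comp : B.comp ≃ C.comp
  proj_equiv : ∀ b c, C.proj (equiv b) (comp c) = B.proj b c

namespace MarkedAlgebra

variable {k : Type u} [Field k] {B : MarkedAlgebra k}

/-- Elements `α a`, with source `s a` and target `t a`, that form a basis of the radical modulo its
square. -/
structure IsArrowBasis (B : MarkedAlgebra k) (ε : B.comp → B.alg) {I : Type} [Fintype I]
    (s t : I → B.comp) (α : I → B.alg) : Prop where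
  proj_eq : ∀ a, B.proj (α a) = 0
  mul_left : ∀ a, ε (t a) * α a = α a
  mul_right : ∀ a, α a * ε (s a) = α a
  span : ∀ j, B.proj j = 0 → ∃ r : I → k,
    j - ∑ a, r a • α a ∈ RingHom.ker B.proj * RingHom.ker B.proj
  indep : ∀ r : I → k, ∑ a, r a • α a ∈ RingHom.ker B.proj * RingHom.ker B.proj → r = 0

theorem IsBasic.exists_isArrowBasis (hB : B.IsBasic) {ε : B.comp → B.alg}
    (hε : B.IsDecomposition ε) :
    ∃ (n : B.comp → B.comp → ℕ) (α : (Σ c d : B.comp, Fin (n c d)) → B.alg),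
      B.IsArrowBasis ε (fun a => a.1) (fun a => a.2.1) α := by
  have := hB.finite
  let J : Ideal B.alg := RingHom.ker B.proj
  let J2 : Submodule k B.alg := (J * J).restrictScalars k
  have hJ2 : ∀ x, x ∈ J2 ↔ x ∈ J * J := fun x => Iff.rfl
  have hmk : ∀ x, J2.mkQ x = 0 ↔ x ∈ J2 := fun x => Submodule.Quotient.mk_eq_zero J2
  -- the projection onto `ε d * B * ε c`; an arrow basis consists of bases of the images of
  -- `ε d * (rad B) * ε c` modulo the square of the radical
  let T (c d : B.comp) : B.alg →ₗ[k] B.alg :=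
    (LinearMap.mulLeft k (ε d)).comp (LinearMap.mulRight k (ε c))
  have hT : ∀ c d x, T c d x = ε d * (x * ε c) := fun c d x => rfl
  have hTT : ∀ c d x, T c d (T c d x) = T c d x := by
    intro c d x
    rw [hT, hT, mul_assoc, mul_assoc, (hε.complete.idem c).eq, ← mul_assoc, (hε.complete.idem d).eq]
  have hTd : ∀ c d d' x, d' ≠ d → T c d (T c d' x) = 0 := by
    intro c d d' x h
    rw [hT, hT, mul_assoc, ← mul_assoc, hε.complete.ortho h.symm, zero_mul]
  have hTc : ∀ c d c' d' x, c' ≠ c → T c d (T c' d' x) = 0 := by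
    intro c d c' d' x h
    rw [hT, hT, mul_assoc, mul_assoc, hε.complete.ortho h, mul_zero, mul_zero, mul_zero]
  let S (c d : B.comp) : Submodule k B.alg := (J.restrictScalars k).map (T c d)
  let V (c d : B.comp) : Submodule k (B.alg ⧸ J2) := (S c d).map J2.mkQ
  let b (c d : B.comp) := Module.finBasis k (V c d)
  have hex : ∀ a : Σ c d : B.comp, Fin (Module.finrank k (V c d)),
      ∃ j, B.proj j = 0 ∧ J2.mkQ (T a.1 a.2.1 j) = (b a.1 a.2.1 a.2.2).1 := by
    rintro ⟨c, d, i⟩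
    obtain ⟨x, ⟨j, hj, rfl⟩, hx⟩ := (b c d i).2
    exact ⟨j, hj, hx⟩
  choose j hj hjb using hex
  refine ⟨fun c d => Module.finrank k (V c d), fun a => T a.1 a.2.1 (j a), ?_, ?_, ?_, ?_, ?_⟩
  · intro a
    rw [hT, map_mul, map_mul, hj, zero_mul, mul_zero]
  · intro a
    rw [hT, ← mul_assoc, (hε.complete.idem _).eq]
  · intro a
    rw [hT, mul_assoc, mul_assoc, (hε.complete.idem _).eq]
  · intro x hx
    have h1 : ∀ c d, J2.mkQ (T c d x) ∈ V c d := fun c d => ⟨_, ⟨x, hx, rfl⟩, rfl⟩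
    refine ⟨fun a => (b a.1 a.2.1).repr ⟨_, h1 a.1 a.2.1⟩ a.2.2, ?_⟩
    rw [← hJ2, ← hmk, map_sub, sub_eq_zero]
    have h2 : x = ∑ c, ∑ d, T c d x := by
      simp only [hT, ← mul_assoc]
      rw [Finset.sum_comm]
      simp only [← Finset.mul_sum, hε.complete.complete, mul_one]
      rw [← Finset.sum_mul, hε.complete.complete, one_mul]
    conv_lhs => rw [h2]
    rw [map_sum, map_sum, Fintype.sum_sigma]
    refine Finset.sum_congr rfl fun c _ => ?_
    rw [map_sum, Fintype.sum_sigma]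
    refine Finset.sum_congr rfl fun d _ => ?_
    have h3 := congrArg Subtype.val ((b c d).sum_repr ⟨_, h1 c d⟩)
    rw [Submodule.coe_sum] at h3
    refine h3.symm.trans (Finset.sum_congr rfl fun i _ => ?_)
    rw [map_smul, hjb]
    rfl
  · intro r hr
    have key : ∀ c d, ∑ i, r ⟨c, d, i⟩ • T c d (j ⟨c, d, i⟩) ∈ J2 := by
      intro c d
      have h := (J * J).mul_mem_left (ε d) ((J * J).mul_mem_right (ε c) hr)
      rw [← hJ2] at h
      convert h using 1
      rw [← hT, map_sum, Fintype.sum_sigma, Finset.sum_eq_single c]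
      · rw [Fintype.sum_sigma, Finset.sum_eq_single d]
        · refine Finset.sum_congr rfl fun i _ => ?_
          rw [map_smul, hTT]
        · intro d' _ hd
          refine Finset.sum_eq_zero fun i _ => ?_
          rw [map_smul, hTd _ _ _ _ hd, smul_zero]
        · simp
      · intro c' _ hc
        rw [Fintype.sum_sigma]
        refine Finset.sum_eq_zero fun d' _ => Finset.sum_eq_zero fun i _ => ?_
        rw [map_smul, hTc _ _ _ _ _ hc, smul_zero]
      · simp
    funext ⟨c, d, i⟩
    have h1 := key c d
    rw [← hmk, map_sum] at h1
    have h2 : ∑ i, r ⟨c, d, i⟩ • b c d i = 0 := by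
      apply Subtype.ext
      rw [Submodule.coe_sum]
      refine Eq.trans (Finset.sum_congr rfl fun i _ => ?_) h1
      rw [map_smul, hjb ⟨c, d, i⟩]
      rfl
    exact Fintype.linearIndependent_iff.1 (b c d).linearIndependent _ h2 i

theorem IsArrowBasis.congr_fintype {ε : B.comp → B.alg} {I : Type} {i₁ : Fintype I}
    (i₂ : Fintype I) {s t : I → B.comp} {α : I → B.alg} (h : @IsArrowBasis k _ B ε I i₁ s t α) :
    @IsArrowBasis k _ B ε I i₂ s t α := by
  rwa [Subsingleton.elim i₂ i₁]

section ArrowBasis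

variable {ε : B.comp → B.alg} {I : Type} [Fintype I] {s t : I → B.comp} {α : I → B.alg}

/-- The arrows generate the radical as a left ideal, by Nakayama's lemma. -/
theorem IsArrowBasis.exists_eq_sum (hB : B.IsBasic) (hα : B.IsArrowBasis ε s t α) {j : B.alg}
    (hj : B.proj j = 0) : ∃ b : I → B.alg, j = ∑ a, b a * α a := by
  have := hB.finite
  have : IsNoetherianRing B.alg := IsNoetherianRing.of_finite k B.alg
  let J : Ideal B.alg := RingHom.ker B.proj
  let L : Ideal B.alg := Submodule.span B.alg (Set.range α)
  have hle : J ≤ L ⊔ J • J := by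
    intro x hx
    obtain ⟨r, hr⟩ := hα.span x hx
    rw [← add_sub_cancel (∑ a, r a • α a) x]
    refine Submodule.add_mem_sup (L.sum_mem fun a _ => ?_) hr
    exact L.smul_of_tower_mem _ (Submodule.subset_span ⟨a, rfl⟩)
  have hbot : Submodule.map L.mkQ J = ⊥ := by
    apply Submodule.FG.eq_bot_of_le_jacobson_smul ((IsNoetherian.noetherian J).map _)
    rw [← hB.ker_eq, ← Submodule.map_smul'']
    refine (Submodule.map_mono hle).trans ?_
    rw [Submodule.map_sup, sup_le_iff]
    refine ⟨?_, le_rfl⟩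
    rw [Submodule.mkQ_map_self]
    exact bot_le
  have hjL : j ∈ L := by
    rw [← Submodule.ker_mkQ L, LinearMap.mem_ker, ← Submodule.mem_bot (R := B.alg), ← hbot]
    exact ⟨j, hj, rfl⟩
  obtain ⟨b, hb⟩ := (Submodule.mem_span_range_iff_exists_fun B.alg).1 hjL
  exact ⟨b, hb.symm⟩

/-- If the radical is projective, it is the direct sum of the left ideals generated by the arrows
`α a`, and the latter are isomorphic to `B ε_{t a}`. Namely, the kernel of the
epimorphism `⨁ B ε_{t a} → rad B` is a direct summand which is contained in the radical. -/
theorem IsArrowBasis.mul_eq_zero_of_sum_eq_zero (hB : B.IsBasic) (hε : B.IsDecomposition ε)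
    (hα : B.IsArrowBasis ε s t α) (hJ : Module.Projective B.alg (RingHom.ker B.proj))
    {b : I → B.alg} (hb : ∑ a, b a * α a = 0) (a : I) : b a * ε (t a) = 0 := by
  classical
  let J : Ideal B.alg := RingHom.ker B.proj
  let Ψ : (I → B.alg) →ₗ[B.alg] J :=
    (Fintype.linearCombination B.alg α).codRestrict J fun x => by
      rw [Fintype.linearCombination_apply]
      exact J.sum_mem fun a _ => J.mul_mem_left _ (hα.proj_eq a)
  have hΨ : ∀ x, (Ψ x).1 = ∑ a, x a * α a := fun x => rfl
  obtain ⟨σ, hσ⟩ := LinearMap.exists_rightInverse_of_surjective Ψ (by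
    rw [LinearMap.range_eq_top]
    rintro ⟨j, hj⟩
    obtain ⟨x, hx⟩ := hα.exists_eq_sum hB hj
    exact ⟨x, Subtype.ext hx.symm⟩)
  have hσ' : ∀ y, ∑ a, σ y a * α a = y.1 := fun y => by
    rw [← hΨ]
    exact congrArg Subtype.val (LinearMap.congr_fun hσ y)
  -- the projection onto the kernel of `Ψ`; the kernel lies in the radical, so the projection maps
  -- it into higher and higher powers of the radical
  let κ (x : I → B.alg) (a : I) : B.alg := x a - σ (Ψ x) a * ε (t a)
  have hJ1 : ∀ b : I → B.alg, ∑ a, b a * α a = 0 → (∀ a, b a * ε (t a) = b a) → ∀ a, b a ∈ J := by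
    intro b h1 h2
    have h3 : ∀ a, b a - B.proj (b a) (t a) • ε (t a) ∈ J := fun a => by
      have := hε.proj_mul_sub (b a) (t a)
      rw [h2] at this
      exact this
    have h4 : (fun a => B.proj (b a) (t a)) = 0 := by
      apply hα.indep
      have : ∑ a, B.proj (b a) (t a) • α a =
          ∑ a, -((b a - B.proj (b a) (t a) • ε (t a)) * α a) := by
        simp only [sub_mul, smul_mul_assoc, hα.mul_left, neg_sub, Finset.sum_sub_distrib, h1,
          sub_zero]
      rw [this]
      exact Ideal.sum_mem _ fun a _ => neg_mem (Ideal.mul_mem_mul (h3 a) (hα.proj_eq a))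
    intro a
    have := h3 a
    rwa [congrFun h4 a, Pi.zero_apply, zero_smul, sub_zero] at this
  have hκ : ∀ x : I → B.alg, (∀ a, x a * ε (t a) = x a) →
      ∑ a, κ x a * α a = 0 ∧ ∀ a, κ x a * ε (t a) = κ x a := by
    intro x hx
    constructor
    · simp only [κ, sub_mul, mul_assoc, hα.mul_left, Finset.sum_sub_distrib, hσ', hΨ, sub_self]
    · intro a
      simp only [κ, sub_mul, mul_assoc, (hε.complete.idem _).eq, hx]
  have key : ∀ n, ∀ b : I → B.alg, ∑ a, b a * α a = 0 → (∀ a, b a * ε (t a) = b a) →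
      ∀ a, b a ∈ J ^ n := by
    intro n
    induction n with
    | zero =>
      intro b _ _ a
      rw [Submodule.pow_zero, Ideal.one_eq_top]
      exact Submodule.mem_top
    | succ n ih =>
      intro b h1 h2 a
      have h3 : b a = ∑ a', b a' * κ (Pi.single a' (ε (t a'))) a := by
        have h4 : b = ∑ a', b a' • (Pi.single a' (ε (t a')) : I → B.alg) := by
          funext x
          rw [Finset.sum_apply, Finset.sum_eq_single x]
          · simp [h2]
          · intro y _ hy
            simp [Pi.single_eq_of_ne hy.symm]
          · simp
        have h5 : Ψ b = 0 := Subtype.ext h1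
        have h6 : κ b a = b a := by simp only [κ, h5, map_zero, Pi.zero_apply, zero_mul, sub_zero]
        rw [← h6]
        simp only [κ]
        conv_lhs => rw [h4]
        simp only [map_sum, map_smul, Finset.sum_apply, Pi.smul_apply, smul_eq_mul, mul_sub,
          Finset.sum_sub_distrib, Finset.sum_mul, mul_assoc]
      rw [h3, Ideal.IsTwoSided.pow_succ]
      refine Ideal.sum_mem _ fun a' _ => Ideal.mul_mem_mul (hJ1 b h1 h2 a') ?_
      obtain ⟨h7, h8⟩ := hκ (Pi.single a' (ε (t a'))) (fun x => by
        by_cases h : x = a'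
        · subst h
          rw [Pi.single_eq_same, (hε.complete.idem _).eq]
        · rw [Pi.single_eq_of_ne h, zero_mul])
      exact ih _ h7 h8 a
  obtain ⟨N, hN⟩ := hB.exists_ker_pow_eq_bot
  have := key N (fun a => b a * ε (t a)) (by simpa only [mul_assoc, hα.mul_left] using hb)
    (fun a => by rw [mul_assoc, (hε.complete.idem _).eq]) a
  rw [hN] at this
  exact (Submodule.mem_bot _).1 this

end ArrowBasis

end MarkedAlgebra

namespace PathAlgebra

variable {k : Type u} [Field k] {Γ : FinQuiver} {R : Type*} [Ring R] [Algebra k R]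

/-- The product of the images of the arrows of a path. -/
def evalPath (ε : Γ.vert → R) (α : Arrows Γ → R) : {a b : Γ.vert} → Quiver.Path a b → R
  | a, _, .nil => ε a
  | _, _, .cons p e => α ⟨_, _, e⟩ * evalPath ε α p

variable {ε : Γ.vert → R} {α : Arrows Γ → R}

theorem mul_evalPath (hε : CompleteOrthogonalIdempotents ε) (hl : ∀ a, ε a.2.1 * α a = α a)
    {a b : Γ.vert} (p : Quiver.Path a b) : ε b * evalPath ε α p = evalPath ε α p := by
  cases p with
  | nil => rw [evalPath, (hε.idem a).eq]
  | cons p e => rw [evalPath, ← mul_assoc, hl ⟨_, _, e⟩]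

theorem evalPath_mul (hε : CompleteOrthogonalIdempotents ε) {a b : Γ.vert} (p : Quiver.Path a b) :
    evalPath ε α p * ε a = evalPath ε α p := by
  induction p with
  | nil => rw [evalPath, (hε.idem a).eq]
  | cons p e ih => rw [evalPath, mul_assoc, ih]

theorem evalPath_comp (hε : CompleteOrthogonalIdempotents ε) (hl : ∀ a, ε a.2.1 * α a = α a)
    {a b c : Γ.vert} (q : Quiver.Path a b) (p : Quiver.Path b c) :
    evalPath ε α (q.comp p) = evalPath ε α p * evalPath ε α q := by
  induction p with
  | nil => rw [Quiver.Path.comp_nil, evalPath, mul_evalPath hε hl q]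
  | cons p e ih => rw [Quiver.Path.comp_cons, evalPath, evalPath, ih, mul_assoc]

/-- The linear map from the path algebra given by the images of the vertices and the arrows. -/
def evalLin (k : Type u) [Field k] [Algebra k R] (ε : Γ.vert → R) (α : Arrows Γ → R) :
    PathAlgebra k Γ →ₗ[k] R :=
  Finsupp.lift R k Γ.Paths fun p => evalPath ε α p.2.2

theorem evalLin_ofPath {a b : Γ.vert} (p : Quiver.Path a b) :
    evalLin k ε α (ofPath k ⟨a, b, p⟩) = evalPath ε α p :=
  lift_ofPath _ _

/-- The homomorphism from the path algebra given by the images of the vertices and the arrows. -/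
def eval (k : Type u) [Field k] [Algebra k R] (hε : CompleteOrthogonalIdempotents ε)
    (hl : ∀ a, ε a.2.1 * α a = α a) : PathAlgebra k Γ →ₐ[k] R :=
  AlgHom.ofLinearMap (evalLin k ε α)
    (by
      rw [one_def, map_sum, ← hε.complete]
      exact Finset.sum_congr rfl fun a _ => (evalLin_ofPath _).trans (by rw [evalPath]))
    (fun f g => by
      induction f using induction with
      | zero => simp
      | add f₁ f₂ h₁ h₂ => simp only [add_mul, map_add, h₁, h₂]
      | path r p =>
        induction g using induction with
        | zero => simp
        | add g₁ g₂ h₁ h₂ => simp only [mul_add, map_add, h₁, h₂]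
        | path s q =>
          simp only [smul_mul_assoc, mul_smul_comm, map_smul, ofPath_mul]
          obtain ⟨a, b, p⟩ := p
          obtain ⟨c, d, q⟩ := q
          congr 2
          rw [evalLin_ofPath, evalLin_ofPath]
          by_cases h : d = a
          · subst h
            rw [pathMul_comp, evalLin_ofPath, evalPath_comp hε hl]
          · rw [pathMul_of_ne _ _ h, map_zero, ← evalPath_mul hε p, ← mul_evalPath hε hl q,
              mul_assoc, ← mul_assoc (ε a), hε.ortho (Ne.symm h), zero_mul, mul_zero])

theorem eval_nilPath (hε : CompleteOrthogonalIdempotents ε) (hl : ∀ a, ε a.2.1 * α a = α a)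
    (a : Γ.vert) : eval k hε hl (ofPath k (nilPath a)) = ε a :=
  (evalLin_ofPath _).trans (by rw [evalPath])

theorem eval_ofArrow (hε : CompleteOrthogonalIdempotents ε) (hl : ∀ a, ε a.2.1 * α a = α a)
    (hr : ∀ a, α a * ε a.1 = α a) (a : Arrows Γ) : eval k hε hl (ofArrow k a) = α a :=
  (evalLin_ofPath _).trans (by rw [Quiver.Hom.toPath, evalPath, evalPath, hr])

theorem eq_zero_of_forall_mem_longPaths {x : PathAlgebra k Γ} (hx : ∀ n, x ∈ longPaths k Γ n) :
    x = 0 := by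
  have key : ∀ (p : Γ.Paths) (y : PathAlgebra k Γ), y ∈ longPaths k Γ (p.2.2.length + 1) →
      (Finsupp.lapply p : (Γ.Paths →₀ k) →ₗ[k] k) y = 0 := by
    intro p y hy
    induction hy using Submodule.span_induction with
    | zero => exact map_zero _
    | add x x' _ _ h h' => exact (map_add _ _ _).trans (by rw [h, h', add_zero])
    | smul r x _ h => exact (map_smul _ _ _).trans (by rw [h, smul_zero])
    | mem x hx =>
      obtain ⟨q, hq, rfl⟩ := hx
      refine Finsupp.single_eq_of_ne ?_
      rintro rfl
      exact absurd hq (by simp)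
  exact Finsupp.ext fun p => key p x (hx _)

/-- If every element of the kernel of `π` can be uniquely written as `∑ b_a α_a` with
`b_a ∈ R ε_{t a}` and this kernel is nilpotent, then the ring `R` is the path algebra. -/
theorem bijective_eval (π : R →ₐ[k] (Γ.vert → k)) (hnil : ∃ N, RingHom.ker π ^ N = ⊥)
    (hε : CompleteOrthogonalIdempotents ε) (hl : ∀ a, ε a.2.1 * α a = α a)
    (hr : ∀ a, α a * ε a.1 = α a) (hπε : ∀ a b, π (ε a) b = if b = a then 1 else 0)
    (hπα : ∀ a, π (α a) = 0)
    (hgen : ∀ j, π j = 0 → ∃ b : Arrows Γ → R, j = ∑ a, b a * α a)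
    (hfree : ∀ b : Arrows Γ → R, ∑ a, b a * α a = 0 → ∀ a, b a * ε a.2.1 = 0) :
    Function.Bijective (eval k hε hl) ∧ ∀ x, π (eval k hε hl x) = nilCoeff k Γ x := by
  set φ := eval k hε hl with hφ
  have hφε : ∀ a, φ (ofPath k (nilPath a)) = ε a := fun a => eval_nilPath hε hl a
  have hφα : ∀ a, φ (ofArrow k a) = α a := fun a => eval_ofArrow hε hl hr a
  have hdec : ∀ x : PathAlgebra k Γ, φ x = ∑ a : Γ.vert, nilCoeff k Γ x a • ε a +
      ∑ a, φ (tail k Γ x a) * α a := by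
    intro x
    conv_lhs => rw [eq_add_sum_tail x]
    simp only [map_add, map_sum, map_smul, map_mul, hφε, hφα]
  have hproj : ∀ x, π (φ x) = nilCoeff k Γ x := by
    intro x
    rw [hdec]
    funext c
    simp only [map_add, map_sum, map_mul, map_smul, hπα, mul_zero, Finset.sum_const_zero,
      add_zero, Finset.sum_apply, Pi.smul_apply, hπε]
    rw [Finset.sum_eq_single c]
    · simp
    · intro d _ hd
      simp [hd.symm]
    · simp
  obtain ⟨N, hN⟩ := hnil
  have hsurj : Function.Surjective φ := by
    have key : ∀ m, ∀ b, ∃ x, b - φ x ∈ RingHom.ker π ^ m := by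
      intro m
      induction m with
      | zero =>
        intro b
        refine ⟨0, ?_⟩
        rw [Submodule.pow_zero, Ideal.one_eq_top]
        exact Submodule.mem_top
      | succ m ih =>
        intro b
        have hj : π (b - ∑ a, π b a • ε a) = 0 := by
          funext c
          simp only [map_sub, map_sum, map_smul, Pi.sub_apply, Finset.sum_apply, Pi.smul_apply,
            hπε]
          simp
        obtain ⟨y, hy⟩ := hgen _ hj
        choose x hx using fun a => ih (y a)
        refine ⟨∑ a : Γ.vert, π b a • ofPath k (nilPath a) +
          ∑ a, x a * ofArrow k a, ?_⟩
        simp only [map_add, map_sum, map_smul, map_mul, hφε, hφα]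
        rw [← sub_sub]
        change b - ∑ a, π b a • ε a - _ ∈ _
        rw [hy, ← Finset.sum_sub_distrib]
        refine Ideal.sum_mem _ fun a _ => ?_
        rw [← sub_mul]
        rcases Nat.eq_zero_or_pos m with h | h
        · subst h
          rw [zero_add, Submodule.pow_one]
          exact Ideal.mul_mem_left _ _ (hπα a)
        · rw [Submodule.pow_succ]
          exact Ideal.mul_mem_mul (hx a) (hπα a)
    intro b
    obtain ⟨x, hx⟩ := key N b
    rw [hN, Submodule.mem_bot, sub_eq_zero] at hx
    exact ⟨x, hx.symm⟩
  have hinj : Function.Injective φ := by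
    rw [injective_iff_map_eq_zero]
    have key : ∀ m, ∀ x, φ x = 0 → x ∈ longPaths k Γ m := by
      intro m
      induction m with
      | zero =>
        intro x hx
        clear hx
        induction x using induction with
        | zero => exact Submodule.zero_mem _
        | add f g hf hg => exact Submodule.add_mem _ hf hg
        | path r p => exact Submodule.smul_mem _ _ (Submodule.subset_span ⟨p, Nat.zero_le _, rfl⟩)
      | succ m ih =>
        intro x hx
        have h0 : nilCoeff k Γ x = 0 := by rw [← hproj, hx, map_zero]
        have h1 := hdec x
        rw [hx, h0] at h1
        simp only [Pi.zero_apply, zero_smul, Finset.sum_const_zero, zero_add] at h1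
        have h2 := eq_add_sum_tail x
        rw [h0] at h2
        simp only [Pi.zero_apply, zero_smul, Finset.sum_const_zero, zero_add] at h2
        rw [h2]
        refine Submodule.sum_mem _ fun a _ => mul_mem_longPaths (ih _ ?_)
          (mem_longPaths_one (nilCoeff_ofArrow a))
        have h3 := hfree _ h1.symm a
        rw [← hφε, ← map_mul, tail_mul_nilPath] at h3
        exact h3
    exact fun x hx => eq_zero_of_forall_mem_longPaths fun m => key m x hx
  exact ⟨⟨hinj, hsurj⟩, hproj⟩

end PathAlgebra

/-- The quiver with `n c d` arrows from `c` to `d`. -/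
def quiverOfCard {V : Type} [Fintype V] [DecidableEq V] (n : V → V → ℕ) : FinQuiver where
  vert := V
  quiver := ⟨fun c d => Fin (n c d)⟩
  finite_arrows c d := inferInstanceAs (Finite (Fin (n c d)))

/-- Gabriel's theorem for hereditary algebras. The quiver has no oriented cycles since an oriented
cycle would be a nilpotent element of the path algebra. -/
theorem MarkedAlgebra.IsBasic.exists_markedIso_pathMarked {k : Type u} [Field k]
    {B : MarkedAlgebra k} (hB : B.IsBasic) (hH : IsHereditary B.alg) :
    ∃ Γ : FinQuiver, Γ.Acyclic ∧ Nonempty (MarkedIso B (pathMarked k Γ)) := by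
  classical
  obtain ⟨ε, hε⟩ := hB.exists_isDecomposition
  obtain ⟨n, α, hα⟩ := hB.exists_isArrowBasis hε
  let Γ := quiverOfCard n
  have hα' : B.IsArrowBasis (I := PathAlgebra.Arrows (quiverOfCard n)) ε (fun a => a.1)
      (fun a => a.2.1) α :=
    hα.congr_fintype _
  obtain ⟨⟨hinj, hsurj⟩, hproj⟩ := PathAlgebra.bijective_eval (Γ := quiverOfCard n) B.proj
    hB.exists_ker_pow_eq_bot hε.complete hα.mul_left hα.mul_right hε.proj_apply hα.proj_eq
    (fun j hj => hα'.exists_eq_sum hB hj)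
    (fun b hb => hα'.mul_eq_zero_of_sum_eq_zero hB hε (hH _) hb)
  set φ : PathAlgebra k Γ →ₐ[k] B.alg :=
    PathAlgebra.eval (Γ := quiverOfCard n) k hε.complete hα.mul_left with hφ
  refine ⟨Γ, ?_, ⟨⟨(AlgEquiv.ofBijective φ ⟨hinj, hsurj⟩).symm, Equiv.refl _, ?_⟩⟩⟩
  · intro a p
    by_contra hp
    have hlen : 0 < p.length := by
      rcases Nat.eq_zero_or_pos p.length with h | h
      · exact absurd (Quiver.Path.eq_nil_of_length_zero p h) hp
      · exact h
    obtain ⟨m, hm⟩ : IsNilpotent (PathAlgebra.ofPath k (⟨a, a, p⟩ : Γ.Paths)) := by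
      refine (hB.isNilpotent (b := φ (PathAlgebra.ofPath k (⟨a, a, p⟩ : Γ.Paths))) ?_).imp
        fun m hm => hinj ?_
      · exact (hproj _).trans (PathAlgebra.nilCoeff_of_length_pos p hlen)
      · rw [map_pow, hm, map_zero]
    -- the powers of an oriented cycle are paths, so they cannot vanish
    have hpow : ∀ m, ∃ q : Quiver.Path a a, PathAlgebra.ofPath k (⟨a, a, p⟩ : Γ.Paths) ^ (m + 1) =
        PathAlgebra.ofPath k ⟨a, a, q⟩ := by
      intro m
      induction m with
      | zero => exact ⟨p, by rw [zero_add, pow_one]⟩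
      | succ m ih =>
        obtain ⟨q, hq⟩ := ih
        exact ⟨p.comp q, by rw [pow_succ, hq, PathAlgebra.ofPath_mul, PathAlgebra.pathMul_comp]⟩
    obtain ⟨q, hq⟩ := hpow m
    rw [pow_succ, hm, zero_mul] at hq
    exact one_ne_zero (Finsupp.single_eq_zero.1 hq.symm : (1 : k) = 0)
  · intro b c
    obtain ⟨x, rfl⟩ := hsurj b
    refine Eq.trans ?_ (congrFun (hproj x) c).symm
    have := (AlgEquiv.ofBijective φ ⟨hinj, hsurj⟩).symm_apply_apply x
    exact congrFun (congrArg (PathAlgebra.nilCoeff k (quiverOfCard n)) this) c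

/-! ### Matrices of endomorphisms in a blowing up -/

namespace MarkedAlgebra

variable {k : Type u} [Field k] {B : MarkedAlgebra k} {ε : B.comp → B.alg} {i : B.comp}

theorem mul_blowEntry (hε : B.IsDecomposition ε) (φ : B.BlowEnd ε i) (x y : BlowIndex i) :
    ε x.under * B.blowEntry ε i φ x y = B.blowEntry ε i φ x y :=
  (hε.eq_mul (φ.toEnd (B.blowGen ε i y) x).2).symm

theorem blowEntry_mul_idem (hε : B.IsDecomposition ε) (φ : B.BlowEnd ε i) (x y : BlowIndex i) :
    B.blowEntry ε i φ x y * ε y.under = B.blowEntry ε i φ x y := by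
  have h : MulOpposite.op (ε y.under) • B.blowGen ε i y = B.blowGen ε i y := by
    funext z
    apply Subtype.ext
    by_cases hz : z = y
    · subst hz
      simp only [Pi.smul_apply, blowGen, Pi.single_eq_same, Submodule.coe_smul,
        MulOpposite.smul_eq_mul_unop, MulOpposite.unop_op]
      exact (hε.complete.idem _).eq
    · simp [blowGen, Pi.single_eq_of_ne hz]
  have h2 := congrArg (fun v => (φ.toEnd v x : B.alg)) h
  simp only [map_smul, Pi.smul_apply, Submodule.coe_smul, MulOpposite.smul_eq_mul_unop,
    MulOpposite.unop_op] at h2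
  exact h2

theorem blowEnd_ext (hε : B.IsDecomposition ε) {φ ψ : B.BlowEnd ε i}
    (h : ∀ x y, B.blowEntry ε i φ x y = B.blowEntry ε i ψ x y) : φ = ψ := by
  refine LinearMap.ext fun v => ?_
  have key : v = ∑ z, MulOpposite.op (v z : B.alg) • B.blowGen ε i z := by
    funext w
    apply Subtype.ext
    rw [Finset.sum_apply, Finset.sum_eq_single w]
    · simp only [Pi.smul_apply, blowGen, Pi.single_eq_same, Submodule.coe_smul,
        MulOpposite.smul_eq_mul_unop, MulOpposite.unop_op]
      exact hε.eq_mul (v w).2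
    · intro z _ hz
      simp [blowGen, Pi.single_eq_of_ne (Ne.symm hz)]
    · simp
  change φ.toEnd v = ψ.toEnd v
  rw [key, map_sum, map_sum]
  refine Finset.sum_congr rfl fun z _ => ?_
  rw [map_smul, map_smul]
  congr 1
  funext x
  exact Subtype.ext (h x z)

theorem mem_span_of_mul_eq {c : B.comp} {b : B.alg} (h : ε c * b = b) :
    b ∈ Submodule.span (B.alg)ᵐᵒᵖ {ε c} :=
  Submodule.mem_span_singleton.2 ⟨MulOpposite.op b, by rwa [MulOpposite.smul_eq_mul_unop]⟩

theorem exists_blowEntry_eq (M : BlowIndex i → BlowIndex i → B.alg)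
    (hl : ∀ x y, ε x.under * M x y = M x y) (hr : ∀ x y, M x y * ε y.under = M x y) :
    ∃ φ : B.BlowEnd ε i, ∀ x y, B.blowEntry ε i φ x y = M x y := by
  let F : Module.End (B.alg)ᵐᵒᵖ (B.BlowModule ε i) :=
    { toFun := fun v x => ⟨∑ y, M x y * (v y : B.alg), mem_span_of_mul_eq (by
        rw [Finset.mul_sum]
        exact Finset.sum_congr rfl fun y _ => by rw [← mul_assoc, hl])⟩
      map_add' := fun v w => funext fun x => Subtype.ext (by
        simp [mul_add, Finset.sum_add_distrib])
      map_smul' := fun r v => funext fun x => Subtype.ext (by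
        simp [MulOpposite.smul_eq_mul_unop, Finset.sum_mul, mul_assoc]) }
  refine ⟨F, fun x y => ?_⟩
  change ∑ z, M x z * (B.blowGen ε i y z : B.alg) = M x y
  rw [Finset.sum_eq_single y]
  · simp only [blowGen, Pi.single_eq_same]
    exact hr x y
  · intro z _ hz
    simp [blowGen, Pi.single_eq_of_ne hz]
  · simp

theorem mem_blowSubalgebra (hε : B.IsDecomposition ε) {φ : B.BlowEnd ε i} :
    φ ∈ B.blowSubalgebra ε hε i ↔
      ∀ s t : Fin 2, s ≠ t → B.proj (B.blowEntry ε i φ (.inr s) (.inr t)) i = 0 := by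
  change (∃ d, Matrix.diagonal d = (B.blowReduce ε hε i φ).2) ↔ _
  have h : ∀ s t, (B.blowReduce ε hε i φ).2 s t =
    B.proj (B.blowEntry ε i φ (.inr s) (.inr t)) i := fun s t => rfl
  simp only [← h]
  constructor
  · rintro ⟨d, hd⟩ s t hst
    rw [← hd, Matrix.diagonal_apply_ne _ hst]
  · intro h
    refine ⟨fun s => (B.blowReduce ε hε i φ).2 s s, ?_⟩
    ext s t
    by_cases hst : s = t
    · subst hst
      rw [Matrix.diagonal_apply_eq]
    · rw [Matrix.diagonal_apply_ne _ hst, h s t hst]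

theorem blowProj_apply (hε : B.IsDecomposition ε) (φ : B.blowSubalgebra ε hε i)
    (x : BlowIndex i) :
    B.blowProj ε hε i φ x = B.proj (B.blowEntry ε i φ.1 x x) x.under := by
  cases x <;> rfl

theorem BlowIndex.eq_of_under_eq {ι : Type} {i : ι} {x y : BlowIndex i} (h : x.under = y.under)
    (hxy : x ≠ y) : ∃ s t, s ≠ t ∧ x = .inr s ∧ y = .inr t := by
  rcases x with c | s <;> rcases y with d | t
  · exact absurd (congrArg Sum.inl (Subtype.ext h)) hxy
  · exact absurd h c.2
  · exact absurd h.symm d.2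
  · exact ⟨s, t, fun h => hxy (congrArg _ h), rfl, rfl⟩

theorem IsDecomposition.proj_eq_smul (hε : B.IsDecomposition ε) {b : B.alg} {c : B.comp}
    (h : ε c * b = b) : B.proj b = B.proj b c • Pi.single c 1 := by
  funext d
  by_cases hd : d = c
  · subst hd; simp
  · conv_lhs => rw [← h]
    simp [hε.proj_apply, hd]

theorem proj_blowEntry (hε : B.IsDecomposition ε) (φ : B.blowSubalgebra ε hε i)
    (x y : BlowIndex i) :
    B.proj (B.blowEntry ε i φ.1 x y) =
      if x = y then B.blowProj ε hε i φ x • Pi.single x.under 1 else 0 := by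
  by_cases hxy : x = y
  · subst hxy
    rw [if_pos rfl, blowProj_apply, ← hε.proj_eq_smul (mul_blowEntry hε φ.1 x x)]
  · rw [if_neg hxy]
    by_cases hu : x.under = y.under
    · rw [hε.proj_eq_smul (mul_blowEntry hε φ.1 x y)]
      obtain ⟨s, t, hst, rfl, rfl⟩ := BlowIndex.eq_of_under_eq hu hxy
      have := (mem_blowSubalgebra hε).1 φ.2 s t hst
      change B.proj _ i • _ = _
      rw [this, zero_smul]
    · rw [hε.proj_eq_smul (mul_blowEntry hε φ.1 x y), ← blowEntry_mul_idem hε φ.1 x y]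
      simp [hε.proj_apply, hu]

theorem blowEntry_one (x y : BlowIndex i) :
    B.blowEntry ε i 1 x y = if x = y then ε x.under else 0 := by
  change (B.blowGen ε i y x : B.alg) = _
  by_cases h : x = y
  · subst h
    simp only [blowGen, Pi.single_eq_same, if_true]
  · simp only [blowGen, Pi.single_eq_of_ne h, if_neg h, ZeroMemClass.coe_zero]

/-- Recognition of elements of the blowing up by their matrices. -/
theorem exists_blowSubalgebra (hε : B.IsDecomposition ε) (M : BlowIndex i → BlowIndex i → B.alg)
    (hl : ∀ x y, ε x.under * M x y = M x y) (hr : ∀ x y, M x y * ε y.under = M x y)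
    (h0 : ∀ x y, x ≠ y → B.proj (M x y) = 0) :
    ∃ φ : B.blowSubalgebra ε hε i, ∀ x y, B.blowEntry ε i φ.1 x y = M x y := by
  obtain ⟨φ, hφ⟩ := exists_blowEntry_eq M hl hr
  refine ⟨⟨φ, (mem_blowSubalgebra hε).2 fun s t hst => ?_⟩, hφ⟩
  rw [hφ, h0 _ _ (fun h => hst (Sum.inr.inj h)), Pi.zero_apply]

end MarkedAlgebra

/-! ### Nodal models of marked algebras -/

section CornerMap

variable {k R S : Type*} [CommRing k] [Ring R] [Ring S] [Algebra k R] [Algebra k S]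

/-- The homomorphism of corner rings induced by a homomorphism of algebras. -/
def cornerMap (φ : R →ₐ[k] S) {e : R} {e' : S} (he : IsIdempotentElem e)
    (he' : IsIdempotentElem e') (h : φ e = e') : he.Corner →ₐ[k] he'.Corner :=
  AlgHom.ofLinearMap
    { toFun := fun x => ⟨φ x.1, φ x.1, by
        subst h
        simp only [← map_mul, corner_mul_left, corner_mul_right]⟩
      map_add' := fun x y => corner_ext _ (map_add φ x.1 y.1)
      map_smul' := fun r x => corner_ext _ (map_smul φ r x.1) }
    (corner_ext _ h) (fun x y => corner_ext _ (map_mul φ x.1 y.1))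

end CornerMap

/-- An embedding `f` of a marked algebra `D` into a finite dimensional hereditary algebra `H` that
shows that `D` is nodal, together with the semisimple quotient `π : H → Q` of `H`. The algebra
`D` is the preimage in `H` of the subalgebra `k ^ comp` of `Q`. Semisimplicity of `Q` is only used
in the form that `z Q z = 0` implies `z = 0`. The field `two` says that the idempotents of
`k ^ comp` generate left ideals of dimension at most two; it replaces the condition on the length
of `H ⊗ U`, which for the simple module `U` number `x` is the left ideal `Q e_x`. -/
structure IsModel {k : Type u} [Field k] (D : MarkedAlgebra k) {H Q : Type u} [Ring H] [Algebra k H]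
    [Ring Q] [Algebra k Q] (f : D.alg →ₐ[k] H) (π : H →ₐ[k] Q) (ι : (D.comp → k) →ₐ[k] Q) :
    Prop where
  finite : FiniteDimensional k H
  hereditary : IsHereditary H
  injective : Function.Injective f
  surjective : Function.Surjective π
  injective_idem : Function.Injective ι
  comm : ∀ d, π (f d) = ι (D.proj d)
  exists_eq : ∀ h t, π h = ι t → ∃ d, f d = h
  nil : ∀ h, π h = 0 → IsNilpotent h
  semiprime : ∀ z : Q, (∀ w, z * w * z = 0) → z = 0
  two : ∀ x, ∃ p q : Q, ∀ z, ∃ s t : k, z * ι (Pi.single x 1) = s • p + t • q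

/-- The left ideal generated by the idempotent number `x` is one-dimensional. -/
def IsLine {k : Type u} [Field k] {X Q : Type*} [DecidableEq X] [Ring Q] [Algebra k Q]
    (ι : (X → k) →ₐ[k] Q) (x : X) : Prop :=
  ∀ z, ∃ s : k, z * ι (Pi.single x 1) = s • ι (Pi.single x 1)

section Idem

variable {k : Type u} [Field k] {X Q : Type*} [Fintype X] [DecidableEq X] [Ring Q] [Algebra k Q]
  (ι : (X → k) →ₐ[k] Q)

theorem complete_map_single : CompleteOrthogonalIdempotents fun x => ι (Pi.single x 1) :=
  (CompleteOrthogonalIdempotents.single fun _ : X => k).map ι.toRingHom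

theorem map_eq_sum (t : X → k) : ι t = ∑ x, t x • ι (Pi.single x 1) := by
  simp only [← map_smul, ← map_sum]
  congr 1
  funext y
  simp [Pi.single_apply]

variable {ι}

/-- By semisimplicity, a one-dimensional left ideal `Q e` is also a right ideal: for
`z = e z (1 - e)` one has `z Q z ⊆ e z (1 - e) Q e Q = 0`. -/
theorem IsLine.mul_eq_smul (hQ : ∀ z : Q, (∀ w, z * w * z = 0) → z = 0) {x : X} (hx : IsLine ι x)
    (z : Q) : ∃ s : k, ι (Pi.single x 1) * z = s • ι (Pi.single x 1) := by
  have he : ι (Pi.single x 1) * ι (Pi.single x 1) = ι (Pi.single x 1) :=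
    ((complete_map_single ι).idem x).eq
  obtain ⟨s, hs⟩ := hx (ι (Pi.single x 1) * z)
  refine ⟨s, ?_⟩
  rw [← hs, ← sub_eq_zero]
  apply hQ
  intro w
  set e := ι (Pi.single x 1) with hedef
  obtain ⟨r, hr⟩ := hx w
  have h1 : e * (e * z - e * z * e) = e * z - e * z * e := by
    rw [mul_sub, ← mul_assoc, ← mul_assoc, ← mul_assoc, he]
  have h2 : (e * z - e * z * e) * e = 0 := by
    rw [sub_mul, mul_assoc _ e, he, sub_self]
  calc (e * z - e * z * e) * w * (e * z - e * z * e)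
      = (e * z - e * z * e) * (w * e) * (e * z - e * z * e) := by
        rw [← mul_assoc _ w e, mul_assoc _ e, h1]
    _ = 0 := by rw [hr, mul_smul_comm, h2, smul_zero, zero_mul]

theorem IsLine.mul_eq_zero (hQ : ∀ z : Q, (∀ w, z * w * z = 0) → z = 0) {x y : X}
    (hx : IsLine ι x) (hxy : x ≠ y) (z : Q) : ι (Pi.single x 1) * z * ι (Pi.single y 1) = 0 := by
  obtain ⟨s, hs⟩ := hx.mul_eq_smul hQ z
  rw [hs, smul_mul_assoc, (complete_map_single ι).ortho hxy, smul_zero]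

theorem IsLine.mul_eq_zero' {x y : X} (hx : IsLine ι x) (hxy : y ≠ x) (z : Q) :
    ι (Pi.single y 1) * z * ι (Pi.single x 1) = 0 := by
  obtain ⟨s, hs⟩ := hx z
  rw [mul_assoc, hs, mul_smul_comm, (complete_map_single ι).ortho hxy, smul_zero]

end Idem

section Model

variable {k : Type u} [Field k] {D : MarkedAlgebra k} {H Q : Type u} [Ring H] [Algebra k H]
  [Ring Q] [Algebra k Q] {f : D.alg →ₐ[k] H} {π : H →ₐ[k] Q} {ι : (D.comp → k) →ₐ[k] Q}

theorem IsModel.proj_eq_of_map_eq (hM : IsModel D f π ι) {d : D.alg} {t : D.comp → k}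
    (h : π (f d) = ι t) : D.proj d = t :=
  hM.injective_idem (by rw [← hM.comm, h])

theorem IsModel.isBasic (hM : IsModel D f π ι) : D.IsBasic := by
  have := hM.finite
  have : FiniteDimensional k D.alg :=
    FiniteDimensional.of_injective f.toLinearMap hM.injective
  refine MarkedAlgebra.isBasic_of_nil (fun t => ?_) (fun d hd => ?_)
  · obtain ⟨h, hh⟩ := hM.surjective (ι t)
    obtain ⟨d, rfl⟩ := hM.exists_eq h t hh
    exact ⟨d, hM.proj_eq_of_map_eq hh⟩
  · obtain ⟨n, hn⟩ := hM.nil (f d) (by rw [hM.comm, hd, map_zero])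
    exact ⟨n, hM.injective (by rw [map_pow, hn, map_zero])⟩

theorem IsModel.jacobson_eq (hM : IsModel D f π ι) : Ring.jacobson H = RingHom.ker π := by
  have := hM.finite
  have := IsArtinianRing.of_finite k H
  exact jacobson_eq_ker π.toRingHom hM.surjective hM.nil hM.semiprime

theorem IsModel.map_idem_ne_zero (hM : IsModel D f π ι) (x : D.comp) :
    ι (Pi.single x 1) ≠ 0 := by
  rw [← map_zero ι]
  exact fun h => one_ne_zero (α := k) (by simpa using congrFun (hM.injective_idem h) x)

/-- A basic hereditary algebra is a model of itself. -/
theorem isModel_self {B : MarkedAlgebra k} (hB : B.IsBasic) (hH : IsHereditary B.alg) :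
    IsModel B (AlgHom.id k B.alg) B.proj (AlgHom.id k (B.comp → k)) where
  finite := hB.finite
  hereditary := hH
  injective := Function.injective_id
  surjective := hB.surjective
  injective_idem := Function.injective_id
  comm _ := rfl
  exists_eq h _ _ := ⟨h, rfl⟩
  nil _ h := hB.isNilpotent h
  semiprime z hz := by
    have := hz 1
    rw [mul_one] at this
    exact funext fun c => mul_self_eq_zero.1 (congrFun this c)
  two x := by
    refine ⟨Pi.single x 1, 0, fun z => ⟨z x, 0, ?_⟩⟩
    funext y
    by_cases h : y = x
    · subst h; simp
    · simp [h]

theorem isLine_id {X : Type*} [DecidableEq X] (x : X) : IsLine (AlgHom.id k (X → k)) x := by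
  refine fun z => ⟨z x, ?_⟩
  funext y
  by_cases h : y = x
  · subst h; simp
  · simp [h]

/-! ### Gluing in a model -/

/-- The map from the components of `B` to the components of the algebra obtained by gluing. -/
def glueIndex {X : Type} [DecidableEq X] (a b c : X) : Option {c : X // c ≠ a ∧ c ≠ b} :=
  if h : c ≠ a ∧ c ≠ b then some ⟨c, h⟩ else none

theorem glueIndex_left {X : Type} [DecidableEq X] (a b : X) : glueIndex a b a = none :=
  dif_neg fun h => h.1 rfl

theorem glueIndex_right {X : Type} [DecidableEq X] (a b : X) : glueIndex a b b = none :=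
  dif_neg fun h => h.2 rfl

theorem glueIndex_of_ne {X : Type} [DecidableEq X] {a b c : X} (h : c ≠ a ∧ c ≠ b) :
    glueIndex a b c = some ⟨c, h⟩ :=
  dif_pos h

/-- Composition with a map of index sets. -/
def pullAlg (k : Type u) [Field k] {X Y : Type*} (r : X → Y) : (Y → k) →ₐ[k] (X → k) :=
  AlgHom.pi fun x : X => Pi.evalAlgHom k (fun _ : Y => k) (r x)

theorem pullAlg_apply {X Y : Type*} (r : X → Y) (t : Y → k) (x : X) :
    pullAlg k r t x = t (r x) := rfl

theorem pullAlg_some_single {X : Type} [DecidableEq X] {a b : X} (c : {c : X // c ≠ a ∧ c ≠ b}) :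
    pullAlg k (glueIndex a b) (Pi.single (some c) 1) = Pi.single c.1 1 := by
  funext d
  rw [pullAlg_apply]
  by_cases h : d ≠ a ∧ d ≠ b
  · rw [glueIndex_of_ne h]
    simp [Pi.single_apply, Subtype.ext_iff]
  · have h1 : glueIndex a b d = none := dif_neg h
    rw [h1, Pi.single_eq_of_ne (by simp), Pi.single_eq_of_ne]
    rintro rfl
    exact h c.2

theorem pullAlg_none_single {X : Type} [DecidableEq X] {a b : X} (hab : a ≠ b) :
    pullAlg k (glueIndex a b) (Pi.single none 1) = Pi.single a 1 + Pi.single b 1 := by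
  funext d
  rw [pullAlg_apply, Pi.add_apply]
  by_cases h : d ≠ a ∧ d ≠ b
  · rw [glueIndex_of_ne h]
    simp [h.1, h.2]
  · by_cases h1 : d = a
    · subst h1
      rw [glueIndex_left]
      simp [hab]
    · have h2 : d = b := by
        by_contra h2
        exact h ⟨h1, h2⟩
      subst h2
      rw [glueIndex_right]
      simp [h1]

theorem glue_proj_apply {B : MarkedAlgebra k} (a b : B.comp) (d : (B.glue a b).alg) :
    pullAlg k (glueIndex a b) ((B.glue a b).proj d) = B.proj d.1 := by
  have hd : B.proj d.1 a = B.proj d.1 b := (AlgHom.mem_equalizer _ _ _).1 d.2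
  funext c
  change (B.glue a b).proj d (glueIndex a b c) = _
  by_cases h : c ≠ a ∧ c ≠ b
  · rw [glueIndex_of_ne h]
    rfl
  · have h1 : glueIndex a b c = none := dif_neg h
    rw [h1]
    change B.proj d.1 a = _
    by_cases h1 : c = a
    · rw [h1]
    · have h2 : c = b := by
        by_contra h2
        exact h ⟨h1, h2⟩
      rw [h2, hd]

/-- The glued algebra has the same overring, and the idempotent of the new component is the sum of
two idempotents that generate one-dimensional left ideals. -/
theorem IsModel.glue (hM : IsModel D f π ι) {a b : D.comp} (hab : a ≠ b) (ha : IsLine ι a)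
    (hb : IsLine ι b) :
    IsModel (D.glue a b) (f.comp (Subalgebra.val _)) π (ι.comp (pullAlg k (glueIndex a b))) where
  finite := hM.finite
  hereditary := hM.hereditary
  injective := hM.injective.comp Subtype.val_injective
  surjective := hM.surjective
  injective_idem := by
    refine hM.injective_idem.comp fun t t' h => ?_
    funext x
    rcases x with _ | c
    · have : t (glueIndex a b a) = t' (glueIndex a b a) := congrFun h a
      rwa [glueIndex_left] at this
    · have : t (glueIndex a b c.1) = t' (glueIndex a b c.1) := congrFun h c.1
      rwa [glueIndex_of_ne c.2] at this
  comm d := by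
    change π (f d.1) = ι (pullAlg k (glueIndex a b) ((D.glue a b).proj d))
    rw [glue_proj_apply, hM.comm]
  exists_eq h t ht := by
    obtain ⟨d, rfl⟩ := hM.exists_eq h _ ht
    have hd := hM.proj_eq_of_map_eq ht
    refine ⟨⟨d, (AlgHom.mem_equalizer _ _ _).2 ?_⟩, rfl⟩
    change D.proj d a = D.proj d b
    rw [hd]
    change t (glueIndex a b a) = t (glueIndex a b b)
    rw [glueIndex_left, glueIndex_right]
  nil := hM.nil
  semiprime := hM.semiprime
  two x := by
    rcases x with _ | c
    · refine ⟨ι (Pi.single a 1), ι (Pi.single b 1), fun z => ?_⟩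
      obtain ⟨s, hs⟩ := ha z
      obtain ⟨t, ht⟩ := hb z
      refine ⟨s, t, ?_⟩
      change z * ι (pullAlg k (glueIndex a b) (Pi.single none 1)) = _
      rw [pullAlg_none_single hab, map_add, mul_add, hs, ht]
    · obtain ⟨p, q, h⟩ := hM.two c.1
      refine ⟨p, q, fun z => ?_⟩
      change ∃ s t : k, z * ι (pullAlg k (glueIndex a b) (Pi.single (some c) 1)) = _
      rw [pullAlg_some_single]
      exact h z

theorem IsLine.glue {a b : D.comp} {c : {c : D.comp // c ≠ a ∧ c ≠ b}} (hc : IsLine ι c.1) :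
    IsLine (ι.comp (pullAlg k (glueIndex a b))) (some c) := by
  intro z
  change ∃ s : k, z * ι (pullAlg k (glueIndex a b) (Pi.single (some c) 1)) =
    s • ι (pullAlg k (glueIndex a b) (Pi.single (some c) 1))
  rw [pullAlg_some_single]
  exact hc z

end Model

open MarkedAlgebra (BlowIndex)

/-! ### Blowing up in a model -/

section DiagonalCorner

variable {R : Type*} [Ring R] {X : Type*} [Fintype X] [DecidableEq X]

theorem isIdempotentElem_diagonal {e : X → R} (he : ∀ x, e x * e x = e x) :
    IsIdempotentElem (Matrix.diagonal e) := by
  rw [IsIdempotentElem, Matrix.diagonal_mul_diagonal]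
  exact congrArg _ (funext he)

variable {e : X → R} (he : ∀ x, e x * e x = e x)

theorem corner_entry_mul_left (z : (isIdempotentElem_diagonal he).Corner) (x y : X) :
    e x * z.1 x y = z.1 x y := by
  conv_rhs => rw [← corner_mul_left _ z, Matrix.diagonal_mul]

theorem corner_entry_mul_right (z : (isIdempotentElem_diagonal he).Corner) (x y : X) :
    z.1 x y * e y = z.1 x y := by
  conv_rhs => rw [← corner_mul_right _ z, Matrix.mul_diagonal]

/-- A matrix with entries in `e x R e y` as an element of the corner ring defined by the diagonal
matrix `e`. -/
def cornerOfEntries (M : X → X → R) (hl : ∀ x y, e x * M x y = M x y)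
    (hr : ∀ x y, M x y * e y = M x y) : (isIdempotentElem_diagonal he).Corner :=
  ⟨Matrix.of M, Matrix.of M, by
    change _ * _ * _ = _
    ext x y
    rw [Matrix.mul_diagonal, Matrix.diagonal_mul, Matrix.of_apply, hl, hr]⟩

theorem cornerOfEntries_val (M : X → X → R) (hl : ∀ x y, e x * M x y = M x y)
    (hr : ∀ x y, M x y * e y = M x y) (x y : X) : (cornerOfEntries he M hl hr).1 x y = M x y := rfl

theorem corner_entry_ext {z w : (isIdempotentElem_diagonal he).Corner}
    (h : ∀ x y, z.1 x y = w.1 x y) : z = w :=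
  corner_ext _ (Matrix.ext h)

theorem corner_entry_mul (z w : (isIdempotentElem_diagonal he).Corner) (x y : X) :
    (z * w).1 x y = ∑ j, z.1 x j * w.1 j y := rfl

/-- Multiplication with a matrix with the only entry `w` in the row `y` and column `x`. -/
theorem corner_entry_mul_single_mul (z : (isIdempotentElem_diagonal he).Corner) (x y : X)
    (h : ∀ w, z * w * z = 0) (w : R) : z.1 x y * w * z.1 x y = 0 := by
  have h1 : ∀ i j, e i * (if i = y ∧ j = x then e y * w * e x else 0) =
      if i = y ∧ j = x then e y * w * e x else 0 := by
    intro i j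
    split_ifs with h
    · rw [h.1, ← mul_assoc, ← mul_assoc, he]
    · rw [mul_zero]
  have h2 : ∀ i j, (if i = y ∧ j = x then e y * w * e x else 0) * e j =
      if i = y ∧ j = x then e y * w * e x else 0 := by
    intro i j
    split_ifs with h
    · rw [h.2, mul_assoc, he]
    · rw [zero_mul]
  have h3 : (z * cornerOfEntries he _ h1 h2 * z).1 x y = 0 := by rw [h]; rfl
  rw [corner_entry_mul he, Finset.sum_eq_single x, corner_entry_mul he, Finset.sum_eq_single y,
    cornerOfEntries_val, if_pos ⟨rfl, rfl⟩] at h3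
  · rw [← h3, mul_assoc, mul_assoc, mul_assoc (e y * w), corner_entry_mul_left he, ← mul_assoc,
      ← mul_assoc, ← mul_assoc, corner_entry_mul_right he]
  · intro j _ hj
    rw [cornerOfEntries_val, if_neg (fun h => hj h.1), mul_zero]
  · simp
  · intro j _ hj
    rw [corner_entry_mul he, Finset.sum_eq_zero, zero_mul]
    intro i _
    rw [cornerOfEntries_val, if_neg (fun h => hj h.2), mul_zero]
  · simp

/-- A matrix with only one nonzero column as an element of the corner ring. -/
def cornerColumn (c : X) (v : X → R) : (isIdempotentElem_diagonal he).Corner :=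
  cornerOfEntries he (fun x y => if y = c then e x * v x * e c else 0)
    (fun x y => by
      split_ifs
      · rw [← mul_assoc, ← mul_assoc, he]
      · rw [mul_zero])
    (fun x y => by
      split_ifs with h
      · rw [h, mul_assoc, he]
      · rw [zero_mul])

theorem cornerColumn_val (c : X) (v : X → R) (x y : X) :
    (cornerColumn he c v).1 x y = if y = c then e x * v x * e c else 0 := rfl

variable (k : Type*) [CommRing k] [Algebra k R]

/-- The inclusion of the tuples of scalars as diagonal matrices. -/
def diagonalCorner : (X → k) →ₐ[k] (isIdempotentElem_diagonal he).Corner :=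
  AlgHom.ofLinearMap
    { toFun := fun t => cornerOfEntries he (fun x y => if x = y then t x • e x else 0)
        (fun x y => by split_ifs <;> simp [he])
        (fun x y => by
          split_ifs with h
          · subst h; simp [he]
          · simp)
      map_add' := fun t t' => corner_entry_ext he fun x y => by
        change (if x = y then (t x + t' x) • e x else 0) =
          (if x = y then t x • e x else 0) + if x = y then t' x • e x else 0
        split_ifs <;> simp [add_smul]
      map_smul' := fun r t => corner_entry_ext he fun x y => by
        change (if x = y then (r * t x) • e x else 0) = r • if x = y then t x • e x else 0
        split_ifs <;> simp [mul_smul] }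
    (corner_entry_ext he fun x y => by
      change (if x = y then (1 : k) • e x else 0) = Matrix.diagonal e x y
      rw [Matrix.diagonal_apply, one_smul])
    (fun t t' => corner_entry_ext he fun x y => by
      change (if x = y then (t x * t' x) • e x else 0) =
        ∑ j, (if x = j then t x • e x else 0) * if j = y then t' j • e j else 0
      rw [Finset.sum_eq_single x]
      · rw [if_pos rfl]
        split_ifs
        · rw [smul_mul_smul_comm, he]
        · rw [mul_zero]
      · intro j _ hj
        rw [if_neg (Ne.symm hj), zero_mul]
      · simp)

theorem diagonalCorner_val (t : X → k) (x y : X) :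
    (diagonalCorner he k t).1 x y = if x = y then t x • e x else 0 := rfl

theorem mul_diagonalCorner_single (z : (isIdempotentElem_diagonal he).Corner) (c x y : X) :
    (z * diagonalCorner he k (Pi.single c 1)).1 x y = if y = c then z.1 x c else 0 := by
  rw [corner_entry_mul he, Finset.sum_eq_single y, diagonalCorner_val, if_pos rfl]
  · by_cases h : y = c
    · subst h
      rw [Pi.single_eq_same, one_smul, corner_entry_mul_right he, if_pos rfl]
    · rw [Pi.single_eq_of_ne h, zero_smul, mul_zero, if_neg h]
  · intro j _ hj
    rw [diagonalCorner_val, if_neg hj, mul_zero]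
  · simp

end DiagonalCorner

section Blow

variable {k : Type u} [Field k] {D : MarkedAlgebra k} {H Q : Type u} [Ring H] [Algebra k H]
  [Ring Q] [Algebra k Q] {f : D.alg →ₐ[k] H} {π : H →ₐ[k] Q} {ι : (D.comp → k) →ₐ[k] Q}
  {ε : D.comp → D.alg}

theorem map_idem_mul_self (hε : D.IsDecomposition ε) (f : D.alg →ₐ[k] H) (c : D.comp) :
    f (ε c) * f (ε c) = f (ε c) := by
  rw [← map_mul, (hε.complete.idem c).eq]

theorem map_single_mul_self {X : Type*} [DecidableEq X] (ι : (X → k) →ₐ[k] Q) (c : X) :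
    ι (Pi.single c 1) * ι (Pi.single c 1) = ι (Pi.single c 1) := by
  rw [← map_mul, ← Pi.single_mul, one_mul]

theorem blow_idem_map (hε : D.IsDecomposition ε) (f : D.alg →ₐ[k] H) (a : D.comp)
    (x : BlowIndex a) : f (ε x.under) * f (ε x.under) = f (ε x.under) :=
  map_idem_mul_self hε f x.under

theorem blow_idem_single {X : Type} [DecidableEq X] (ι : (X → k) →ₐ[k] Q) (a : X)
    (x : BlowIndex a) :
    ι (Pi.single x.under 1) * ι (Pi.single x.under 1) = ι (Pi.single x.under 1) :=
  map_single_mul_self ι x.under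

/-- The ring in which a blowing up is embedded: an idempotent in a matrix ring cuts out the
endomorphisms of the projective module that corresponds to the components from `BlowIndex a`. -/
abbrev BlowRing (hε : D.IsDecomposition ε) (f : D.alg →ₐ[k] H) (a : D.comp) : Type u :=
  (isIdempotentElem_diagonal (blow_idem_map hε f a)).Corner

/-- The semisimple quotient of `BlowRing`. -/
abbrev BlowQuot (ι : (D.comp → k) →ₐ[k] Q) (a : D.comp) : Type u :=
  (isIdempotentElem_diagonal (blow_idem_single ι a)).Corner

/-- The inclusion of the product of the components of a blowing up. -/
def blowDiagonal (ι : (D.comp → k) →ₐ[k] Q) (a : D.comp) :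
    (BlowIndex a → k) →ₐ[k] BlowQuot ι a :=
  diagonalCorner (blow_idem_single ι a) k

theorem blowDiagonal_val (ι : (D.comp → k) →ₐ[k] Q) (a : D.comp) (t : BlowIndex a → k)
    (x y : BlowIndex a) :
    (blowDiagonal ι a t).1 x y = if x = y then t x • ι (Pi.single x.under 1) else 0 := rfl

theorem mul_blowDiagonal_single (ι : (D.comp → k) →ₐ[k] Q) (a : D.comp) (z : BlowQuot ι a)
    (c x y : BlowIndex a) :
    (z * blowDiagonal ι a (Pi.single c 1)).1 x y = if y = c then z.1 x c else 0 :=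
  mul_diagonalCorner_single (blow_idem_single ι a) k z c x y

theorem MarkedAlgebra.BlowIndex.under_ne {X : Type} {a : X} (c : {c : X // c ≠ a}) {x : BlowIndex a}
    (hx : x ≠ .inl c) : x.under ≠ c := by
  rcases x with d | s
  · exact fun h => hx (congrArg Sum.inl (Subtype.ext h))
  · exact Ne.symm c.2

/-- The embedding of the blowing up of `a`: the matrix of the images of the entries. -/
def blowEmbedding (hε : D.IsDecomposition ε) (f : D.alg →ₐ[k] H) (a : D.comp) :
    (D.blowUp ε hε a).alg →ₐ[k] BlowRing hε f a :=
  AlgHom.ofLinearMap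
    { toFun := fun φ : D.blowSubalgebra ε hε a =>
        cornerOfEntries (blow_idem_map hε f a) (fun x y => f (D.blowEntry ε a φ.1 x y))
          (fun x y => by rw [← map_mul, MarkedAlgebra.mul_blowEntry hε])
          (fun x y => by rw [← map_mul, MarkedAlgebra.blowEntry_mul_idem hε])
      map_add' := fun φ ψ => corner_entry_ext (blow_idem_map hε f a) fun x y => map_add f _ _
      map_smul' := fun r φ => corner_entry_ext (blow_idem_map hε f a) fun x y => map_smul f _ _ }
    (corner_entry_ext (blow_idem_map hε f a) fun x y => by
      change f (D.blowEntry ε a 1 x y) = (Matrix.diagonal _ : Matrix _ _ H) x y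
      rw [MarkedAlgebra.blowEntry_one, Matrix.diagonal_apply]
      split_ifs <;> simp)
    (fun φ ψ => corner_entry_ext (blow_idem_map hε f a) fun x y => by
      change f (D.blowEntry ε a (φ.1 * ψ.1) x y) =
        ∑ z, f (D.blowEntry ε a φ.1 x z) * f (D.blowEntry ε a ψ.1 z y)
      rw [MarkedAlgebra.blowEntry_mul hε, map_sum]
      simp only [map_mul])

theorem blowEmbedding_val (hε : D.IsDecomposition ε) (f : D.alg →ₐ[k] H) (a : D.comp)
    (φ : D.blowSubalgebra ε hε a) (x y : BlowIndex a) :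
    (blowEmbedding hε f a φ).1 x y = f (D.blowEntry ε a φ.1 x y) := rfl

/-- The projection of `BlowRing` onto its semisimple quotient. -/
def blowMap (hε : D.IsDecomposition ε) (hf : ∀ c, π (f (ε c)) = ι (Pi.single c 1))
    (a : D.comp) : BlowRing hε f a →ₐ[k] BlowQuot ι a :=
  cornerMap π.mapMatrix _ _ (by
    rw [AlgHom.mapMatrix_apply, Matrix.diagonal_map (map_zero π)]
    exact congrArg _ (funext fun x => hf x.under))

theorem blowMap_val (hε : D.IsDecomposition ε) (hf : ∀ c, π (f (ε c)) = ι (Pi.single c 1))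
    (a : D.comp) (h : BlowRing hε f a) (x y : BlowIndex a) :
    (blowMap hε hf a h).1 x y = π (h.1 x y) := rfl

theorem matrix_pow_mem {R : Type*} [Ring R] (J : Ideal R) [J.IsTwoSided] {X : Type*} [Fintype X]
    [DecidableEq X] {M : Matrix X X R} (hM : ∀ x y, M x y ∈ J) (n : ℕ) (x y : X) :
    (M ^ n) x y ∈ J ^ n := by
  induction n generalizing x y with
  | zero => rw [Submodule.pow_zero, Ideal.one_eq_top]; trivial
  | succ n ih =>
    rw [pow_succ, Matrix.mul_apply]
    refine Ideal.sum_mem _ fun z _ => ?_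
    rw [Submodule.pow_succ]
    exact Ideal.mul_mem_mul (ih x z) (hM z y)

theorem IsModel.idem_eq (hM : IsModel D f π ι) (hε : D.IsDecomposition ε) (c : D.comp) :
    π (f (ε c)) = ι (Pi.single c 1) := by
  rw [hM.comm, hε.proj_eq]

theorem IsModel.exists_ker_pow (hM : IsModel D f π ι) : ∃ n, RingHom.ker π ^ n = ⊥ := by
  have := hM.finite
  have := IsArtinianRing.of_finite k H
  rw [← hM.jacobson_eq]
  exact IsSemiprimaryRing.isNilpotent

theorem blowDiagonal_injective (hM : IsModel D f π ι) (a : D.comp) :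
    Function.Injective (blowDiagonal ι a) := by
  intro t t' h
  funext x
  have h1 : (blowDiagonal ι a t).1 x x = (blowDiagonal ι a t').1 x x :=
    congrArg (fun z => z.1 x x) h
  rw [blowDiagonal_val, blowDiagonal_val, if_pos rfl, if_pos rfl] at h1
  exact smul_left_injective k (hM.map_idem_ne_zero (BlowIndex.under x)) h1

theorem blowMap_blowEmbedding (hM : IsModel D f π ι) (hε : D.IsDecomposition ε) (a : D.comp)
    (φ : D.blowSubalgebra ε hε a) :
    blowMap hε (hM.idem_eq hε) a (blowEmbedding hε f a φ) =
      blowDiagonal ι a (D.blowProj ε hε a φ) := by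
  refine corner_entry_ext (blow_idem_single ι a) fun x y => ?_
  change π (f (D.blowEntry ε a φ.1 x y)) =
    if x = y then D.blowProj ε hε a φ x • ι (Pi.single x.under 1) else 0
  rw [hM.comm, MarkedAlgebra.proj_blowEntry hε]
  split_ifs
  · rw [map_smul]
  · rw [map_zero]

theorem exists_blowEmbedding_eq (hM : IsModel D f π ι) (hε : D.IsDecomposition ε) (a : D.comp)
    (h : BlowRing hε f a) (t : BlowIndex a → k)
    (ht : blowMap hε (hM.idem_eq hε) a h = blowDiagonal ι a t) :
    ∃ φ : D.blowSubalgebra ε hε a, blowEmbedding hε f a φ = h := by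
  have h1 : ∀ x y, π (h.1 x y) = ι (if x = y then t x • Pi.single x.under 1 else 0) := by
    intro x y
    rw [← blowMap_val hε (hM.idem_eq hε), ht]
    refine (blowDiagonal_val ι a t x y).trans ?_
    split_ifs
    · rw [map_smul]
    · rw [map_zero]
  choose d hd using fun x y => hM.exists_eq _ _ (h1 x y)
  obtain ⟨φ, hφ⟩ := MarkedAlgebra.exists_blowSubalgebra hε d
    (fun x y => hM.injective (by
      rw [map_mul, hd]
      exact corner_entry_mul_left (blow_idem_map hε f a) h x y))
    (fun x y => hM.injective (by
      rw [map_mul, hd]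
      exact corner_entry_mul_right (blow_idem_map hε f a) h x y))
    (fun x y hxy => by
      have := h1 x y
      rw [if_neg hxy, ← hd] at this
      exact hM.proj_eq_of_map_eq this)
  refine ⟨φ, corner_entry_ext (blow_idem_map hε f a) fun x y => ?_⟩
  rw [blowEmbedding_val, hφ, hd]

/-- The idempotents of the components of a blowing up generate left ideals of dimension at most two.
A column of a new component has only two nonzero entries, in the rows of the new components, and
they are scalar multiples of the idempotent of `a`. A column of an old component has zeros in these
two rows, so it is an element of the corresponding left ideal of `Q`, divided into rows. -/
theorem exists_mul_blowDiagonal_single (hM : IsModel D f π ι) {a : D.comp} (ha : IsLine ι a)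
    (x : BlowIndex a) :
    ∃ p q : BlowQuot ι a, ∀ z, ∃ s t : k,
      z * blowDiagonal ι a (Pi.single x 1) = s • p + t • q := by
  have h0 := map_single_mul_self ι
  have hl : ∀ (z : BlowQuot ι a) x y, ι (Pi.single x.under 1) * z.1 x y = z.1 x y :=
    corner_entry_mul_left (blow_idem_single ι a)
  have hr : ∀ (z : BlowQuot ι a) x y, z.1 x y * ι (Pi.single y.under 1) = z.1 x y :=
    corner_entry_mul_right (blow_idem_single ι a)
  rcases x with c | i
  · obtain ⟨p, q, hpq⟩ := hM.two c.1
    refine ⟨cornerColumn (blow_idem_single ι a) (.inl c) (Sum.elim (fun _ => p) fun _ => 0),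
      cornerColumn (blow_idem_single ι a) (.inl c) (Sum.elim (fun _ => q) fun _ => 0), fun z => ?_⟩
    -- the entries lie in different rows, hence all of them are recovered from their sum
    obtain ⟨s, t, hst⟩ := hpq (∑ d, z.1 (.inl d) (.inl c))
    refine ⟨s, t, corner_entry_ext (blow_idem_single ι a) fun x y => ?_⟩
    rw [mul_blowDiagonal_single, corner_val_add, corner_val_smul, corner_val_smul,
      Matrix.add_apply, Matrix.smul_apply, Matrix.smul_apply, cornerColumn_val, cornerColumn_val]
    split_ifs with hy
    · rcases x with d | j
      · have h1 : ι (Pi.single d.1 1) * ((∑ d, z.1 (.inl d) (.inl c)) * ι (Pi.single c.1 1)) *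
            ι (Pi.single c.1 1) = z.1 (.inl d) (.inl c) := by
          rw [mul_assoc, mul_assoc _ _ (ι _), h0, Finset.sum_mul, Finset.mul_sum,
            Finset.sum_eq_single d]
          · exact (congrArg _ (hr z (.inl d) (.inl c))).trans (hl z (.inl d) (.inl c))
          · intro d' _ hd
            rw [← hl, mul_assoc, ← mul_assoc]
            change ι (Pi.single d.1 1) * ι (Pi.single d'.1 1) * _ = 0
            rw [(complete_map_single ι).ortho (fun h => hd (Subtype.ext h.symm)), zero_mul]
          · simp
        rw [← h1, hst, mul_add, add_mul]
        simp only [mul_smul_comm, smul_mul_assoc]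
        rfl
      · rw [← hr, ← hl]
        change ι (Pi.single a 1) * _ * ι (Pi.single c.1 1) = _
        rw [ha.mul_eq_zero hM.semiprime (Ne.symm c.2)]
        simp
    · simp
  · refine ⟨cornerColumn (blow_idem_single ι a) (.inr i) (Pi.single (.inr 0) 1),
      cornerColumn (blow_idem_single ι a) (.inr i) (Pi.single (.inr 1) 1), fun z => ?_⟩
    obtain ⟨s, hs⟩ := ha (z.1 (.inr 0) (.inr i))
    obtain ⟨t, ht⟩ := ha (z.1 (.inr 1) (.inr i))
    refine ⟨s, t, corner_entry_ext (blow_idem_single ι a) fun x y => ?_⟩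
    rw [mul_blowDiagonal_single, corner_val_add, corner_val_smul, corner_val_smul,
      Matrix.add_apply, Matrix.smul_apply, Matrix.smul_apply, cornerColumn_val, cornerColumn_val]
    split_ifs with hy
    · rcases x with d | j
      · rw [← hr, ← hl]
        change ι (Pi.single d.1 1) * _ * ι (Pi.single a 1) = _
        rw [ha.mul_eq_zero' d.2]
        simp
      · rw [← hr]
        change _ * ι (Pi.single a 1) = s • (ι (Pi.single a 1) * _ * ι (Pi.single a 1)) +
          t • (ι (Pi.single a 1) * _ * ι (Pi.single a 1))
        fin_cases j
        · refine hs.trans ?_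
          simp [h0]
        · refine ht.trans ?_
          simp [h0]
    · simp

/-- Blowing up a component that generates a one-dimensional left ideal gives an algebra with a
model. The overring is the endomorphism ring of the projective `H`-module which is induced from the
module that defines the blowing up. -/
theorem IsModel.blowUp (hM : IsModel D f π ι) (hε : D.IsDecomposition ε) {a : D.comp}
    (ha : IsLine ι a) :
    IsModel (D.blowUp ε hε a) (blowEmbedding hε f a) (blowMap hε (hM.idem_eq hε) a)
      (blowDiagonal ι a) where
  finite := by
    have := hM.finite
    infer_instance
  hereditary := (hM.hereditary.matrix _).corner _
  injective φ ψ h := by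
    refine Subtype.ext (MarkedAlgebra.blowEnd_ext hε fun x y => hM.injective ?_)
    have h1 := congrArg (fun z : BlowRing hε f a => z.1 x y) h
    exact h1
  surjective z := by
    choose h hh using fun x y => hM.surjective (z.1 x y)
    refine ⟨cornerOfEntries (blow_idem_map hε f a)
      (fun x y => f (ε x.under) * h x y * f (ε y.under)) ?_ ?_, ?_⟩
    · intro x y
      rw [← mul_assoc, ← mul_assoc, map_idem_mul_self hε f]
    · intro x y
      rw [mul_assoc, map_idem_mul_self hε f]
    · refine corner_entry_ext (blow_idem_single ι a) fun x y => ?_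
      rw [blowMap_val, cornerOfEntries_val, map_mul, map_mul, hh, hM.idem_eq hε, hM.idem_eq hε]
      rw [corner_entry_mul_left (blow_idem_single ι a),
        corner_entry_mul_right (blow_idem_single ι a)]
  injective_idem := blowDiagonal_injective hM a
  comm := blowMap_blowEmbedding hM hε a
  exists_eq := exists_blowEmbedding_eq hM hε a
  nil h hh := by
    obtain ⟨n, hn⟩ := hM.exists_ker_pow
    have h1 : ∀ m, (h ^ (m + 1)).1 = h.1 ^ (m + 1) := by
      intro m
      induction m with
      | zero => rw [zero_add, pow_one, pow_one]
      | succ m ih => rw [pow_succ, pow_succ _ (m + 1), ← ih]; rfl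
    refine ⟨n + 1, corner_entry_ext (blow_idem_map hε f a) fun x y => ?_⟩
    rw [h1]
    have h2 := matrix_pow_mem (RingHom.ker π) (M := h.1) (fun x y => by
      rw [RingHom.mem_ker, ← blowMap_val hε (hM.idem_eq hε), hh]
      rfl) (n + 1) x y
    have h3 := Ideal.pow_le_pow_right (Nat.le_succ n) h2
    rw [hn] at h3
    exact h3
  semiprime z hz := corner_entry_ext (blow_idem_single ι a) fun x y =>
    hM.semiprime _ (corner_entry_mul_single_mul (blow_idem_single ι a) z x y hz)
  two := exists_mul_blowDiagonal_single hM ha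

theorem IsLine.blowUp {a : D.comp}
    (c : {c : D.comp // c ≠ a}) (hc : IsLine ι c.1) :
    IsLine (blowDiagonal ι a) (.inl c) := by
  intro z
  obtain ⟨s, hs⟩ := hc (z.1 (.inl c) (.inl c))
  refine ⟨s, corner_entry_ext (blow_idem_single ι a) fun x y => ?_⟩
  rw [mul_blowDiagonal_single, corner_val_smul, Matrix.smul_apply, blowDiagonal_val]
  by_cases hy : y = .inl c
  · subst hy
    rw [if_pos rfl]
    by_cases hx : x = .inl c
    · subst hx
      rw [if_pos rfl, Pi.single_eq_same, one_smul]
      refine Eq.trans ?_ hs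
      exact (corner_entry_mul_right (blow_idem_single ι a) z _
        (.inl c)).symm
    · rw [if_neg hx, smul_zero, ← corner_entry_mul_left
        (blow_idem_single ι a) z, ← corner_entry_mul_right
        (blow_idem_single ι a) z, ← mul_assoc]
      exact hc.mul_eq_zero' (BlowIndex.under_ne c hx) _
  · rw [if_neg hy]
    split_ifs with hx
    · subst hx
      rw [Pi.single_eq_of_ne hy, zero_smul, smul_zero]
    · rw [smul_zero]

end Blow

/-! ### Suitable sequences -/

namespace MarkedAlgebra

variable {k : Type u} [Field k] {B C : MarkedAlgebra k}

theorem eq_of_glueKeep_eq_some {a b c : C.comp} {x : (C.glue a b).comp}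
    (h : C.glueKeep a b c = some x) : ∃ hc : c ≠ a ∧ c ≠ b, x = some ⟨c, hc⟩ := by
  unfold glueKeep at h
  split_ifs at h with hc
  exact ⟨hc, (Option.some.inj h).symm⟩

theorem eq_of_blowKeep_eq_some {ε : C.comp → C.alg} {hε : C.IsDecomposition ε} {a c : C.comp}
    {x : BlowIndex a} (h : C.blowKeep ε hε a c = some x) : ∃ hc : c ≠ a, x = .inl ⟨c, hc⟩ := by
  unfold blowKeep at h
  split_ifs at h with hc
  exact ⟨hc, (Option.some.inj h).symm⟩

theorem glueKeep_left (a b : C.comp) : C.glueKeep a b a = none := dif_neg fun h => h.1 rfl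

theorem glueKeep_right (a b : C.comp) : C.glueKeep a b b = none := dif_neg fun h => h.2 rfl

theorem blowKeep_self (ε : C.comp → C.alg) (hε : C.IsDecomposition ε) (a : C.comp) :
    C.blowKeep ε hε a a = none := dif_neg fun h => h rfl

/-- Different components of `B` are identified with different components of `C`. -/
theorem SuitableStep.eq_of_old_eq {gl : List (B.comp × B.comp)} {bl : List B.comp}
    {old : B.comp → Option C.comp} (h : SuitableStep B gl bl C old) {b b' : B.comp} {c : C.comp}
    (hb : old b = some c) (hb' : old b' = some c) : b = b' := by
  induction h with
  | start => exact Option.some.inj (hb.trans hb'.symm)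
  | glue _ _ _ _ ih =>
    obtain ⟨x, hx, hx'⟩ := Option.bind_eq_some_iff.1 hb
    obtain ⟨y, hy, hy'⟩ := Option.bind_eq_some_iff.1 hb'
    obtain ⟨_, rfl⟩ := eq_of_glueKeep_eq_some hx'
    obtain ⟨_, h⟩ := eq_of_glueKeep_eq_some hy'
    obtain rfl := congrArg Subtype.val (Option.some.inj h)
    exact ih hx hy
  | blowUp _ _ _ _ ih =>
    obtain ⟨x, hx, hx'⟩ := Option.bind_eq_some_iff.1 hb
    obtain ⟨y, hy, hy'⟩ := Option.bind_eq_some_iff.1 hb'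
    obtain ⟨_, rfl⟩ := eq_of_blowKeep_eq_some hx'
    obtain ⟨_, h⟩ := eq_of_blowKeep_eq_some hy'
    obtain rfl := congrArg Subtype.val (Sum.inl.inj h)
    exact ih hx hy

/-- All components that take part in a sequence are pairwise different, because those that have been
glued or blown up do not survive. -/
theorem SuitableStep.old_eq_none_and_nodup {gl : List (B.comp × B.comp)} {bl : List B.comp}
    {old : B.comp → Option C.comp} (h : SuitableStep B gl bl C old) :
    (∀ b ∈ gl.map Prod.fst ++ bl ++ gl.map Prod.snd, old b = none) ∧
      (gl.map Prod.fst ++ bl ++ gl.map Prod.snd).Nodup := by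
  induction h with
  | start => simp
  | @glue gl C old i j a b _ hij ha hb ih =>
    have hi : i ∉ gl.map Prod.fst ++ [] ++ gl.map Prod.snd := fun h => by
      simp [ih.1 i h] at ha
    have hj : j ∉ gl.map Prod.fst ++ [] ++ gl.map Prod.snd := fun h => by
      simp [ih.1 j h] at hb
    constructor
    · intro c hc
      have : c = i ∨ c = j ∨ c ∈ gl.map Prod.fst ++ [] ++ gl.map Prod.snd := by
        simp only [List.map_cons, List.append_nil, List.mem_append, List.mem_cons] at hc ⊢
        tauto
      change (old c).bind _ = none
      rcases this with rfl | rfl | h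
      · rw [ha]; exact glueKeep_left a b
      · rw [hb]; exact glueKeep_right a b
      · rw [ih.1 c h]; rfl
    · have h2 := ih.2
      rw [List.append_nil] at hi hj h2
      rw [List.map_cons, List.append_nil, List.map_cons, List.cons_append, List.nodup_cons,
        List.nodup_middle, List.nodup_cons]
      refine ⟨?_, hj, h2⟩
      simp only [List.mem_append, List.mem_cons] at hi ⊢
      tauto
  | @blowUp gl bl C old i a ε hε _ ha ih =>
    have hi : i ∉ gl.map Prod.fst ++ bl ++ gl.map Prod.snd := fun h => by
      simp [ih.1 i h] at ha
    constructor
    · intro c hc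
      have : c = i ∨ c ∈ gl.map Prod.fst ++ bl ++ gl.map Prod.snd := by
        simp only [List.mem_append, List.mem_cons] at hc ⊢
        tauto
      change (old c).bind _ = none
      rcases this with rfl | h
      · rw [ha]; exact blowKeep_self ε hε a
      · rw [ih.1 c h]; rfl
    · have h2 := ih.2
      rw [List.append_assoc] at hi h2
      rw [List.append_assoc, List.cons_append, List.nodup_middle, List.nodup_cons]
      exact ⟨hi, h2⟩

/-- A sequence of gluings and blowings up that starts with a basic hereditary algebra
yields algebras that have models, in which the components not involved so far generate
one-dimensional left ideals; so the next operation is applied to such components. -/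
theorem SuitableStep.exists_isModel (hB : B.IsBasic) (hH : IsHereditary B.alg)
    {gl : List (B.comp × B.comp)} {bl : List B.comp} {old : B.comp → Option C.comp}
    (h : SuitableStep B gl bl C old) :
    ∃ (H Q : Type u) (_ : Ring H) (_ : Algebra k H) (_ : Ring Q) (_ : Algebra k Q)
      (f : C.alg →ₐ[k] H) (π : H →ₐ[k] Q) (ι : (C.comp → k) →ₐ[k] Q),
      IsModel C f π ι ∧ ∀ b c, old b = some c → IsLine ι c := by
  induction h with
  | start => exact ⟨_, _, _, _, _, _, _, _, _, isModel_self hB hH, fun _ c _ => isLine_id c⟩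
  | @glue gl C old i j a b h hij ha hb ih =>
    obtain ⟨H, Q, _, _, _, _, f, π, ι, hM, hl⟩ := ih
    have hab : a ≠ b := by
      rintro rfl
      exact hij (h.eq_of_old_eq ha hb)
    refine ⟨_, _, _, _, _, _, _, _, _, hM.glue hab (hl _ _ ha) (hl _ _ hb), fun c x hx => ?_⟩
    obtain ⟨y, hy, hy'⟩ := Option.bind_eq_some_iff.1 hx
    obtain ⟨hc, rfl⟩ := eq_of_glueKeep_eq_some hy'
    exact IsLine.glue (c := ⟨y, hc⟩) (hl c y hy)
  | @blowUp gl bl C old i a ε hε h ha ih =>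
    obtain ⟨H, Q, _, _, _, _, f, π, ι, hM, hl⟩ := ih
    refine ⟨_, _, _, _, _, _, _, _, _, hM.blowUp hε (hl _ _ ha), fun c x hx => ?_⟩
    obtain ⟨y, hy, hy'⟩ := Option.bind_eq_some_iff.1 hx
    obtain ⟨hc, rfl⟩ := eq_of_blowKeep_eq_some hy'
    exact IsLine.blowUp ⟨y, hc⟩ (hl c y hy)

end MarkedAlgebra

/-! ### Algebras with a model are nodal -/

theorem length_le_two {k A : Type*} [Field k] [Ring A] [Algebra k A] (V : Type*) [AddCommGroup V]
    [Module A V] (p q : V) (h : ∀ v, ∃ s t : k, v = algebraMap k A s • p + algebraMap k A t • q) :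
    Module.length A V ≤ 2 := by
  let _ : Module k V := Module.compHom V (algebraMap k A)
  have : IsScalarTower k A V := IsScalarTower.of_algebraMap_smul fun _ _ => rfl
  have hsurj : Function.Surjective (Fintype.linearCombination k ![p, q]) := by
    intro v
    obtain ⟨s, t, rfl⟩ := h v
    refine ⟨![s, t], ?_⟩
    rw [Fintype.linearCombination_apply, Fin.sum_univ_two]
    rfl
  calc Module.length A V ≤ Module.length k V := by
        rw [← Module.length_top (R := A), ← Module.length_top (R := k) (M := V)]
        exact Submodule.length_le_length_restrictScalars k ⊤
    _ ≤ Module.length k (Fin 2 → k) := Module.length_le_of_surjective _ hsurj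
    _ = 2 := by simp

/-- Simple modules over basic algebras are one-dimensional. -/
theorem exists_smul_eq_of_isSimpleModule {k A X : Type*} [Field k] [Ring A] [Algebra k A]
    [Fintype X] [DecidableEq X] (p : A →ₐ[k] (X → k)) (hp : Function.Surjective p)
    (hnil : ∀ a, p a = 0 → IsNilpotent a) (U : Type*) [AddCommGroup U] [Module A U]
    [IsSimpleModule A U] :
    ∃ x, ∃ u : U, u ≠ 0 ∧ ∀ a, a • u = algebraMap k A (p a x) • u := by
  have hann : ∀ a (u : U), p a = 0 → a • u = 0 := by
    intro a u ha
    by_contra hne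
    obtain ⟨b, hb⟩ := IsSimpleModule.toSpanSingleton_surjective A hne u
    obtain ⟨n, hn⟩ := hnil (b * a) (by rw [map_mul, ha, mul_zero])
    have hb' : (b * a) • u = u := by rw [mul_smul]; exact hb
    have : ∀ n, (b * a) ^ n • u = u := by
      intro n
      induction n with
      | zero => rw [pow_zero, one_smul]
      | succ n ih => rw [pow_succ, mul_smul, hb', ih]
    have h0 := this n
    rw [hn, zero_smul] at h0
    exact hne (by rw [← h0, smul_zero])
  have heq : ∀ a b (u : U), p a = p b → a • u = b • u := by
    intro a b u hab
    rw [← sub_eq_zero, ← sub_smul, hann _ u (by rw [map_sub, hab, sub_self])]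
  have := IsSimpleModule.nontrivial A U
  obtain ⟨v, hv⟩ := exists_ne (0 : U)
  choose ε hε using fun x => hp (Pi.single x 1)
  obtain ⟨x, hx⟩ : ∃ x, ε x • v ≠ 0 := by
    by_contra! h
    apply hv
    rw [← one_smul A v, heq 1 (∑ x, ε x) v, Finset.sum_smul]
    · exact Finset.sum_eq_zero fun c _ => h c
    · simp only [map_one, map_sum, hε]
      exact (CompleteOrthogonalIdempotents.single fun _ : X => k).complete.symm
  refine ⟨x, ε x • v, hx, fun a => ?_⟩
  rw [← mul_smul, ← mul_smul]
  apply heq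
  funext y
  rw [map_mul, map_mul, hε, AlgHom.commutes]
  by_cases h : y = x
  · subst h; simp
  · simp [h]

section Induced

variable {A : Type v} {H : Type u} [Ring A] [Ring H] (f : A →+* H)
  (U : Type v) [AddCommGroup U] [Module A U]

variable {U} in
/-- The element `h ⊗ u` of `H ⊗_A U`. -/
def Induced.tmul (h : H) (u : U) : Induced f U := Submodule.Quotient.mk (h ⊗ₜ u)

variable {U} in
theorem Induced.tmul_smul (h : H) (a : A) (u : U) :
    Induced.tmul f h (a • u) = Induced.tmul f (h * f a) u := by
  refine ((Submodule.Quotient.eq _).2 ?_).symm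
  exact Submodule.subset_span ⟨h, a, u, rfl⟩

variable {U} in
theorem Induced.add_tmul (h h' : H) (u : U) :
    Induced.tmul f (h + h') u = Induced.tmul f h u + Induced.tmul f h' u := by
  unfold Induced.tmul
  rw [TensorProduct.add_tmul]
  rfl

variable {U} in
theorem Induced.smul_tmul (r h : H) (u : U) :
    Induced.tmul f (r * h) u = r • Induced.tmul f h u := rfl

variable {U} in
theorem Induced.induction {p : Induced f U → Prop} (h0 : p 0)
    (ht : ∀ h u, p (Induced.tmul f h u)) (ha : ∀ x y, p x → p y → p (x + y)) (x : Induced f U) :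
    p x := by
  obtain ⟨t, rfl⟩ := Submodule.Quotient.mk_surjective _ x
  induction t using TensorProduct.induction_on with
  | zero => exact h0
  | tmul h u => exact ht h u
  | add t t' h h' => exact ha _ _ h h'

end Induced

variable {k : Type u} [Field k] {D : MarkedAlgebra k} {H Q : Type u} [Ring H] [Algebra k H]
  [Ring Q] [Algebra k Q] {f : D.alg →ₐ[k] H} {π : H →ₐ[k] Q} {ι : (D.comp → k) →ₐ[k] Q}

/-- The tensor product `H ⊗ U` with the simple module `U` that corresponds to the component `x` is
spanned by the elements `p ⊗ u` and `q ⊗ u` if `p` and `q` span the left ideal of `x` modulo the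
radical of `H`. -/
theorem IsModel.isNodal (hM : IsModel D f π ι) {A : Type v} [Ring A] [Algebra k A]
    (e : A ≃ₐ[k] D.alg) : IsNodal k A := by
  have hB := hM.isBasic
  have := hM.finite
  have := hB.finite
  have : FiniteDimensional k A := e.symm.toLinearEquiv.finiteDimensional
  have := IsArtinianRing.of_finite k A
  have hnil : ∀ a, D.proj (e a) = 0 → IsNilpotent a := by
    intro a ha
    obtain ⟨n, hn⟩ := hB.isNilpotent ha
    exact ⟨n, e.injective (by rw [map_pow, hn, map_zero])⟩
  have hJ : Ring.jacobson A = RingHom.ker (D.proj.comp e.toAlgHom).toRingHom := by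
    refine jacobson_eq_ker _ (hB.surjective.comp e.surjective) hnil fun z hz => ?_
    have := hz 1
    rw [mul_one] at this
    exact funext fun c => mul_self_eq_zero.1 (congrFun this c)
  have hmem : ∀ a, a ∈ Ring.jacobson A ↔ D.proj (e a) = 0 := by
    intro a
    rw [hJ]
    rfl
  have hmem' : ∀ h, h ∈ Ring.jacobson H ↔ π h = 0 := by
    intro h
    rw [hM.jacobson_eq]
    rfl
  have himage : f.comp e.toAlgHom '' (Ring.jacobson A : Set A) = (Ring.jacobson H : Set H) := by
    ext h
    constructor
    · rintro ⟨a, ha, rfl⟩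
      refine (hmem' _).2 ?_
      change π (f (e a)) = 0
      rw [hM.comm, (hmem a).1 ha, map_zero]
    · intro hh
      have h0 := (hmem' h).1 hh
      obtain ⟨d, rfl⟩ := hM.exists_eq h 0 (by rw [h0, map_zero])
      refine ⟨e.symm d, (hmem _).2 ?_, congrArg f (e.apply_symm_apply d)⟩
      rw [e.apply_symm_apply]
      exact hM.proj_eq_of_map_eq (by rw [h0, map_zero])
  refine ⟨H, _, _, f.comp e.toAlgHom, hM.finite, hM.hereditary, hM.injective.comp e.injective,
    ?_, himage, ?_⟩
  · rw [← himage]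
    exact Set.image_subset_range _ _
  · intro U _ _ hU
    obtain ⟨ε, hε⟩ := hB.exists_isDecomposition
    obtain ⟨x, u, hx, hxa⟩ := exists_smul_eq_of_isSimpleModule (D.proj.comp e.toAlgHom)
      (hB.surjective.comp e.surjective) hnil U
    have hxu : e.symm (ε x) • u = u := by
      rw [hxa]
      change algebraMap k A (D.proj (e (e.symm (ε x))) x) • u = u
      rw [e.apply_symm_apply, hε.proj_eq, Pi.single_eq_same, map_one, one_smul]
    obtain ⟨p, q, hpq⟩ := hM.two x
    obtain ⟨p, rfl⟩ := hM.surjective p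
    obtain ⟨q, rfl⟩ := hM.surjective q
    let F : A →+* H := (f.comp e.toAlgHom).toRingHom
    have hF : ∀ a, F a = f (e a) := fun _ => rfl
    have key : ∀ h : H, ∃ s t : k, Induced.tmul F h u =
        F (algebraMap k A s) • Induced.tmul F p u + F (algebraMap k A t) • Induced.tmul F q u := by
      intro h
      obtain ⟨s, t, hst⟩ := hpq (π h)
      rw [← hM.idem_eq hε, ← map_mul, ← map_smul, ← map_smul, ← map_add, ← sub_eq_zero,
        ← map_sub] at hst
      obtain ⟨d, hd⟩ := hM.exists_eq _ 0 (hst.trans (map_zero ι).symm)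
      have hd0 : D.proj d = 0 := hM.proj_eq_of_map_eq (by rw [hd, hst, map_zero])
      refine ⟨s, t, ?_⟩
      have h1 : F (algebraMap k A s) = algebraMap k H s := AlgHom.commutes _ s
      have h2 : F (algebraMap k A t) = algebraMap k H t := AlgHom.commutes _ t
      have h3 : Induced.tmul F (f d) u = 0 := by
        rw [← e.apply_symm_apply d, ← hF, ← one_mul (F _), ← Induced.tmul_smul,
          hxa]
        change Induced.tmul F 1 (algebraMap k A (D.proj (e (e.symm d)) x) • u) = 0
        rw [e.apply_symm_apply, hd0, Pi.zero_apply, map_zero, zero_smul]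
        unfold Induced.tmul
        rw [TensorProduct.tmul_zero]
        rfl
      conv_lhs => rw [← hxu]
      rw [Induced.tmul_smul, hF, e.apply_symm_apply, h1, h2, ← Induced.smul_tmul,
        ← Induced.smul_tmul, ← Induced.add_tmul, ← Algebra.smul_def, ← Algebra.smul_def,
        ← sub_add_cancel (h * f (ε x)) (s • p + t • q), ← hd, Induced.add_tmul, h3, zero_add]
    let _ : Module A (Induced F U) := Module.compHom _ F
    refine length_le_two (k := k) (Induced F U) (Induced.tmul F p u) (Induced.tmul F q u) ?_
    intro w
    induction w using Induced.induction with
    | h0 => exact ⟨0, 0, by simp⟩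
    | ht h w =>
      obtain ⟨a, rfl⟩ := IsSimpleModule.toSpanSingleton_surjective A hx w
      rw [LinearMap.toSpanSingleton_apply, Induced.tmul_smul]
      exact key _
    | ha w w' hw hw' =>
      obtain ⟨s, t, rfl⟩ := hw
      obtain ⟨s', t', rfl⟩ := hw'
      refine ⟨s + s', t + t', ?_⟩
      rw [map_add, map_add, add_smul, add_smul]
      abel

/-! ### Nodal algebras have models -/

/-- Over a basic algebra the dimension of a module is at most its length. -/
theorem exists_span_of_length_le {k A X : Type*} [Field k] [Ring A] [Algebra k A]
    [Fintype X] [DecidableEq X] (p : A →ₐ[k] (X → k)) (hp : Function.Surjective p)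
    (hnil : ∀ a, p a = 0 → IsNilpotent a) (n : ℕ) (M : Type*) [AddCommGroup M] [Module A M]
    (hM : Module.length A M ≤ n) :
    ∃ v : Fin n → M, ∀ m, ∃ c : Fin n → k, m = ∑ i, algebraMap k A (c i) • v i := by
  induction n generalizing M with
  | zero =>
    have : Subsingleton M := Module.length_eq_zero_iff.1 (by simpa using hM)
    exact ⟨fun _ => 0, fun m => ⟨fun _ => 0, Subsingleton.elim _ _⟩⟩
  | succ n ih =>
    cases subsingleton_or_nontrivial M with
    | inl h => exact ⟨fun _ => 0, fun m => ⟨fun _ => 0, Subsingleton.elim _ _⟩⟩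
    | inr h =>
      have hfin : IsFiniteLength A M := Module.length_ne_top_iff.1
        (ne_top_of_le_ne_top (ENat.natCast_ne_top _) hM)
      have := (isFiniteLength_iff_isNoetherian_isArtinian.1 hfin).1
      obtain ⟨N, hN, -⟩ := (eq_top_or_exists_le_coatom (⊥ : Submodule A M)).resolve_left bot_ne_top
      have hs : IsSimpleModule A (M ⧸ N) := isSimpleModule_iff_isCoatom.2 hN
      have hlen : Module.length A N ≤ n := by
        have h1 := Module.length_eq_add_of_exact N.subtype N.mkQ N.subtype_injective
          N.mkQ_surjective (LinearMap.exact_subtype_mkQ N)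
        rw [Module.length_eq_one A (M ⧸ N)] at h1
        rw [h1] at hM
        push_cast at hM
        exact (ENat.add_le_add_iff_right ENat.one_ne_top).1 hM
      obtain ⟨v, hv⟩ := ih N hlen
      obtain ⟨x, u, hu, hux⟩ := exists_smul_eq_of_isSimpleModule p hp hnil (M ⧸ N)
      obtain ⟨w, rfl⟩ := N.mkQ_surjective u
      refine ⟨Fin.cons w fun i => (v i).1, fun m => ?_⟩
      obtain ⟨a, ha⟩ := IsSimpleModule.toSpanSingleton_surjective A hu (N.mkQ m)
      rw [LinearMap.toSpanSingleton_apply, hux] at ha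
      rw [← map_smul, ← sub_eq_zero, ← map_sub, ← neg_eq_zero, ← map_neg, neg_sub,
        Submodule.mkQ_apply, Submodule.Quotient.mk_eq_zero] at ha
      obtain ⟨c, hc⟩ := hv ⟨_, ha⟩
      refine ⟨Fin.cons (p a x) c, ?_⟩
      rw [Fin.sum_univ_succ]
      have h2 := congrArg Subtype.val hc
      rw [Submodule.coe_sum] at h2
      simp only [Fin.cons_zero, Fin.cons_succ]
      rw [← sub_eq_iff_eq_add']
      exact h2

section Pullback

variable {k : Type u} [Field k] {H Q : Type u} [Ring H] [Algebra k H]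
  [Ring Q] [Algebra k Q] (π : H →ₐ[k] Q) {X : Type} [Fintype X] [DecidableEq X]
  (ι : (X → k) →ₐ[k] Q) (hι : Function.Injective ι)

/-- The preimage in `H` of a subalgebra `k ^ X` of `Q`. -/
def pullback : MarkedAlgebra k where
  alg := ι.range.comap π
  comp := X
  proj := (AlgEquiv.ofInjective ι hι).symm.toAlgHom.comp
    ((π.comp (ι.range.comap π).val).codRestrict ι.range fun d => d.2)

theorem map_pullback_proj (d : ι.range.comap π) : ι ((pullback π ι hι).proj d) = π d.1 :=
  congrArg Subtype.val ((AlgEquiv.ofInjective ι hι).apply_symm_apply ⟨π d.1, d.2⟩)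

/-- The embedding of the preimage. -/
def pullbackVal : (pullback π ι hι).alg →ₐ[k] H := (ι.range.comap π).val

theorem isModel_pullback [FiniteDimensional k H] (hH : IsHereditary H)
    (hπ : Function.Surjective π) (hnil : ∀ h, π h = 0 → IsNilpotent h)
    (hQ : ∀ z : Q, (∀ w, z * w * z = 0) → z = 0)
    (htwo : ∀ x, ∃ p q : Q, ∀ z, ∃ s t : k, z * ι (Pi.single x 1) = s • p + t • q) :
    IsModel (pullback π ι hι) (pullbackVal π ι hι) π ι where
  finite := inferInstance
  hereditary := hH
  injective := Subtype.val_injective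
  surjective := hπ
  injective_idem := hι
  comm d := (map_pullback_proj π ι hι d).symm
  exists_eq h t ht := ⟨⟨h, t, ht.symm⟩, rfl⟩
  nil := hnil
  semiprime := hQ
  two := htwo

end Pullback

/-- The semisimple quotient of the overring is `Q = H / rad H`. For the simple module `U` that
corresponds to a component, multiplication maps `H ⊗ U` onto the left ideal of `Q` generated by
the idempotent of this component, so its length is an upper bound for the dimension. -/
theorem exists_isModel_of_isNodal {k : Type u} [Field k] {A : Type v} [Ring A] [Algebra k A]
    [FiniteDimensional k A] (hA : IsBasic k A) (hN : IsNodal k A) :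
    ∃ (D : MarkedAlgebra k) (H Q : Type u) (_ : Ring H) (_ : Algebra k H) (_ : Ring Q)
      (_ : Algebra k Q) (f : D.alg →ₐ[k] H) (π : H →ₐ[k] Q) (ι : (D.comp → k) →ₐ[k] Q),
      IsModel D f π ι ∧ Nonempty (A ≃ₐ[k] D.alg) := by
  obtain ⟨s, ⟨e⟩⟩ := hA
  obtain ⟨H, _, _, f, _, hH, hf, hJ, hJ', hU⟩ := hN
  have := IsArtinianRing.of_finite k H
  have := IsArtinianRing.of_finite k A
  let p : A →ₐ[k] (Fin s → k) := e.toAlgHom.comp (Ideal.Quotient.mkₐ k (Ring.jacobson A))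
  have hp : Function.Surjective p := e.surjective.comp Ideal.Quotient.mk_surjective
  have hp0 : ∀ a, p a = 0 ↔ a ∈ Ring.jacobson A := fun a =>
    (EmbeddingLike.map_eq_zero_iff (f := e)).trans Ideal.Quotient.eq_zero_iff_mem
  have hnil : ∀ a, p a = 0 → IsNilpotent a := fun a ha =>
    isNilpotent_of_mem_jacobson ((hp0 a).1 ha)
  let π : H →ₐ[k] (H ⧸ Ring.jacobson H) := Ideal.Quotient.mkₐ k (Ring.jacobson H)
  have hπ : Function.Surjective π := Ideal.Quotient.mk_surjective
  have hπ0 : ∀ h, π h = 0 ↔ h ∈ Ring.jacobson H := fun h => Ideal.Quotient.eq_zero_iff_mem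
  have hf0 : ∀ a, π (f a) = 0 ↔ p a = 0 := by
    intro a
    rw [hp0, hπ0, ← SetLike.mem_coe, ← hJ', hf.mem_set_image]
    rfl
  let L : (A ⧸ Ring.jacobson A) →ₐ[k] (H ⧸ Ring.jacobson H) :=
    Ideal.Quotient.liftₐ (Ring.jacobson A) (π.comp f) fun a ha => (hf0 a).2 ((hp0 a).2 ha)
  let ι : (Fin s → k) →ₐ[k] (H ⧸ Ring.jacobson H) := L.comp e.symm.toAlgHom
  have hιp : ∀ a, ι (p a) = π (f a) := by
    intro a
    change L (e.symm (e _)) = _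
    rw [e.symm_apply_apply]
    rfl
  have hι : Function.Injective ι := by
    rw [injective_iff_map_eq_zero]
    intro t ht
    obtain ⟨a, rfl⟩ := hp t
    rwa [hιp, hf0] at ht
  have htwo : ∀ x, ∃ p q, ∀ z, ∃ s t : k, z * ι (Pi.single x 1) = s • p + t • q := by
    intro x
    -- the simple module that corresponds to the component `x`
    let P : Submodule A A :=
      { carrier := {a | p a x = 0}
        zero_mem' := by simp
        add_mem' := fun {a b} ha hb => by
          change p (a + b) x = 0
          rw [map_add, Pi.add_apply, show p a x = 0 from ha, show p b x = 0 from hb, add_zero]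
        smul_mem' := fun r a ha => by
          change p (r * a) x = 0
          rw [map_mul, Pi.mul_apply, show p a x = 0 from ha, mul_zero] }
    have hP : ∀ a, a ∈ P ↔ p a x = 0 := fun a => Iff.rfl
    have hs : IsSimpleModule A (A ⧸ P) := by
      rw [isSimpleModule_iff_toSpanSingleton_surjective]
      constructor
      · obtain ⟨a, ha⟩ := hp (Pi.single x 1)
        refine ⟨Submodule.Quotient.mk a, 0, fun h => ?_⟩
        rw [Submodule.Quotient.mk_eq_zero, hP, ha, Pi.single_eq_same] at h
        exact one_ne_zero h
      · intro u hu v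
        obtain ⟨a, rfl⟩ := Submodule.Quotient.mk_surjective _ u
        obtain ⟨b, rfl⟩ := Submodule.Quotient.mk_surjective _ v
        rw [Ne, Submodule.Quotient.mk_eq_zero, hP] at hu
        refine ⟨algebraMap k A (p b x * (p a x)⁻¹), ?_⟩
        rw [LinearMap.toSpanSingleton_apply, ← Submodule.Quotient.mk_smul, Submodule.Quotient.eq,
          hP, map_sub, smul_eq_mul, map_mul, AlgHom.commutes]
        simp [hu]
    let χ : (A ⧸ P) →+ k := QuotientAddGroup.lift P.toAddSubgroup
      ((Pi.evalAddMonoidHom (fun _ : Fin s => k) x).comp (p : A →+ (Fin s → k))) fun a ha => ha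
    have hχ : ∀ a, χ (Submodule.Quotient.mk a) = p a x := fun a => rfl
    let g : (A ⧸ P) →ₗ[ℤ] (H ⧸ Ring.jacobson H) := AddMonoidHom.toIntLinearMap
      ((AddMonoidHom.mk' (fun c : k => c • ι (Pi.single x 1)) fun a b => add_smul a b _).comp χ)
    have hg : ∀ u, g u = χ u • ι (Pi.single x 1) := fun _ => rfl
    -- the homomorphism `h ⊗ u ↦ h u` to the left ideal generated by the idempotent of `x`
    let Φ : H ⊗[ℤ] (A ⧸ P) →ₗ[H] (H ⧸ Ring.jacobson H) :=
      TensorProduct.AlgebraTensorModule.lift (LinearMap.toSpanSingleton H _ g)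
    have hΦ : ∀ h u, Φ (h ⊗ₜ u) = π h * (χ u • ι (Pi.single x 1)) := fun h u => rfl
    have hbal : balancing f.toRingHom (A ⧸ P) ≤ LinearMap.ker Φ := by
      refine Submodule.span_le.2 ?_
      rintro _ ⟨h, a, u, rfl⟩
      obtain ⟨b, rfl⟩ := Submodule.Quotient.mk_surjective _ u
      rw [SetLike.mem_coe, LinearMap.mem_ker, map_sub, hΦ, hΦ, ← Submodule.Quotient.mk_smul, hχ, hχ,
        smul_eq_mul, map_mul, mul_assoc]
      change π h * (π (f a) * _) - _ = 0
      rw [← mul_sub, ← hιp, ← map_smul, ← map_smul, ← map_mul, ← map_sub]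
      convert mul_zero (π h)
      rw [← map_zero ι]
      congr 1
      funext y
      by_cases h : y = x
      · subst h; simp [mul_comm]
      · simp [h]
    let Ψ : Induced f.toRingHom (A ⧸ P) →ₗ[H] (H ⧸ Ring.jacobson H) :=
      (balancing f.toRingHom (A ⧸ P)).liftQ Φ hbal
    let _ : Module A (Induced f.toRingHom (A ⧸ P)) := Module.compHom _ f.toRingHom
    let _ : Module A (H ⧸ Ring.jacobson H) := Module.compHom _ f.toRingHom
    let Ψ' : Induced f.toRingHom (A ⧸ P) →ₗ[A] (H ⧸ Ring.jacobson H) :=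
      { toFun := Ψ
        map_add' := map_add Ψ
        map_smul' := fun a v => map_smul Ψ (f a) v }
    have hlen : Module.length A (LinearMap.range Ψ') ≤ (2 : ℕ) :=
      (Module.length_le_of_surjective Ψ'.rangeRestrict Ψ'.surjective_rangeRestrict).trans
        (hU (A ⧸ P) hs)
    obtain ⟨v, hv⟩ := exists_span_of_length_le p hp hnil 2 _ hlen
    refine ⟨(v 0).1, (v 1).1, fun z => ?_⟩
    obtain ⟨h, rfl⟩ := hπ z
    obtain ⟨a, ha⟩ := hp (Pi.single x 1)
    obtain ⟨c, hc⟩ := hv ⟨Ψ (Induced.tmul _ h (Submodule.Quotient.mk a)), _, rfl⟩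
    refine ⟨c 0, c 1, ?_⟩
    have h1 := congrArg Subtype.val hc
    rw [Fin.sum_univ_two] at h1
    have h2 : ∀ (r : k) (w : LinearMap.range Ψ'), (algebraMap k A r • w).1 = r • w.1 := by
      intro r w
      change π (f (algebraMap k A r)) * w.1 = _
      rw [AlgHom.commutes, AlgHom.commutes, Algebra.smul_def]
    rw [Submodule.coe_add, h2, h2] at h1
    rw [← h1]
    change _ = Φ (h ⊗ₜ _)
    rw [hΦ, hχ, ha, Pi.single_eq_same, one_smul]
  refine ⟨pullback π ι hι, H, _, _, _, _, _, pullbackVal π ι hι, π, ι,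
    isModel_pullback π ι hι hH hπ (fun h hh => isNilpotent_of_mem_jacobson ((hπ0 h).1 hh))
      semiprime_quotient_jacobson htwo, ⟨AlgEquiv.ofBijective
        (f.codRestrict (ι.range.comap π) fun a => ⟨p a, hιp a⟩) ⟨fun a b hab =>
          hf (congrArg Subtype.val hab), ?_⟩⟩⟩
  rintro ⟨h, t, ht⟩
  obtain ⟨a, rfl⟩ := hp t
  obtain ⟨b, hb⟩ := hJ ((hπ0 (h - f a)).1 (by
    rw [map_sub, ← hιp, sub_eq_zero]
    exact ht.symm))
  refine ⟨a + b, Subtype.ext ?_⟩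
  change f (a + b) = h
  rw [map_add, hb, add_sub_cancel]

/-! ### The components of a model that do not generate one-dimensional left ideals -/

/-- Exchange of both generators of a space spanned by two elements. -/
theorem exists_eq_smul_add_smul {k V : Type*} [Field k] [AddCommGroup V] [Module k V] {p q e w : V}
    (he : ∃ a b : k, e = a • p + b • q) (hw : ∃ c d : k, w = c • p + d • q) (he0 : e ≠ 0)
    (hwe : ∀ s : k, w ≠ s • e) {v : V} (hv : ∃ s t : k, v = s • p + t • q) :
    ∃ s t : k, v = s • e + t • w := by
  obtain ⟨a, b, hab⟩ := he
  obtain ⟨c, d, hcd⟩ := hw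
  obtain ⟨s, t, rfl⟩ := hv
  have h1 : d • e - b • w = (a * d - b * c) • p := by rw [hab, hcd]; module
  have h2 : a • w - c • e = (a * d - b * c) • q := by rw [hab, hcd]; module
  by_cases hΔ : a * d - b * c = 0
  · exfalso
    rw [hΔ, zero_smul, sub_eq_zero] at h1 h2
    by_cases ha : a = 0
    · have hb : b ≠ 0 := by
        rintro rfl
        exact he0 (by rw [hab, ha]; simp)
      exact hwe (b⁻¹ * d) (by rw [mul_smul, h1, inv_smul_smul₀ hb])
    · exact hwe (a⁻¹ * c) (by rw [mul_smul, ← h2, inv_smul_smul₀ ha])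
  · set Δ := a * d - b * c
    have h3 : p = Δ⁻¹ • (d • e - b • w) := by rw [h1, inv_smul_smul₀ hΔ]
    have h4 : q = Δ⁻¹ • (a • w - c • e) := by rw [h2, inv_smul_smul₀ hΔ]
    refine ⟨Δ⁻¹ * (s * d - t * c), Δ⁻¹ * (t * a - s * b), ?_⟩
    rw [h3, h4]
    module

/-- Two components such that the corresponding idempotents of `Q` are equivalent, and the left
ideals generated by them are two-dimensional. They arise by blowing up. -/
structure IsDouble {k : Type u} [Field k] {X Q : Type*} [DecidableEq X] [Ring Q] [Algebra k Q]
    (ι : (X → k) →ₐ[k] Q) (x y : X) (p q : Q) : Prop where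
  ne : x ≠ y
  mul_left : p * q = ι (Pi.single x 1)
  mul_right : q * p = ι (Pi.single y 1)
  idem_mul_left : ι (Pi.single x 1) * p = p
  idem_mul_right : ι (Pi.single y 1) * q = q
  span : ∀ z, ∃ s t : k, z * ι (Pi.single x 1) = s • ι (Pi.single x 1) + t • q

/-- An idempotent that splits into two idempotents that generate one-dimensional left ideals. -/
structure IsSplit {k : Type u} [Field k] {X Q : Type*} [DecidableEq X] [Ring Q] [Algebra k Q]
    (ι : (X → k) →ₐ[k] Q) (x : X) (e e' : Q) : Prop where
  add_eq : e + e' = ι (Pi.single x 1)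
  ne_zero : e ≠ 0
  ne_zero' : e' ≠ 0
  idem : e * e = e
  idem' : e' * e' = e'
  ortho : e * e' = 0
  ortho' : e' * e = 0
  line : ∀ z, ∃ s : k, z * e = s • e
  line' : ∀ z, ∃ s : k, z * e' = s • e'

section

variable {k Q : Type u} [Field k] [Ring Q] [Algebra k Q]

/-- A two-dimensional algebra `k e + k w` without nilpotent elements splits. -/
theorem exists_isSplit [IsAlgClosed k] {X : Type*} [DecidableEq X] {ι : (X → k) →ₐ[k] Q}
    (hQ : ∀ z : Q, (∀ w, z * w * z = 0) → z = 0)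
    {x : X} {w : Q} (hw : w * ι (Pi.single x 1) = w) (hw' : ι (Pi.single x 1) * w = w)
    (hwe : ∀ s : k, w ≠ s • ι (Pi.single x 1))
    (hspan : ∀ z, ∃ s t : k, z * ι (Pi.single x 1) = s • ι (Pi.single x 1) + t • w) :
    ∃ e e' : Q, IsSplit ι x e e' := by
  have he := map_single_mul_self ι x
  set e := ι (Pi.single x 1) with hedef
  obtain ⟨s, t, hst⟩ := hspan w
  obtain ⟨s, t, hst⟩ := hspan (w * w)
  rw [mul_assoc, hw] at hst
  obtain ⟨α, hα⟩ : ∃ α : k, α * α - t * α - s = 0 := by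
    obtain ⟨α, hα⟩ := IsAlgClosed.exists_root
      (Polynomial.X ^ 2 - Polynomial.C t * Polynomial.X - Polynomial.C s) (by
        have : (Polynomial.X ^ 2 - Polynomial.C t * Polynomial.X - Polynomial.C s).degree = 2 := by
          compute_degree!
        rw [this]
        exact two_ne_zero)
    refine ⟨α, ?_⟩
    simpa [Polynomial.IsRoot, pow_two] using hα
  set β := t - α with hβ
  have h0 : (w - α • e) * (w - β • e) = 0 := by
    have : s = α * α - t * α := by linear_combination -hα
    rw [sub_mul, mul_sub, mul_sub, hst, mul_smul_comm, smul_mul_assoc, smul_mul_smul_comm, hw, hw',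
      he, hβ, this]
    module
  have h0' : (w - β • e) * (w - α • e) = 0 := by
    rw [← h0, sub_mul, mul_sub, mul_sub, sub_mul, mul_sub, mul_sub]
    simp only [mul_smul_comm, smul_mul_assoc, hw, hw', he]
    module
  have hαβ : α - β ≠ 0 := by
    intro h
    rw [sub_eq_zero] at h
    rw [← h] at h0
    refine hwe α (sub_eq_zero.1 (hQ _ fun z => ?_))
    have h1 : e * (w - α • e) = w - α • e := by rw [mul_sub, hw', mul_smul_comm, he]
    obtain ⟨a, b, hab⟩ := hspan z
    rw [mul_assoc, ← h1, ← mul_assoc z, hab, h1]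
    have h2 : a • e + b • w = (a + b * α) • e + b • (w - α • e) := by module
    rw [h2, add_mul, smul_mul_assoc, h1, smul_mul_assoc, h0, smul_zero, add_zero, mul_smul_comm,
      h0, smul_zero]
  have hadd : (α - β)⁻¹ • (w - β • e) + (α - β)⁻¹ • (α • e - w) = e := by
    rw [← smul_add]
    have : w - β • e + (α • e - w) = (α - β) • e := by module
    rw [this, inv_smul_smul₀ hαβ]
  set e₁ := (α - β)⁻¹ • (w - β • e) with he₁
  set e₂ := (α - β)⁻¹ • (α • e - w) with he₂
  have hneg : α • e - w = -(w - α • e) := by abel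
  have h12 : e₁ * e₂ = 0 := by
    rw [he₁, he₂, smul_mul_smul_comm, hneg, mul_neg, h0', neg_zero, smul_zero]
  have h21 : e₂ * e₁ = 0 := by
    rw [he₁, he₂, smul_mul_smul_comm, hneg, neg_mul, h0, neg_zero, smul_zero]
  have hee₁ : e * e₁ = e₁ := by rw [he₁, mul_smul_comm, mul_sub, mul_smul_comm, hw', he]
  have hee₂ : e * e₂ = e₂ := by rw [he₂, mul_smul_comm, mul_sub, mul_smul_comm, hw', he]
  have h11 : e₁ * e₁ = e₁ := by rw [← hadd, add_mul, h21, add_zero] at hee₁; exact hee₁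
  have h22 : e₂ * e₂ = e₂ := by rw [← hadd, add_mul, h12, zero_add] at hee₂; exact hee₂
  have hw₁ : w * e₁ = α • e₁ := by
    have : w = (w - α • e) + α • e := by abel
    rw [this, add_mul, smul_mul_assoc, hee₁, he₁, mul_smul_comm, h0, smul_zero, zero_add]
  have hw₂ : w * e₂ = β • e₂ := by
    have : w = (w - β • e) + β • e := by abel
    rw [this, add_mul, smul_mul_assoc, hee₂, he₂, mul_smul_comm, hneg, mul_neg, h0', neg_zero,
      smul_zero, zero_add]
  refine ⟨e₁, e₂, hadd, ?_, ?_, h11, h22, h12, h21, fun z => ?_, fun z => ?_⟩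
  · intro h
    rw [he₁, smul_eq_zero_iff_right (inv_ne_zero hαβ), sub_eq_zero] at h
    exact hwe _ h
  · intro h
    rw [he₂, smul_eq_zero_iff_right (inv_ne_zero hαβ), sub_eq_zero] at h
    exact hwe _ h.symm
  · obtain ⟨a, b, hab⟩ := hspan z
    refine ⟨a + b * α, ?_⟩
    rw [← hee₁, ← mul_assoc, hab, add_mul, smul_mul_assoc, smul_mul_assoc, hw₁, hee₁]
    module
  · obtain ⟨a, b, hab⟩ := hspan z
    refine ⟨a + b * β, ?_⟩
    rw [← hee₂, ← mul_assoc, hab, add_mul, smul_mul_assoc, smul_mul_assoc, hw₂, hee₂]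
    module

/-- A component that does not generate a one-dimensional left ideal arises by gluing or by blowing
up. Let `e` be its idempotent. If `e Q e` is larger than `k e`, then `Q e = e Q e` is a
two-dimensional algebra without nilpotent elements, so `e` splits. Otherwise `f Q e ≠ 0` for the
idempotent `f` of another component, and by semisimplicity `e` and `f` are equivalent. -/
theorem exists_isSplit_or_isDouble [IsAlgClosed k] {X : Type*} [Fintype X] [DecidableEq X]
    {ι : (X → k) →ₐ[k] Q} (hι : ∀ x, ι (Pi.single x 1) ≠ 0)
    (hQ : ∀ z : Q, (∀ w, z * w * z = 0) → z = 0)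
    (htwo : ∀ x, ∃ p q : Q, ∀ z, ∃ s t : k, z * ι (Pi.single x 1) = s • p + t • q)
    {x : X} (hx : ¬ IsLine ι x) :
    (∃ e e', IsSplit ι x e e') ∨ ∃ y p q, IsDouble ι x y p q := by
  have hspan : ∀ x (w : Q), w * ι (Pi.single x 1) = w → (∀ s : k, w ≠ s • ι (Pi.single x 1)) →
      ∀ z, ∃ s t : k, z * ι (Pi.single x 1) = s • ι (Pi.single x 1) + t • w := by
    intro x w hw hwe z
    obtain ⟨p, q, hpq⟩ := htwo x
    have h1 := hpq 1
    have h2 := hpq w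
    rw [one_mul] at h1
    rw [hw] at h2
    exact exists_eq_smul_add_smul (k := k) h1 h2 (hι x) hwe (hpq z)
  have hidem := map_single_mul_self ι
  have hortho : ∀ {y z : X}, y ≠ z → ι (Pi.single y 1) * ι (Pi.single z 1) = 0 :=
    fun h => (complete_map_single ι).ortho h
  have he := hidem x
  by_cases hcorner : ∀ z, ∃ s : k, ι (Pi.single x 1) * z * ι (Pi.single x 1) =
      s • ι (Pi.single x 1)
  · right
    unfold IsLine at hx
    push Not at hx
    obtain ⟨z₀, hz₀⟩ := hx
    obtain ⟨y, hyx, hq0⟩ : ∃ y, y ≠ x ∧ ι (Pi.single y 1) * z₀ * ι (Pi.single x 1) ≠ 0 := by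
      by_contra! h
      obtain ⟨s, hs⟩ := hcorner z₀
      apply hz₀ s
      rw [← one_mul (z₀ * _), ← (complete_map_single ι).complete, Finset.sum_mul,
        Finset.sum_eq_single x]
      · rw [← mul_assoc, hs]
      · intro y _ hy
        rw [← mul_assoc, h y hy]
      · simp
    set q := ι (Pi.single y 1) * z₀ * ι (Pi.single x 1) with hq
    have hqx : q * ι (Pi.single x 1) = q := by rw [hq, mul_assoc, he]
    have hyq : ι (Pi.single y 1) * q = q := by rw [hq, ← mul_assoc, ← mul_assoc, hidem]
    have hxq : ι (Pi.single x 1) * q = 0 := by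
      rw [hq, ← mul_assoc, ← mul_assoc, hortho hyx.symm, zero_mul, zero_mul]
    have hqe : ∀ s : k, q ≠ s • ι (Pi.single x 1) := by
      intro s hs
      rw [hs, mul_smul_comm, he, ← hs] at hxq
      exact hq0 hxq
    obtain ⟨z, hz⟩ : ∃ z, q * z * q ≠ 0 := by
      by_contra! h
      exact hq0 (hQ q h)
    obtain ⟨c, hc⟩ := hcorner (z * q)
    rw [mul_assoc, mul_assoc, hqx] at hc
    have hc0 : c ≠ 0 := by
      rintro rfl
      rw [zero_smul] at hc
      apply hz
      have h1 : q * z * q = q * (ι (Pi.single x 1) * (z * q)) := by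
        rw [← mul_assoc q (ι _), hqx, mul_assoc]
      rw [h1, hc, mul_zero]
    set p := c⁻¹ • (ι (Pi.single x 1) * z * ι (Pi.single y 1)) with hp
    have hpq : p * q = ι (Pi.single x 1) := by
      rw [hp, smul_mul_assoc, mul_assoc, hyq, mul_assoc, hc, inv_smul_smul₀ hc0]
    have hxp : ι (Pi.single x 1) * p = p := by
      rw [hp, mul_smul_comm, ← mul_assoc, ← mul_assoc, he]
    have hpy : p * ι (Pi.single y 1) = p := by
      rw [hp, smul_mul_assoc, mul_assoc, hidem]
    have hyp : ι (Pi.single y 1) * p = 0 := by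
      rw [← hxp, ← mul_assoc, hortho hyx, zero_mul]
    have hp0 : p ≠ 0 := by
      rintro h
      rw [h, zero_mul] at hpq
      exact hι x hpq.symm
    have hpqp : p * (q * p) = p := by rw [← mul_assoc, hpq, hxp]
    have hqp0 : q * p ≠ 0 := fun h => hp0 (by rw [← hpqp, h, mul_zero])
    -- the elements `p` and `q p` span the left ideal of `y`
    have hspan' : ∃ s t : k, ι (Pi.single y 1) = s • p + t • (q * p) := by
      obtain ⟨p', q', hpq'⟩ := htwo y
      have h1 := hpq' p
      have h2 := hpq' (q * p)
      have h3 := hpq' 1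
      rw [hpy] at h1
      rw [mul_assoc, hpy] at h2
      rw [one_mul] at h3
      refine exists_eq_smul_add_smul (k := k) h1 h2 hp0 (fun s hs => hqp0 ?_) h3
      rw [← hyq, mul_assoc, hs, mul_smul_comm, hyp, smul_zero]
    obtain ⟨s, t, hst⟩ := hspan'
    -- multiplication by the idempotent of `x` and by `p` determines the coefficients
    have hs : s = 0 := by
      have h1 := congrArg (ι (Pi.single x 1) * ·) hst
      simp only [mul_add, mul_smul_comm, hxp, ← mul_assoc, hxq, zero_mul, smul_zero, add_zero,
        hortho hyx.symm] at h1
      exact (smul_eq_zero.1 h1.symm).resolve_right hp0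
    rw [hs, zero_smul, zero_add] at hst
    have ht : t = 1 := by
      have h1 := congrArg (p * ·) hst
      simp only [mul_smul_comm, hpqp, hpy] at h1
      by_contra h
      have h2 : (t - 1) • p = 0 := by rw [sub_smul, one_smul, ← h1, sub_self]
      exact (smul_eq_zero.1 h2).elim (fun h3 => h (sub_eq_zero.1 h3)) hp0
    rw [ht, one_smul] at hst
    exact ⟨y, p, q, hyx.symm, hpq, hst.symm, hxp, hyq, hspan x q hqx hqe⟩
  · left
    push Not at hcorner
    obtain ⟨z, hz⟩ := hcorner
    have hw : ι (Pi.single x 1) * z * ι (Pi.single x 1) * ι (Pi.single x 1) =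
        ι (Pi.single x 1) * z * ι (Pi.single x 1) := by rw [mul_assoc, he]
    exact exists_isSplit hQ hw (by rw [← mul_assoc, ← mul_assoc, he]) hz (hspan x _ hw hz)

end

/-! ### Homomorphisms from a product of fields -/

section IdemAlg

variable {k : Type*} [Field k] {Y Q : Type*} [Fintype Y] [Ring Q] [Algebra k Q] {e : Y → Q}

/-- The homomorphism from a product of copies of `k` defined by a complete family of orthogonal
idempotents. -/
def idemAlg (he : CompleteOrthogonalIdempotents e) : (Y → k) →ₐ[k] Q :=
  AlgHom.ofLinearMap (Fintype.linearCombination k e)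
    (by simp [Fintype.linearCombination_apply, he.complete])
    (fun s t => by
      simp only [Fintype.linearCombination_apply, Finset.sum_mul, Finset.mul_sum,
        smul_mul_smul_comm]
      refine Finset.sum_congr rfl fun x _ => ?_
      rw [Finset.sum_eq_single x]
      · rw [(he.idem x).eq]; rfl
      · intro y _ hy
        rw [he.ortho hy, smul_zero]
      · simp)

theorem idemAlg_apply (he : CompleteOrthogonalIdempotents e) (t : Y → k) :
    idemAlg he t = ∑ y, t y • e y := rfl

theorem idemAlg_injective (he : CompleteOrthogonalIdempotents e) (h0 : ∀ y, e y ≠ 0) :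
    Function.Injective (idemAlg (k := k) he) := by
  rw [injective_iff_map_eq_zero]
  intro t ht
  funext y
  have h1 : e y * idemAlg he t = t y • e y := by
    rw [idemAlg_apply, Finset.mul_sum, Finset.sum_eq_single y]
    · rw [mul_smul_comm, (he.idem y).eq]
    · intro z _ hz
      rw [mul_smul_comm, he.ortho hz.symm, smul_zero]
    · simp
  rw [ht, mul_zero] at h1
  exact (smul_eq_zero.1 h1.symm).resolve_right (h0 y)

variable [DecidableEq Y]

theorem idemAlg_single (he : CompleteOrthogonalIdempotents e) (y : Y) :
    idemAlg he (Pi.single y (1 : k)) = e y := by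
  rw [idemAlg_apply, Finset.sum_eq_single y]
  · simp
  · intro z _ hz
    simp [hz]
  · simp

end IdemAlg

/-! ### Reversing a gluing -/

/-- `D` is isomorphic to an algebra obtained from the path algebra of `Γ` by a suitable sequence
of gluings and blowings up, and the components that satisfy `P` come from components of the
path algebra that are not involved. -/
def IsRebuilt {k : Type u} [Field k] (D : MarkedAlgebra k) (P : D.comp → Prop) (Γ : FinQuiver)
    (gl : List (Γ.vert × Γ.vert)) (bl : List Γ.vert) : Prop :=
  ∃ (C : MarkedAlgebra k) (old : Γ.vert → Option C.comp),
    MarkedAlgebra.SuitableStep (pathMarked k Γ) gl bl C old ∧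
      ∃ σ : MarkedIso D C, ∀ x, P x → ∃ b, old b = some (σ.comp x)

/-- Recognition of the result of gluing. -/
def markedIsoGlue {k : Type u} [Field k] {D C : MarkedAlgebra k} (j : D.alg →ₐ[k] C.alg)
    (hj : Function.Injective j) {a b : C.comp} (hab : ∀ d, C.proj (j d) a = C.proj (j d) b)
    (hrange : ∀ c, C.proj c a = C.proj c b → ∃ d, j d = c)
    (τ : D.comp ≃ Option {c : C.comp // c ≠ a ∧ c ≠ b})
    (hτ : ∀ d x, C.proj (j d) ((τ x).elim a Subtype.val) = D.proj d x) :
    MarkedIso D (C.glue a b) where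
  equiv := AlgEquiv.ofBijective
    (j.codRestrict ((MarkedAlgebra.equalSubalgebra k a b).comap C.proj)
      fun d => (AlgHom.mem_equalizer _ _ _).2 (hab d))
    ⟨fun d d' h => hj (congrArg Subtype.val h), fun c => by
      obtain ⟨d, hd⟩ := hrange c.1 ((AlgHom.mem_equalizer _ _ _).1 c.2)
      exact ⟨d, Subtype.ext hd⟩⟩
  comp := τ
  proj_equiv d x := hτ d x

/-- If the element `x` of `X` is doubled and both copies are identified again, the result is `X`. -/
def splitEquiv {X Z : Type} [DecidableEq X] (x : X) (σ : Option X ≃ Z) :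
    X ≃ Option {c : Z // c ≠ σ none ∧ c ≠ σ (some x)} where
  toFun y := if h : y = x then none else some ⟨σ (some y), by simp, by simp [h]⟩
  invFun o := o.elim x fun c => (σ.symm c.1).getD x
  left_inv y := by
    by_cases h : y = x <;> simp [h]
  right_inv o := by
    rcases o with _ | ⟨c, hc⟩
    · simp
    · obtain ⟨y, rfl⟩ := σ.surjective c
      rcases y with _ | y
      · exact absurd rfl hc.1
      · have : y ≠ x := fun h => hc.2 (by rw [h])
        simp [this]

theorem splitEquiv_self {X Z : Type} [DecidableEq X] (x : X) (σ : Option X ≃ Z) :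
    splitEquiv x σ x = none := dif_pos rfl

theorem splitEquiv_of_ne {X Z : Type} [DecidableEq X] {x y : X} (h : y ≠ x) (σ : Option X ≃ Z) :
    ∃ h', splitEquiv x σ y = some ⟨σ (some y), h'⟩ := ⟨_, dif_neg h⟩

section SplitFamily

variable {k : Type u} [Field k] {X : Type} {Q : Type u} [DecidableEq X] [Ring Q] [Algebra k Q]

/-- The family of idempotents in which the idempotent of `x` is replaced by `e` and `e'`. -/
def splitFamily (ι : (X → k) →ₐ[k] Q) (x : X) (e e' : Q) (o : Option X) : Q :=
  o.elim e fun y => if y = x then e' else ι (Pi.single y 1)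

variable {ι : (X → k) →ₐ[k] Q} {x : X} {e e' : Q}

theorem splitFamily_some_self : splitFamily ι x e e' (some x) = e' := if_pos rfl

theorem splitFamily_some_of_ne {y : X} (h : y ≠ x) :
    splitFamily ι x e e' (some y) = ι (Pi.single y 1) := if_neg h

theorem IsSplit.splitFamily_some (hs : IsSplit ι x e e') (y : X) :
    splitFamily ι x e e' (some y) = ι (Pi.single y 1) - if y = x then e else 0 := by
  by_cases h : y = x
  · subst h
    rw [splitFamily_some_self, if_pos rfl, ← hs.add_eq, add_sub_cancel_left]
  · rw [splitFamily_some_of_ne h, if_neg h, sub_zero]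

theorem IsSplit.idem_mul (hs : IsSplit ι x e e') : ι (Pi.single x 1) * e = e := by
  rw [← hs.add_eq, add_mul, hs.idem, hs.ortho', add_zero]

theorem IsSplit.mul_idem (hs : IsSplit ι x e e') : e * ι (Pi.single x 1) = e := by
  rw [← hs.add_eq, mul_add, hs.idem, hs.ortho, add_zero]

theorem IsSplit.idem_mul' (hs : IsSplit ι x e e') : ι (Pi.single x 1) * e' = e' := by
  rw [← hs.add_eq, add_mul, hs.idem', hs.ortho, zero_add]

theorem IsSplit.mul_idem' (hs : IsSplit ι x e e') : e' * ι (Pi.single x 1) = e' := by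
  rw [← hs.add_eq, mul_add, hs.idem', hs.ortho', zero_add]

theorem IsSplit.complete [Fintype X] (hs : IsSplit ι x e e') :
    CompleteOrthogonalIdempotents (splitFamily ι x e e') := by
  have h0 : ∀ {y z : X}, y ≠ z → ι (Pi.single y 1) * ι (Pi.single z 1) = 0 :=
    fun h => (complete_map_single ι).ortho h
  have h1 : ∀ {y}, y ≠ x → e * ι (Pi.single y 1) = 0 := fun h => by
    rw [← hs.mul_idem, mul_assoc, h0 h.symm, mul_zero]
  have h2 : ∀ {y}, y ≠ x → ι (Pi.single y 1) * e = 0 := fun h => by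
    rw [← hs.idem_mul, ← mul_assoc, h0 h, zero_mul]
  have h1' : ∀ {y}, y ≠ x → e' * ι (Pi.single y 1) = 0 := fun h => by
    rw [← hs.mul_idem', mul_assoc, h0 h.symm, mul_zero]
  have h2' : ∀ {y}, y ≠ x → ι (Pi.single y 1) * e' = 0 := fun h => by
    rw [← hs.idem_mul', ← mul_assoc, h0 h, zero_mul]
  refine ⟨⟨?_, ?_⟩, ?_⟩
  · rintro (_ | y)
    · exact hs.idem
    · by_cases h : y = x
      · subst h
        rw [splitFamily_some_self]
        exact hs.idem'
      · rw [splitFamily_some_of_ne h]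
        exact map_single_mul_self ι y
  · rintro (_ | y) (_ | z) hyz
    · exact absurd rfl hyz
    · by_cases h : z = x
      · subst h
        exact (congrArg _ splitFamily_some_self).trans hs.ortho
      · exact (congrArg _ (splitFamily_some_of_ne h)).trans (h1 h)
    · by_cases h : y = x
      · subst h
        exact (congrArg (· * e) splitFamily_some_self).trans hs.ortho'
      · exact (congrArg (· * e) (splitFamily_some_of_ne h)).trans (h2 h)
    · have hyz' : y ≠ z := fun h => hyz (congrArg _ h)
      change splitFamily ι x e e' (some y) * splitFamily ι x e e' (some z) = 0
      by_cases hy : y = x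
      · subst hy
        rw [splitFamily_some_self, splitFamily_some_of_ne hyz'.symm, h1' hyz'.symm]
      · rw [splitFamily_some_of_ne hy]
        by_cases hz : z = x
        · subst hz
          rw [splitFamily_some_self, h2' hy]
        · rw [splitFamily_some_of_ne hz, h0 hyz']
  · rw [Fintype.sum_option]
    simp only [hs.splitFamily_some]
    rw [Finset.sum_sub_distrib, (complete_map_single ι).complete, Finset.sum_ite_eq' Finset.univ x,
      if_pos (Finset.mem_univ x)]
    exact add_sub_cancel _ _

theorem IsSplit.ne_zero_splitFamily (hs : IsSplit ι x e e') (h0 : ∀ y, ι (Pi.single y 1) ≠ 0)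
    (o : Option X) : splitFamily ι x e e' o ≠ 0 := by
  rcases o with _ | y
  · exact hs.ne_zero
  · by_cases h : y = x
    · subst h
      rw [splitFamily_some_self]
      exact hs.ne_zero'
    · rw [splitFamily_some_of_ne h]
      exact h0 y

/-- The homomorphism from a product of fields defined by the new family of idempotents. -/
def splitAlg [Fintype X] (hs : IsSplit ι x e e') : (Option X → k) →ₐ[k] Q := idemAlg hs.complete

theorem splitAlg_none [Fintype X] (hs : IsSplit ι x e e') :
    splitAlg hs (Pi.single none 1) = e := idemAlg_single hs.complete none

theorem splitAlg_some_self [Fintype X] (hs : IsSplit ι x e e') :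
    splitAlg hs (Pi.single (some x) 1) = e' :=
  (idemAlg_single hs.complete (some x)).trans splitFamily_some_self

theorem splitAlg_some_of_ne [Fintype X] (hs : IsSplit ι x e e') {y : X} (h : y ≠ x) :
    splitAlg hs (Pi.single (some y) 1) = ι (Pi.single y 1) :=
  (idemAlg_single hs.complete (some y)).trans (splitFamily_some_of_ne h)

theorem splitAlg_elim [Fintype X] (hs : IsSplit ι x e e') (t : X → k) :
    splitAlg hs (fun o => t (o.elim x id)) = ι t := by
  rw [splitAlg, idemAlg_apply, Fintype.sum_option, map_eq_sum ι t]
  simp only [hs.splitFamily_some, Option.elim, id, smul_sub, smul_ite, smul_zero]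
  rw [Finset.sum_sub_distrib, Finset.sum_ite_eq' Finset.univ x, if_pos (Finset.mem_univ x)]
  exact add_sub_cancel _ _

theorem isLine_splitAlg_none [Fintype X] (hs : IsSplit ι x e e') : IsLine (splitAlg hs) none := by
  intro z
  rw [splitAlg_none]
  exact hs.line z

theorem isLine_splitAlg_some_self [Fintype X] (hs : IsSplit ι x e e') :
    IsLine (splitAlg hs) (some x) := by
  intro z
  rw [splitAlg_some_self]
  exact hs.line' z

theorem isLine_splitAlg_iff [Fintype X] (hs : IsSplit ι x e e') {y : X} (h : y ≠ x) :
    IsLine (splitAlg hs) (some y) ↔ IsLine ι y := by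
  unfold IsLine
  rw [splitAlg_some_of_ne hs h]

end SplitFamily

variable {k : Type u} [Field k] {D : MarkedAlgebra k} {H Q : Type u} [Ring H] [Algebra k H]
  [Ring Q] [Algebra k Q] {f : D.alg →ₐ[k] H} {π : H →ₐ[k] Q} {ι : (D.comp → k) →ₐ[k] Q}

theorem IsModel.splitAlg_injective (hM : IsModel D f π ι) {x : D.comp} {e e' : Q}
    (hs : IsSplit ι x e e') : Function.Injective (splitAlg hs) :=
  idemAlg_injective hs.complete (hs.ne_zero_splitFamily hM.map_idem_ne_zero)

/-- If the idempotent of `x` splits, the preimage in `H` of the larger product of fields has a model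
with the same overring. -/
theorem IsModel.split (hM : IsModel D f π ι) {x : D.comp} {e e' : Q} (hs : IsSplit ι x e e') :
    IsModel (pullback π (splitAlg hs) (hM.splitAlg_injective hs)) (pullbackVal π _ _) π
      (splitAlg hs) := by
  have := hM.finite
  refine isModel_pullback π _ _ hM.hereditary hM.surjective hM.nil hM.semiprime ?_
  rintro (_ | y)
  · refine ⟨e, 0, fun z => ?_⟩
    obtain ⟨s, h⟩ := hs.line z
    exact ⟨s, 0, by rw [splitAlg_none, h, smul_zero, add_zero]⟩
  · by_cases h : y = x
    · subst h
      refine ⟨e', 0, fun z => ?_⟩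
      obtain ⟨s, h⟩ := hs.line' z
      exact ⟨s, 0, by rw [splitAlg_some_self, h, smul_zero, add_zero]⟩
    · rw [splitAlg_some_of_ne hs h]
      exact hM.two y

/-- If the idempotent of `x` splits, then `D` is obtained by gluing the two components into which
`x` is divided. They generate one-dimensional left ideals, hence have not been involved before. -/
theorem IsModel.isRebuilt_of_split (hM : IsModel D f π ι) {x : D.comp} {e e' : Q}
    (hs : IsSplit ι x e e') {Γ : FinQuiver} {gl : List (Γ.vert × Γ.vert)}
    (h : IsRebuilt (pullback π (splitAlg hs) (hM.splitAlg_injective hs)) (IsLine (splitAlg hs))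
      Γ gl []) :
    ∃ i j, IsRebuilt D (IsLine ι) Γ ((i, j) :: gl) [] := by
  obtain ⟨C, old, hC, σ, hσ⟩ := h
  let σ' : Option D.comp ≃ C.comp := σ.comp
  obtain ⟨i, hi⟩ := hσ none (isLine_splitAlg_none hs)
  obtain ⟨j, hj⟩ := hσ (some x) (isLine_splitAlg_some_self hs)
  have hij : i ≠ j := by
    rintro rfl
    have h1 : σ' none = σ' (some x) := Option.some.inj (hi.symm.trans hj)
    exact absurd (σ'.injective h1) (by simp)
  -- the embedding of `D` into the algebra in which `x` is replaced by two components
  let F : D.alg →ₐ[k] (pullback π (splitAlg hs) (hM.splitAlg_injective hs)).alg :=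
    f.codRestrict ((splitAlg hs).range.comap π) fun d => ⟨fun o => D.proj d (o.elim x id), by
      change splitAlg hs _ = π (f d)
      rw [splitAlg_elim, hM.comm]⟩
  have hF : ∀ d o, (pullback π (splitAlg hs) (hM.splitAlg_injective hs)).proj (F d) o =
      D.proj d (Option.elim o x id) := by
    intro d o
    have h1 := map_pullback_proj π (splitAlg hs) (hM.splitAlg_injective hs) (F d)
    have h2 : splitAlg hs (fun o => D.proj d (o.elim x id)) = π (f d) := by
      rw [splitAlg_elim, hM.comm]
    exact congrFun (hM.splitAlg_injective hs (h1.trans h2.symm)) o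
  have hG : ∀ d o, C.proj (σ.equiv (F d)) (σ' o) = D.proj d (Option.elim o x id) := fun d o =>
    (σ.proj_equiv (F d) o).trans (hF d o)
  refine ⟨i, j, C.glue (σ' none) (σ' (some x)), _, .glue hC hij hi hj,
    markedIsoGlue (σ.equiv.toAlgHom.comp F) ?_ ?_ ?_ (splitEquiv x σ') ?_, ?_⟩
  · exact σ.equiv.injective.comp fun d d' h => hM.injective (congrArg Subtype.val h)
  · exact fun d => (hG d none).trans (hG d (some x)).symm
  · intro c hc
    obtain ⟨d', rfl⟩ := σ.equiv.surjective c
    have h1 : (pullback π (splitAlg hs) (hM.splitAlg_injective hs)).proj d' none =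
        (pullback π (splitAlg hs) (hM.splitAlg_injective hs)).proj d' (some x) :=
      (σ.proj_equiv d' none).symm.trans (hc.trans (σ.proj_equiv d' (some x)))
    set t : Option D.comp → k :=
      (pullback π (splitAlg hs) (hM.splitAlg_injective hs)).proj d' with ht
    have h2 : t = fun o => (fun y => t (some y)) (o.elim x id) := by
      funext o
      rcases o with _ | y
      · exact h1
      · rfl
    have h3 : splitAlg hs t = π d'.1 := map_pullback_proj π _ (hM.splitAlg_injective hs) d'
    have h4 : splitAlg hs t = ι fun y => t (some y) := by
      conv_lhs => rw [h2]
      exact splitAlg_elim hs fun y => t (some y)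
    obtain ⟨d, hd⟩ := hM.exists_eq _ _ (h3.symm.trans h4)
    exact ⟨d, congrArg σ.equiv (Subtype.ext hd)⟩
  · intro d y
    refine Eq.trans ?_ (hG d (some y))
    by_cases h : y = x
    · subst h
      rw [splitEquiv_self]
      exact (hG d none).trans (hG d (some y)).symm
    · obtain ⟨_, h'⟩ := splitEquiv_of_ne h σ'
      rw [h']
      rfl
  · intro y hy
    have h : y ≠ x := by
      rintro rfl
      obtain ⟨s, h1⟩ := hy e
      rw [hs.mul_idem] at h1
      have h2 : e' * e = s • e' := by
        conv_lhs => rw [h1]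
        rw [mul_smul_comm, hs.mul_idem']
      rw [hs.ortho'] at h2
      have hs0 := (smul_eq_zero.1 h2.symm).resolve_right hs.ne_zero'
      rw [hs0, zero_smul] at h1
      exact hs.ne_zero h1
    obtain ⟨b, hb⟩ := hσ (some y) ((isLine_splitAlg_iff hs h).2 hy)
    obtain ⟨h', h2⟩ := splitEquiv_of_ne h σ'
    refine ⟨b, ?_⟩
    change (old b).bind _ = some (splitEquiv x σ' y)
    rw [hb, h2]
    exact dif_pos h'

/-! ### Recognition of a blowing up -/

section Recognition

variable {k : Type u} [Field k] {D C : MarkedAlgebra k} {H : Type u} [Ring H] [Algebra k H]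

/-- An algebra `D ⊆ H` is the blowing up of the component `a` of an algebra `C` (embedded into `H`,
perhaps with another unit) if the components of `D` are indexed by `BlowIndex a` and the
corresponding idempotents `R x * P x` are equivalent to the idempotents `P x * R x` that belong
to the summands of the module that defines the blowing up: the elements of `D` are turned into
matrices with the entries `P x * d * R y`. -/
theorem exists_markedIso_blowUp {ε' : C.comp → C.alg} (hε' : C.IsDecomposition ε') (a : C.comp)
    (f : D.alg →ₐ[k] H) (hf : Function.Injective f) (g : C.alg →ₗ[k] H)
    (hg : Function.Injective g) (hgmul : ∀ c c', g (c * c') = g c * g c')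
    (τ : BlowIndex a ≃ D.comp) {F : D.comp → H} (hF : CompleteOrthogonalIdempotents F)
    (P R : BlowIndex a → H) (hPR : ∀ x, P x * R x = g (ε' x.under))
    (hRP : ∀ x, R x * P x = F (τ x)) (hP : ∀ x, P x * F (τ x) = P x)
    (hR : ∀ x, F (τ x) * R x = R x)
    (hex : ∀ d, ∃ φ : C.blowSubalgebra ε' hε' a,
      ∀ x y, g (C.blowEntry ε' a φ.1 x y) = P x * f d * R y)
    (hproj : ∀ d c x, g c = P x * f d * R x → C.proj c x.under = D.proj d (τ x))
    (hsurj : ∀ φ : C.blowSubalgebra ε' hε' a, ∃ d, f d =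
      ∑ x, ∑ y, R x * g (C.blowEntry ε' a φ.1 x y) * P y) :
    ∃ σ : MarkedIso D (C.blowUp ε' hε' a), ∀ x, σ.comp x = τ.symm x := by
  choose Φ hΦ using hex
  have hext : ∀ φ ψ : C.blowSubalgebra ε' hε' a,
      (∀ x y, g (C.blowEntry ε' a φ.1 x y) = g (C.blowEntry ε' a ψ.1 x y)) → φ = ψ :=
    fun φ ψ h => Subtype.ext (MarkedAlgebra.blowEnd_ext hε' fun x y => hg (h x y))
  have hPR0 : ∀ x y, x ≠ y → P x * R y = 0 := by
    intro x y hxy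
    rw [← hP, ← hR, mul_assoc, ← mul_assoc (F _), hF.ortho (fun h => hxy (τ.injective h)),
      zero_mul, mul_zero]
  have hsum : ∑ x, R x * P x = 1 := by
    simp only [hRP]
    rw [Equiv.sum_comp τ F, hF.complete]
  let Ψ : D.alg →ₐ[k] C.blowSubalgebra ε' hε' a := AlgHom.ofLinearMap
    { toFun := Φ
      map_add' := fun d d' => hext _ _ fun x y => by
        change _ = g (C.blowEntry ε' a (Φ d).1 x y + C.blowEntry ε' a (Φ d').1 x y)
        rw [map_add, hΦ, hΦ, hΦ, map_add, mul_add, add_mul]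
      map_smul' := fun r d => hext _ _ fun x y => by
        change _ = g (r • C.blowEntry ε' a (Φ d).1 x y)
        rw [map_smul, hΦ, hΦ, map_smul, mul_smul_comm, smul_mul_assoc] }
    (hext _ _ fun x y => by
      change g (C.blowEntry ε' a (Φ 1).1 x y) = g (C.blowEntry ε' a 1 x y)
      rw [hΦ, MarkedAlgebra.blowEntry_one, map_one, mul_one]
      split_ifs with h
      · subst h
        exact hPR x
      · rw [hPR0 x y h, map_zero])
    (fun d d' => hext _ _ fun x y => by
      change g (C.blowEntry ε' a (Φ (d * d')).1 x y) =
        g (C.blowEntry ε' a ((Φ d).1 * (Φ d').1) x y)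
      rw [hΦ, MarkedAlgebra.blowEntry_mul hε', map_sum]
      simp only [hgmul, hΦ]
      calc P x * f (d * d') * R y = P x * (f d * (∑ z, R z * P z) * f d') * R y := by
            rw [hsum, mul_one, map_mul]
        _ = _ := by
          rw [Finset.mul_sum, Finset.sum_mul, Finset.mul_sum, Finset.sum_mul]
          simp only [mul_assoc])
  have hΨ : Function.Bijective Ψ := by
    constructor
    · intro d d' h
      apply hf
      have h1 : ∀ x y, P x * f d * R y = P x * f d' * R y := by
        intro x y
        rw [← hΦ, ← hΦ]
        exact congrArg (fun φ : C.blowSubalgebra ε' hε' a => g (C.blowEntry ε' a φ.1 x y)) h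
      have h2 : ∀ h : H, h = ∑ x, ∑ y, R x * (P x * h * R y) * P y := by
        intro h
        conv_lhs => rw [← one_mul h, ← mul_one (1 * h), ← hsum]
        rw [Finset.sum_mul, Finset.sum_mul]
        refine Finset.sum_congr rfl fun x _ => ?_
        rw [Finset.mul_sum]
        simp only [mul_assoc]
      rw [h2 (f d), h2 (f d')]
      simp only [h1]
    · intro φ
      obtain ⟨d, hd⟩ := hsurj φ
      refine ⟨d, hext _ _ fun x y => ?_⟩
      change g (C.blowEntry ε' a (Φ d).1 x y) = _
      rw [hΦ, hd, Finset.mul_sum, Finset.sum_mul, Finset.sum_eq_single x, Finset.mul_sum,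
        Finset.sum_mul, Finset.sum_eq_single y]
      · rw [← mul_assoc, ← mul_assoc, hPR, mul_assoc _ (P y), hPR, ← hgmul, ← hgmul,
          MarkedAlgebra.mul_blowEntry hε', MarkedAlgebra.blowEntry_mul_idem hε']
      · intro z _ hz
        rw [mul_assoc, mul_assoc _ (P z), hPR0 z y hz, mul_zero, mul_zero]
      · simp
      · intro z _ hz
        rw [Finset.mul_sum, Finset.sum_mul]
        refine Finset.sum_eq_zero fun w _ => ?_
        rw [← mul_assoc, ← mul_assoc, hPR0 x z hz.symm, zero_mul, zero_mul, zero_mul]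
      · simp
  have hΦproj : ∀ d x, C.blowProj ε' hε' a (Φ d) x = D.proj d (τ x) := fun d x =>
    (MarkedAlgebra.blowProj_apply hε' (Φ d) x).trans (hproj d _ x (hΦ d x x))
  exact ⟨⟨AlgEquiv.ofBijective Ψ hΨ, τ.symm, fun d y =>
    (hΦproj d (τ.symm y)).trans (by rw [τ.apply_symm_apply])⟩, fun x => rfl⟩

end Recognition

/-! ### Lifting of equivalent idempotents -/

/-- Elements that realize an equivalence of idempotents can be lifted modulo a nil ideal. -/
theorem exists_lift_equivalence {R S : Type*} [Ring R] [Ring S] (π : R →+* S)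
    (hπ : Function.Surjective π) (hnil : ∀ r, π r = 0 → IsNilpotent r) {e e' : R}
    (he : e * e = e) (he' : e' * e' = e') {p q : S} (hpq : p * q = π e) (hqp : q * p = π e')
    (hp : π e * p = p) (hq : π e' * q = q) :
    ∃ P Q : R, π P = p ∧ π Q = q ∧ P * Q = e ∧ Q * P = e' ∧ e * P = P ∧ P * e' = P ∧
      e' * Q = Q ∧ Q * e = Q := by
  have hp' : p * π e' = p := by rw [← hqp, ← mul_assoc, hpq, hp]
  have hq' : q * π e = q := by rw [← hpq, ← mul_assoc, hqp, hq]
  obtain ⟨p₀, rfl⟩ := hπ p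
  obtain ⟨q₀, rfl⟩ := hπ q
  set P := e * p₀ * e' with hP
  set Q₀ := e' * q₀ * e with hQ₀
  have hπP : π P = π p₀ := by rw [hP, map_mul, map_mul, hp, hp']
  have hπQ₀ : π Q₀ = π q₀ := by rw [hQ₀, map_mul, map_mul, hq, hq']
  have heP : e * P = P := by rw [hP, ← mul_assoc, ← mul_assoc, he]
  have hPe : P * e' = P := by rw [hP, mul_assoc, he']
  have heQ₀ : e' * Q₀ = Q₀ := by rw [hQ₀, ← mul_assoc, ← mul_assoc, he']
  have hπn : π (e - P * Q₀) = 0 := by rw [map_sub, map_mul, hπP, hπQ₀, hpq, sub_self]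
  obtain ⟨s, hs⟩ := (hnil _ hπn).isUnit_one_sub.exists_right_inv
  have hπs : π s = 1 := by
    have := congrArg π hs
    rwa [map_mul, map_sub, hπn, sub_zero, map_one, one_mul] at this
  have hPQs : P * Q₀ * s = e := by
    have h1 : e * (1 - (e - P * Q₀)) = P * Q₀ := by
      rw [mul_sub, mul_sub, ← mul_assoc, heP, he, mul_one]
      abel
    rw [← h1, mul_assoc, hs, mul_one]
  set Q := Q₀ * s * e with hQ
  have hPQ : P * Q = e := by rw [hQ, ← mul_assoc, ← mul_assoc, hPQs, he]
  have heQ : e' * Q = Q := by rw [hQ, ← mul_assoc, ← mul_assoc, heQ₀]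
  have hQe : Q * e = Q := by rw [hQ, mul_assoc, he]
  have hπQ : π Q = π q₀ := by rw [hQ, map_mul, map_mul, hπs, mul_one, hπQ₀, hq']
  refine ⟨P, Q, hπP, hπQ, hPQ, ?_, heP, hPe, heQ, hQe⟩
  have hQP : Q * P * (Q * P) = Q * P := by rw [mul_assoc, ← mul_assoc P, hPQ, heP]
  have h1 : (e' - Q * P) * (e' - Q * P) = e' - Q * P := by
    rw [sub_mul, mul_sub, mul_sub, he', hQP, ← mul_assoc, heQ, mul_assoc Q, hPe]
    abel
  obtain ⟨n, hn⟩ := hnil (e' - Q * P) (by rw [map_sub, map_mul, hπQ, hπP, hqp, sub_self])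
  have h2 : ∀ n, (e' - Q * P) ^ (n + 1) = e' - Q * P := by
    intro n
    induction n with
    | zero => rw [zero_add, pow_one]
    | succ n ih => rw [pow_succ, ih, h1]
  have h3 := h2 n
  rw [pow_succ, hn, zero_mul] at h3
  exact (sub_eq_zero.1 h3.symm).symm

/-! ### Deleting a component of a model -/

section Delete

/-- An element `x` such that `e x = x = x e` as an element of the corner ring `e R e`. -/
def cornerMk {R : Type*} [Ring R] {e : R} (he : IsIdempotentElem e) (x : R) (hl : e * x = x)
    (hr : x * e = x) : he.Corner :=
  ⟨x, x, by
    change e * x * e = x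
    rw [hl, hr]⟩

variable {k : Type u} [Field k] {X : Type} {Q : Type u} [DecidableEq X] [Ring Q] [Algebra k Q]
  (ι : (X → k) →ₐ[k] Q) (v : X)

theorem isIdempotentElem_one_sub_single : IsIdempotentElem (1 - ι (Pi.single v 1)) :=
  IsIdempotentElem.one_sub (map_single_mul_self ι v)

theorem one_sub_single_mul [Fintype X] {z : X} (hz : z ≠ v) :
    (1 - ι (Pi.single v 1)) * ι (Pi.single z 1) = ι (Pi.single z 1) := by
  rw [sub_mul, (complete_map_single ι).ortho hz.symm, one_mul, sub_zero]

theorem single_mul_one_sub [Fintype X] {z : X} (hz : z ≠ v) :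
    ι (Pi.single z 1) * (1 - ι (Pi.single v 1)) = ι (Pi.single z 1) := by
  rw [mul_sub, (complete_map_single ι).ortho hz, mul_one, sub_zero]

/-- The idempotents of the components other than `v` as elements of the corner ring. -/
def deleteFamily [Fintype X] (z : {z : X // z ≠ v}) :
    (isIdempotentElem_one_sub_single ι v).Corner :=
  cornerMk _ (ι (Pi.single z.1 1)) (one_sub_single_mul ι v z.2) (single_mul_one_sub ι v z.2)

theorem complete_deleteFamily [Fintype X] : CompleteOrthogonalIdempotents (deleteFamily ι v) where
  idem z := corner_ext _ (map_single_mul_self ι z.1)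
  ortho z w hzw := corner_ext _
    ((complete_map_single ι).ortho fun h => hzw (Subtype.ext h))
  complete := by
    apply corner_ext
    change cornerVal _ k _ = 1 - ι (Pi.single v 1)
    rw [map_sum, eq_sub_iff_add_eq']
    refine Eq.trans ?_ (complete_map_single ι).complete
    rw [Fintype.sum_eq_add_sum_subtype_ne _ v]
    rfl

/-- The inclusion of the product of the components other than `v` into the corner ring. -/
def deleteAlg [Fintype X] :
    ({z : X // z ≠ v} → k) →ₐ[k] (isIdempotentElem_one_sub_single ι v).Corner :=
  idemAlg (complete_deleteFamily ι v)

theorem deleteAlg_single [Fintype X] (z : {z : X // z ≠ v}) :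
    (deleteAlg ι v (Pi.single z 1)).1 = ι (Pi.single z.1 1) :=
  congrArg Subtype.val (idemAlg_single (complete_deleteFamily ι v) z)

theorem deleteAlg_val [Fintype X] (t : {z : X // z ≠ v} → k) :
    (deleteAlg ι v t).1 = ι (fun z => if h : z ≠ v then t ⟨z, h⟩ else 0) := by
  refine Eq.trans ?_ (map_eq_sum ι _).symm
  rw [Fintype.sum_eq_add_sum_subtype_ne _ v, dif_neg (fun h => h rfl), zero_smul,
    zero_add]
  change cornerVal _ k (∑ z, t z • deleteFamily ι v z) = _
  rw [map_sum]
  refine Finset.sum_congr rfl fun z _ => ?_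
  rw [dif_pos z.2]
  rfl

variable {D : MarkedAlgebra k} {H : Type u} [Ring H] [Algebra k H]
  {f : D.alg →ₐ[k] H} {π : H →ₐ[k] Q} {ι : (D.comp → k) →ₐ[k] Q} {ε : D.comp → D.alg}

theorem isIdempotentElem_one_sub_map (hε : D.IsDecomposition ε) (f : D.alg →ₐ[k] H) (v : D.comp) :
    IsIdempotentElem (1 - f (ε v)) :=
  IsIdempotentElem.one_sub (map_idem_mul_self hε f v)

/-- The homomorphism of corner rings. -/
def deleteMap (hM : IsModel D f π ι) (hε : D.IsDecomposition ε) (v : D.comp) :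
    (isIdempotentElem_one_sub_map hε f v).Corner →ₐ[k]
      (isIdempotentElem_one_sub_single ι v).Corner :=
  cornerMap π _ _ (by rw [map_sub, map_one, hM.idem_eq hε])

theorem deleteAlg_injective (hM : IsModel D f π ι) (v : D.comp) :
    Function.Injective (deleteAlg ι v) :=
  idemAlg_injective _ fun z h => hM.map_idem_ne_zero z.1 (congrArg Subtype.val h)

/-- The algebra obtained by deleting the component `v`. -/
def deleted (hM : IsModel D f π ι) (hε : D.IsDecomposition ε) (v : D.comp) : MarkedAlgebra k :=
  pullback (deleteMap hM hε v) (deleteAlg ι v) (deleteAlg_injective hM v)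

/-- Deleting a component replaces `H` and `Q` by corner rings. -/
theorem IsModel.delete (hM : IsModel D f π ι) (hε : D.IsDecomposition ε) (v : D.comp) :
    IsModel (deleted hM hε v) (pullbackVal _ _ _) (deleteMap hM hε v) (deleteAlg ι v) := by
  have := hM.finite
  refine isModel_pullback _ _ _ (hM.hereditary.corner _) ?_ ?_ ?_ ?_
  · intro z
    obtain ⟨h, hh⟩ := hM.surjective z.1
    refine ⟨toCorner _ h, corner_ext _ ?_⟩
    change π ((1 - f (ε v)) * h * (1 - f (ε v))) = z.1
    rw [map_mul, map_mul, hh, map_sub, map_one, hM.idem_eq hε, corner_mul_left, corner_mul_right]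
  · intro h hh
    obtain ⟨n, hn⟩ := hM.nil h.1 (congrArg Subtype.val hh)
    have h1 : ∀ m, (h ^ (m + 1)).1 = h.1 ^ (m + 1) := by
      intro m
      induction m with
      | zero => rw [zero_add, pow_one, pow_one]
      | succ m ih => rw [pow_succ, pow_succ _ (m + 1), ← ih]; rfl
    refine ⟨n + 1, corner_ext _ ?_⟩
    rw [h1, pow_succ, hn, zero_mul]
    rfl
  · intro z hz
    refine corner_ext _ (hM.semiprime _ fun w => ?_)
    have h1 := congrArg Subtype.val (hz (toCorner _ w))
    change z.1 * ((1 - _) * w * (1 - _)) * z.1 = 0 at h1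
    rw [mul_assoc _ _ z.1, mul_assoc _ _ z.1, corner_mul_left, ← mul_assoc, ← mul_assoc,
      corner_mul_right] at h1
    exact h1
  · intro x
    obtain ⟨p, q, hpq⟩ := hM.two x.1
    refine ⟨toCorner _ p, toCorner _ q, fun z => ?_⟩
    obtain ⟨s, t, hst⟩ := hpq z.1
    refine ⟨s, t, corner_ext _ ?_⟩
    rw [← corner_mul_left _ (z * _), ← corner_mul_right _ (z * _), corner_val_mul,
      deleteAlg_single, hst]
    simp only [corner_val_add, corner_val_smul, toCorner_val, mul_add, add_mul, mul_smul_comm,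
      smul_mul_assoc, mul_assoc]

end Delete

/-! ### Reversing a blowing up -/

/-- If `v` is deleted from `X`, and the element `u` is replaced by two elements, the result is `X`
with the second copy of `u` in the role of `v`. -/
def doubleEquiv {X Z : Type} [DecidableEq X] {u v : X} (huv : u ≠ v) (σ : {z : X // z ≠ v} ≃ Z) :
    BlowIndex (σ ⟨u, huv⟩) ≃ X where
  toFun := Sum.elim (fun c => (σ.symm c.1).1) ![u, v]
  invFun z := if hv : z ≠ v then
      if hu : z ≠ u then .inl ⟨σ ⟨z, hv⟩, fun h => hu (congrArg Subtype.val (σ.injective h))⟩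
      else .inr 0
    else .inr 1
  left_inv x := by
    rcases x with ⟨c, hc⟩ | i
    · obtain ⟨⟨z, hz⟩, rfl⟩ := σ.surjective c
      have hu : z ≠ u := by
        rintro rfl
        exact hc rfl
      simp [hz, hu]
    · fin_cases i <;> simp [huv]
  right_inv z := by
    by_cases hv : z = v
    · simp [hv]
    · by_cases hu : z = u <;> simp [hv, hu, huv]

theorem doubleEquiv_symm_of_ne {X Z : Type} [DecidableEq X] {u v : X} (huv : u ≠ v)
    (σ : {z : X // z ≠ v} ≃ Z) {z : X} (hv : z ≠ v) (hu : z ≠ u) :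
    ∃ h, (doubleEquiv huv σ).symm z = .inl ⟨σ ⟨z, hv⟩, h⟩ :=
  ⟨fun h => hu (congrArg Subtype.val (σ.injective h)), (dif_pos hv).trans (dif_pos hu)⟩

section DoubleLine

variable {k : Type u} [Field k] {X : Type} {Q : Type u} [DecidableEq X] [Ring Q]
  [Algebra k Q] {ι : (X → k) →ₐ[k] Q} {u v : X} {p q : Q}

theorem IsDouble.mul_idem_left (hd : IsDouble ι u v p q) : p * ι (Pi.single v 1) = p := by
  rw [← hd.mul_right, ← mul_assoc, hd.mul_left, hd.idem_mul_left]

theorem IsDouble.mul_idem_right (hd : IsDouble ι u v p q) : q * ι (Pi.single u 1) = q := by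
  rw [← hd.mul_left, ← mul_assoc, hd.mul_right, hd.idem_mul_right]

variable [Fintype X]

theorem IsDouble.not_isLine_left (hd : IsDouble ι u v p q) (h0 : ι (Pi.single u 1) ≠ 0) :
    ¬ IsLine ι u := by
  intro h
  obtain ⟨s, hs⟩ := h q
  rw [hd.mul_idem_right] at hs
  apply h0
  have h1 := hd.idem_mul_right
  rw [hs, mul_smul_comm, (complete_map_single ι).ortho hd.ne.symm, smul_zero, ← hs] at h1
  rw [← hd.mul_left, ← h1, mul_zero]

theorem IsDouble.not_isLine_right (hd : IsDouble ι u v p q) (h0 : ι (Pi.single u 1) ≠ 0) :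
    ¬ IsLine ι v := by
  intro h
  obtain ⟨s, hs⟩ := h p
  rw [hd.mul_idem_left] at hs
  apply h0
  have h1 := hd.idem_mul_left
  rw [hs, mul_smul_comm, (complete_map_single ι).ortho hd.ne, smul_zero, ← hs] at h1
  rw [← hd.mul_left, ← h1, zero_mul]

theorem IsDouble.isLine_deleteAlg (hd : IsDouble ι u v p q) :
    IsLine (deleteAlg ι v) ⟨u, hd.ne⟩ := by
  intro z
  obtain ⟨s, t, hst⟩ := hd.span z.1
  refine ⟨s, corner_ext _ ?_⟩
  rw [corner_val_smul, corner_val_mul, deleteAlg_single, ← corner_mul_left _ z, mul_assoc, hst,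
    mul_add, mul_smul_comm, mul_smul_comm, one_sub_single_mul ι v hd.ne, sub_mul, one_mul,
    hd.idem_mul_right, sub_self, smul_zero, add_zero]

theorem IsLine.deleteAlg {x : X} (hx : IsLine ι x) (hxv : x ≠ v) :
    IsLine (deleteAlg ι v) ⟨x, hxv⟩ := by
  intro z
  obtain ⟨s, hs⟩ := hx z.1
  refine ⟨s, corner_ext _ ?_⟩
  rw [corner_val_smul, corner_val_mul, deleteAlg_single, hs]

end DoubleLine

variable {k : Type u} [Field k] {D C : MarkedAlgebra k} {H Q : Type u} [Ring H] [Algebra k H]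
  [Ring Q] [Algebra k Q] {f : D.alg →ₐ[k] H} {π : H →ₐ[k] Q} {ι : (D.comp → k) →ₐ[k] Q}
  {ε : D.comp → D.alg}

/-- An algebra isomorphic to the one obtained by deleting `v` is embedded in `H`. -/
theorem exists_embedding_of_delete (hM : IsModel D f π ι) (hε : D.IsDecomposition ε) (v : D.comp)
    (σ : MarkedIso (deleted hM hε v) C) (σ' : {z : D.comp // z ≠ v} ≃ C.comp)
    (hσ' : ∀ z, σ' z = σ.comp z) :
    ∃ g : C.alg →ₗ[k] H, Function.Injective g ∧ (∀ c c', g (c * c') = g c * g c') ∧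
      g 1 = 1 - f (ε v) ∧ (∀ c, C.proj c = 0 → π (g c) = 0) ∧
      ∀ h t, (1 - f (ε v)) * h = h → h * (1 - f (ε v)) = h → π h = ι t → t v = 0 →
        ∃ c, g c = h ∧ ∀ z, C.proj c (σ' z) = t z.1 := by
  have hM' := hM.delete hε v
  let g₀ : (deleted hM hε v).alg →ₐ[k] (isIdempotentElem_one_sub_map hε f v).Corner :=
    pullbackVal _ _ _
  have hg₀ : Function.Injective g₀ := Subtype.val_injective
  refine ⟨(cornerVal (isIdempotentElem_one_sub_map hε f v) k).comp
    (g₀.toLinearMap.comp σ.equiv.symm.toLinearMap), ?_, ?_, ?_, ?_, ?_⟩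
  · exact Subtype.val_injective.comp (hg₀.comp σ.equiv.symm.injective)
  · intro c c'
    change (g₀ (σ.equiv.symm (c * c'))).1 = (g₀ (σ.equiv.symm c) * g₀ (σ.equiv.symm c')).1
    rw [map_mul, map_mul]
  · change (g₀ (σ.equiv.symm 1)).1 = _
    rw [map_one, map_one]
    rfl
  · intro c hc
    have h1 : (deleted hM hε v).proj (σ.equiv.symm c) = 0 := by
      funext z
      rw [← σ.proj_equiv, σ.equiv.apply_symm_apply, hc]
      rfl
    have h2 := ((hM'.comm (σ.equiv.symm c)).trans (congrArg _ h1)).trans (map_zero (deleteAlg ι v))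
    exact congrArg Subtype.val h2
  · intro h t hl hr ht htv
    have h1 : deleteMap hM hε v (cornerMk _ h hl hr) = deleteAlg ι v fun z => t z.1 := by
      apply corner_ext
      rw [deleteAlg_val]
      refine ht.trans (congrArg ι (funext fun z => ?_))
      by_cases hz : z = v
      · rw [hz, htv, dif_neg (fun h => h rfl)]
      · rw [dif_pos hz]
    obtain ⟨d, hd⟩ := hM'.exists_eq _ _ h1
    refine ⟨σ.equiv d, ?_, fun z => ?_⟩
    · change (g₀ (σ.equiv.symm (σ.equiv d))).1 = h
      rw [σ.equiv.symm_apply_apply]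
      exact congrArg Subtype.val hd
    · rw [hσ']
      exact (σ.proj_equiv d z).trans
        (congrFun (hM'.proj_eq_of_map_eq ((congrArg _ hd).trans h1)) z)

/-- If the idempotents of `u` and `v` are equivalent, then `D` is obtained by blowing up the
component `u` of the algebra in which `v` is deleted. There the left ideal of `u` is
one-dimensional, hence `u` has not been involved before. -/
theorem IsModel.isRebuilt_of_double (hM : IsModel D f π ι) (hε : D.IsDecomposition ε) {u v : D.comp}
    {p q : Q} (hd : IsDouble ι u v p q) {Γ : FinQuiver} {gl : List (Γ.vert × Γ.vert)}
    {bl : List Γ.vert} (h : IsRebuilt (deleted hM hε v) (IsLine (deleteAlg ι v)) Γ gl bl) :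
    ∃ i, IsRebuilt D (IsLine ι) Γ gl (i :: bl) := by
  obtain ⟨C, old, hC, σ, hσ⟩ := h
  let σ' : {z : D.comp // z ≠ v} ≃ C.comp := σ.comp
  obtain ⟨g, hg, hgmul, hg1, hg0, hgex⟩ := exists_embedding_of_delete hM hε v σ σ' fun _ => rfl
  let E : D.comp → H := fun z => f (ε z)
  have hE : CompleteOrthogonalIdempotents E := hε.complete.map f.toRingHom
  have hπE : ∀ z, π (E z) = ι (Pi.single z 1) := hM.idem_eq hε
  have hEl : ∀ {z}, z ≠ v → ∀ h, E z * h = h → (1 - E v) * h = h := by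
    intro z hz h hh
    rw [sub_mul, one_mul, ← hh, ← mul_assoc, hE.ortho hz.symm, zero_mul, sub_zero]
  have hEr : ∀ {z}, z ≠ v → ∀ h, h * E z = h → h * (1 - E v) = h := by
    intro z hz h hh
    rw [mul_sub, mul_one, ← hh, mul_assoc, hE.ortho hz, mul_zero, sub_zero]
  have hgproj : ∀ c c', C.proj c = C.proj c' → π (g c) = π (g c') := by
    intro c c' h
    rw [← sub_eq_zero, ← map_sub, ← map_sub, hg0 _ (by rw [map_sub, h, sub_self])]
  -- the decomposition of the unit of `C`
  have hex : ∀ c, ∃ e, g e = E (σ'.symm c).1 ∧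
      ∀ z, C.proj e (σ' z) = (Pi.single (σ'.symm c).1 1 : D.comp → k) z.1 := fun c =>
    hgex (E (σ'.symm c).1) (Pi.single (σ'.symm c).1 1) (hEl (σ'.symm c).2 _ (hE.idem _).eq)
      (hEr (σ'.symm c).2 _ (hE.idem _).eq) (hπE _) (Pi.single_eq_of_ne (σ'.symm c).2.symm _)
  choose ε' hgε' hε'proj using hex
  have hε' : C.IsDecomposition ε' := by
    refine ⟨⟨⟨fun c => hg ?_, fun c c' hcc => hg ?_⟩, hg ?_⟩, fun c => funext fun c' => ?_⟩
    · rw [hgmul, hgε', (hE.idem _).eq]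
    · rw [hgmul, hgε', hgε', hE.ortho (fun h => hcc (σ'.symm.injective (Subtype.ext h))), map_zero]
    · rw [map_sum, hg1, eq_sub_iff_add_eq']
      refine Eq.trans ?_ hE.complete
      rw [Fintype.sum_eq_add_sum_subtype_ne _ v]
      simp only [hgε']
      rw [Equiv.sum_comp σ'.symm fun z => E z.1]
    · obtain ⟨z, rfl⟩ := σ'.surjective c'
      rw [hε'proj]
      by_cases hz : z = σ'.symm c
      · subst hz
        simp
      · have h1 : z.1 ≠ (σ'.symm c).1 := fun h => hz (Subtype.ext h)
        have h2 : σ' z ≠ c := fun h => hz (by rw [← h, σ'.symm_apply_apply])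
        rw [Pi.single_eq_of_ne h1, Pi.single_eq_of_ne h2]
  -- the elements of `H` that realize the equivalence of the idempotents of `u` and `v`
  obtain ⟨P₀, Q₀, hπP, hπQ, hPQ, hQP, heP, hPe, heQ, hQe⟩ := exists_lift_equivalence π.toRingHom
    hM.surjective hM.nil (hE.idem u).eq (hE.idem v).eq (p := p) (q := q)
    (hd.mul_left.trans (hπE u).symm) (hd.mul_right.trans (hπE v).symm)
    ((congrArg (· * p) (hπE u)).trans hd.idem_mul_left)
    ((congrArg (· * q) (hπE v)).trans hd.idem_mul_right)
  -- the equivalences between the idempotents of `D` and of the summands of the module that defines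
  -- the blowing up: the second copy of `u` corresponds to `v`, the others to themselves
  let τ := doubleEquiv hd.ne σ'
  let P : BlowIndex (σ' ⟨u, hd.ne⟩) → H := Sum.elim (fun c => E (σ'.symm c.1).1) ![E u, P₀]
  let R : BlowIndex (σ' ⟨u, hd.ne⟩) → H := Sum.elim (fun c => E (σ'.symm c.1).1) ![E u, Q₀]
  let base : BlowIndex (σ' ⟨u, hd.ne⟩) → D.comp := fun x => (σ'.symm x.under).1
  have hbase : ∀ x, base x ≠ v := fun x => (σ'.symm x.under).2
  have hcase : ∀ p : BlowIndex (σ' ⟨u, hd.ne⟩) → Prop, (∀ c, p (.inl c)) → p (.inr 0) →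
      p (.inr 1) → ∀ x, p x := by
    intro p h1 h2 h3 x
    rcases x with c | i
    · exact h1 c
    · fin_cases i
      · exact h2
      · exact h3
  have hbase0 : base (.inr 0) = u := congrArg Subtype.val (σ'.symm_apply_apply _)
  have hbase1 : base (.inr 1) = u := congrArg Subtype.val (σ'.symm_apply_apply _)
  have hPR : ∀ x, P x * R x = E (base x) := hcase _ (fun c => (hE.idem _).eq)
    (by rw [hbase0]; exact (hE.idem u).eq) (by rw [hbase1]; exact hPQ)
  have hRP : ∀ x, R x * P x = E (τ x) := hcase _ (fun c => (hE.idem _).eq) (hE.idem u).eq hQP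
  have hP : ∀ x, P x * E (τ x) = P x := hcase _ (fun c => (hE.idem _).eq) (hE.idem u).eq hPe
  have hR : ∀ x, E (τ x) * R x = R x := hcase _ (fun c => (hE.idem _).eq) (hE.idem u).eq heQ
  have hbP : ∀ x, E (base x) * P x = P x := hcase _ (fun c => (hE.idem _).eq)
    (by rw [hbase0]; exact (hE.idem u).eq) (by rw [hbase1]; exact heP)
  have hRb : ∀ x, R x * E (base x) = R x := hcase _ (fun c => (hE.idem _).eq)
    (by rw [hbase0]; exact (hE.idem u).eq) (by rw [hbase1]; exact hQe)
  have hentry : ∀ d x y, π (P x * f d * R y) =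
      ι (if x = y then D.proj d (τ x) • Pi.single (base x) 1 else 0) := by
    intro d x y
    have h1 : P x * f d * R y = P x * (E (τ x) * f d * E (τ y)) * R y := by
      rw [← mul_assoc, ← mul_assoc, hP, mul_assoc _ (E (τ y)), hR]
    have h2 : π (E (τ x) * f d * E (τ y)) =
        if x = y then D.proj d (τ x) • π (E (τ x)) else 0 := by
      rw [map_mul, map_mul, hπE, hπE, hM.comm, ← map_mul, ← map_mul]
      split_ifs with hxy
      · subst hxy
        rw [← map_smul]
        congr 1
        funext z
        by_cases hz : z = τ x
        · subst hz; simp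
        · simp [hz]
      · rw [← map_zero ι]
        congr 1
        funext z
        by_cases hz : z = τ x
        · subst hz
          simp [hxy]
        · simp [hz]
    rw [h1, map_mul, map_mul, h2]
    split_ifs with hxy
    · subst hxy
      rw [mul_smul_comm, smul_mul_assoc, ← map_mul, ← map_mul, hP, hPR, hπE, map_smul]
    · rw [mul_zero, zero_mul, map_zero]
  have hcex : ∀ d x y, ∃ c, g c = P x * f d * R y ∧ ∀ z, C.proj c (σ' z) =
      (if x = y then D.proj d (τ x) • Pi.single (base x) 1 else 0 : D.comp → k) z.1 := by
    intro d x y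
    refine hgex _ _ (hEl (hbase x) _ ?_) (hEr (hbase y) _ ?_) (hentry d x y) ?_
    · rw [← mul_assoc, ← mul_assoc, hbP]
    · rw [mul_assoc, hRb]
    · split_ifs
      · simp [(hbase x).symm]
      · rfl
  obtain ⟨σ₁, hσ₁⟩ := exists_markedIso_blowUp hε' (σ' ⟨u, hd.ne⟩) f hM.injective g hg hgmul τ hE
    P R (fun x => (hPR x).trans (hgε' _).symm) hRP hP hR
    (by
      intro d
      choose c hc hcp using hcex d
      obtain ⟨φ, hφ⟩ := MarkedAlgebra.exists_blowSubalgebra hε' c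
        (fun x y => hg (by
          rw [hgmul, hgε', hc, ← mul_assoc, ← mul_assoc]
          exact congrArg (· * _ * _) (hbP x)))
        (fun x y => hg (by
          rw [hgmul, hgε', hc, mul_assoc]
          exact congrArg _ (hRb y)))
        (fun x y hxy => by
          funext c'
          obtain ⟨z, rfl⟩ := σ'.surjective c'
          rw [hcp, if_neg hxy]
          rfl)
      exact ⟨φ, fun x y => by rw [hφ, hc]⟩)
    (by
      intro d c x hc
      obtain ⟨c', hc', hcp⟩ := hcex d x x
      obtain rfl := hg (hc.trans hc'.symm)
      have h1 := hcp (σ'.symm x.under)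
      rw [σ'.apply_symm_apply, if_pos rfl] at h1
      rw [h1]
      change D.proj d (τ x) • (Pi.single (base x) 1 : D.comp → k) (base x) = _
      rw [Pi.single_eq_same, smul_eq_mul, mul_one])
    (by
      intro φ
      refine hM.exists_eq _ (fun z => C.blowProj ε' hε' _ φ (τ.symm z)) ?_
      rw [map_eq_sum ι, ← Equiv.sum_comp τ, map_sum]
      refine Finset.sum_congr rfl fun x _ => ?_
      rw [map_sum, Finset.sum_eq_single x, τ.symm_apply_apply]
      · have h1 := hgproj _ (C.blowProj ε' hε' _ φ x • ε' x.under) (by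
          rw [MarkedAlgebra.proj_blowEntry hε' φ x x, if_pos rfl, map_smul, hε'.proj_eq])
        rw [map_smul, hgε', map_smul] at h1
        rw [map_mul, map_mul, h1, mul_smul_comm, smul_mul_assoc, ← map_mul]
        change _ • (π (R x * E (base x)) * π (P x)) = _
        rw [hRb, ← map_mul, hRP, hπE]
      · intro y _ hy
        have h1 := hg0 _ ((MarkedAlgebra.proj_blowEntry hε' φ x y).trans (if_neg hy.symm))
        rw [map_mul, map_mul, h1, mul_zero, zero_mul]
      · simp)
  obtain ⟨i, hi⟩ := hσ ⟨u, hd.ne⟩ hd.isLine_deleteAlg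
  refine ⟨i, _, _, .blowUp ε' hε' hC hi, σ₁, fun x hx => ?_⟩
  have hxv : x ≠ v := by
    rintro rfl
    exact hd.not_isLine_right (hM.map_idem_ne_zero u) hx
  have hxu : x ≠ u := by
    rintro rfl
    exact hd.not_isLine_left (hM.map_idem_ne_zero x) hx
  obtain ⟨b, hb⟩ := hσ ⟨x, hxv⟩ (hx.deleteAlg hxv)
  obtain ⟨h1, h2⟩ := doubleEquiv_symm_of_ne hd.ne σ' hxv hxu
  refine ⟨b, ?_⟩
  rw [hb, hσ₁]
  exact (dif_pos h1).trans (congrArg some h2.symm)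

/-! ### Reduction of models to path algebras -/

section

variable {k : Type u} [Field k] {D : MarkedAlgebra k} {H Q : Type u} [Ring H] [Algebra k H]
  [Ring Q] [Algebra k Q] {f : D.alg →ₐ[k] H} {π : H →ₐ[k] Q} {ι : (D.comp → k) →ₐ[k] Q}

/-- If all components generate one-dimensional left ideals, then `D` coincides with the hereditary
algebra `H`, and it is the path algebra of a quiver. -/
theorem IsModel.exists_isRebuilt_of_isLine (hM : IsModel D f π ι) (hl : ∀ x, IsLine ι x) :
    ∃ Γ : FinQuiver, Γ.Acyclic ∧ IsRebuilt D (IsLine ι) Γ [] [] := by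
  have hf : Function.Surjective f := by
    intro h
    choose s hs using fun x => hl x (π h)
    refine hM.exists_eq h s ?_
    rw [map_eq_sum ι, ← mul_one (π h), ← (complete_map_single ι).complete, Finset.mul_sum]
    exact Finset.sum_congr rfl fun x _ => hs x
  have hH : IsHereditary D.alg :=
    hM.hereditary.of_ringEquiv (RingEquiv.ofBijective f.toRingHom ⟨hM.injective, hf⟩).symm
  obtain ⟨Γ, hΓ, ⟨σ⟩⟩ := hM.isBasic.exists_markedIso_pathMarked hH
  exact ⟨Γ, hΓ, _, _, .start, σ, fun x _ => ⟨σ.comp x, rfl⟩⟩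

/-- If no component arises by blowing up, then gluings can be reversed until all components
generate one-dimensional left ideals. -/
theorem IsModel.exists_isRebuilt_of_not_isDouble [IsAlgClosed k] (hM : IsModel D f π ι)
    (hd : ∀ u v p q, ¬ IsDouble ι u v p q) :
    ∃ (Γ : FinQuiver) (gl : List (Γ.vert × Γ.vert)),
      Γ.Acyclic ∧ IsRebuilt D (IsLine ι) Γ gl [] := by
  induction hn : {x | ¬ IsLine ι x}.ncard using Nat.strong_induction_on generalizing D f with
  | _ n ih =>
  by_cases hl : ∀ x, IsLine ι x
  · obtain ⟨Γ, hΓ, h⟩ := hM.exists_isRebuilt_of_isLine hl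
    exact ⟨Γ, [], hΓ, h⟩
  · push Not at hl
    obtain ⟨x, hx⟩ := hl
    obtain ⟨e, e', hs⟩ | ⟨y, p, q, h⟩ := exists_isSplit_or_isDouble hM.map_idem_ne_zero
      hM.semiprime hM.two hx
    · have hM' := hM.split hs
      have hold : ∀ o, ¬ IsLine (splitAlg hs) o →
          ∃ y, y ≠ x ∧ o = some y ∧ ¬ IsLine ι y := by
        rintro (_ | y) ho
        · exact absurd (isLine_splitAlg_none hs) ho
        · by_cases hy : y = x
          · subst hy
            exact absurd (isLine_splitAlg_some_self hs) ho
          · exact ⟨y, hy, rfl, fun h => ho ((isLine_splitAlg_iff hs hy).2 h)⟩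
      have hlt : {o | ¬ IsLine (splitAlg hs) o}.ncard < n := by
        rw [← hn]
        calc {o | ¬ IsLine (splitAlg hs) o}.ncard
            ≤ (some '' ({y | ¬ IsLine ι y} \ {x})).ncard := by
              refine Set.ncard_le_ncard ?_ (Set.toFinite _)
              intro o ho
              obtain ⟨y, hy, rfl, hly⟩ := hold o ho
              exact ⟨y, ⟨hly, hy⟩, rfl⟩
          _ ≤ ({y | ¬ IsLine ι y} \ {x}).ncard := Set.ncard_image_le (Set.toFinite _)
          _ < {y | ¬ IsLine ι y}.ncard := Set.ncard_sdiff_singleton_lt_of_mem hx (Set.toFinite _)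
      obtain ⟨Γ, gl, hΓ, h⟩ := ih _ hlt hM' (by
        intro o o' p q h
        have h0 := hM'.map_idem_ne_zero o
        obtain ⟨y, hy, rfl, -⟩ := hold o (h.not_isLine_left h0)
        obtain ⟨y', hy', rfl, -⟩ := hold o' (h.not_isLine_right h0)
        have h1 := splitAlg_some_of_ne hs hy
        have h2 := splitAlg_some_of_ne hs hy'
        refine hd y y' p q ⟨fun e => h.ne (congrArg some e), ?_, ?_, ?_, ?_, ?_⟩
        · rw [← h1]; exact h.mul_left
        · rw [← h2]; exact h.mul_right
        · rw [← h1]; exact h.idem_mul_left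
        · rw [← h2]; exact h.idem_mul_right
        · rw [← h1]; exact h.span) rfl
      obtain ⟨i, j, h'⟩ := hM.isRebuilt_of_split hs h
      exact ⟨Γ, (i, j) :: gl, hΓ, h'⟩
    · exact absurd h (hd _ _ _ _)

end

/-- Every algebra with a model is obtained from the path algebra of a quiver. The blowings up, which
come last in a suitable sequence, are reversed at first, by deleting components. -/
theorem IsModel.exists_isRebuilt {k : Type u} [Field k] [IsAlgClosed k] (n : ℕ)
    {D : MarkedAlgebra k} (hn : Nat.card D.comp = n) {H Q : Type u} [Ring H] [Algebra k H]
    [Ring Q] [Algebra k Q] {f : D.alg →ₐ[k] H} {π : H →ₐ[k] Q} {ι : (D.comp → k) →ₐ[k] Q}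
    (hM : IsModel D f π ι) :
    ∃ (Γ : FinQuiver) (gl : List (Γ.vert × Γ.vert)) (bl : List Γ.vert),
      Γ.Acyclic ∧ IsRebuilt D (IsLine ι) Γ gl bl := by
  induction n using Nat.strong_induction_on generalizing D H Q with
  | _ n ih =>
  by_cases hd : ∀ u v p q, ¬ IsDouble ι u v p q
  · obtain ⟨Γ, gl, h⟩ := hM.exists_isRebuilt_of_not_isDouble hd
    exact ⟨Γ, gl, [], h⟩
  · push Not at hd
    obtain ⟨u, v, p, q, hd⟩ := hd
    obtain ⟨ε, hε⟩ := hM.isBasic.exists_isDecomposition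
    have hlt : Nat.card {z : D.comp // z ≠ v} < n := by
      rw [← hn]
      exact Finite.card_subtype_lt (x := v) (fun h => h rfl)
    obtain ⟨Γ, gl, bl, hΓ, h⟩ := ih _ hlt rfl (hM.delete hε v)
    obtain ⟨i, h'⟩ := hM.isRebuilt_of_double hε hd h
    exact ⟨Γ, gl, i :: bl, hΓ, h'⟩

theorem encard_seqRel_le_one {X : Type} {gl : List (X × X)} {bl : List X}
    (h : (gl.map Prod.fst ++ bl ++ gl.map Prod.snd).Nodup) (x : X) :
    {y | seqRel gl bl x y}.encard ≤ 1 := by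
  rw [List.nodup_append, List.nodup_append] at h
  obtain ⟨⟨h1, -, h2⟩, h3, h4⟩ := h
  have hfst : ∀ {a b}, (a, b) ∈ gl → a ∈ gl.map Prod.fst := fun h =>
    List.mem_map_of_mem (f := Prod.fst) h
  have hsnd : ∀ {a b}, (a, b) ∈ gl → b ∈ gl.map Prod.snd := fun h =>
    List.mem_map_of_mem (f := Prod.snd) h
  rw [Set.encard_le_one_iff]
  rintro a b (ha | ha | ⟨rfl, ha⟩) (hb | hb | ⟨rfl, hb⟩)
  · exact congrArg Prod.snd (List.inj_on_of_nodup_map h1 ha hb rfl)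
  · exact absurd rfl (h4 _ (List.mem_append_left _ (hfst ha)) _ (hsnd hb))
  · exact absurd rfl (h2 _ (hfst ha) _ hb)
  · exact absurd rfl (h4 _ (List.mem_append_left _ (hfst hb)) _ (hsnd ha))
  · exact congrArg Prod.fst (List.inj_on_of_nodup_map h3 ha hb rfl)
  · exact absurd rfl (h4 _ (List.mem_append_right _ hb) _ (hsnd ha))
  · exact absurd rfl (h2 _ (hfst hb) _ ha)
  · exact absurd rfl (h4 _ (List.mem_append_right _ ha) _ (hsnd hb))
  · rfl

theorem IsNodal.exists_isGivenBy {k : Type u} [Field k] [IsAlgClosed k] {A : Type v} [Ring A]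
    [Algebra k A] [FiniteDimensional k A] (hA : IsBasic k A) (hN : IsNodal k A) :
    ∃ (Γ : FinQuiver) (rel : Γ.vert → Γ.vert → Prop), Γ.Acyclic ∧ (∀ i j, rel i j → rel j i) ∧
      (∀ i, {j | rel i j}.encard ≤ 1) ∧ IsGivenBy k Γ rel A := by
  obtain ⟨D, H, Q, _, _, _, _, f, π, ι, hM, ⟨e⟩⟩ := exists_isModel_of_isNodal hA hN
  obtain ⟨Γ, gl, bl, hΓ, C, old, hC, σ, -⟩ := hM.exists_isRebuilt _ rfl
  have hnd := hC.old_eq_none_and_nodup.2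
  refine ⟨Γ, seqRel gl bl, hΓ, ?_, encard_seqRel_le_one hnd, gl, bl, fun _ _ => Iff.rfl, hnd, C,
    old, hC, ⟨e.trans σ.equiv⟩⟩
  rintro i j (h | h | ⟨rfl, h⟩)
  · exact .inr (.inl h)
  · exact .inl h
  · exact .inr (.inr ⟨rfl, h⟩)

theorem IsObtainedFromHereditary.isNodal {k : Type u} [Field k] {A : Type v} [Ring A]
    [Algebra k A] (hA : IsObtainedFromHereditary k A) : IsNodal k A := by
  obtain ⟨B, hB, hH, gl, bl, -, C, old, hC, ⟨e⟩⟩ := hA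
  obtain ⟨H, Q, _, _, _, _, f, π, ι, hM, -⟩ := hC.exists_isModel hB hH
  exact hM.isNodal e

theorem IsGivenBy.isObtainedFromHereditary {k : Type u} [Field k] {A : Type v} [Ring A]
    [Algebra k A] {Γ : FinQuiver} {rel : Γ.vert → Γ.vert → Prop} (hΓ : Γ.Acyclic)
    (hA : IsGivenBy k Γ rel A) : IsObtainedFromHereditary k A := by
  obtain ⟨gl, bl, -, h⟩ := hA
  exact ⟨pathMarked k Γ, pathMarked_isBasic hΓ, pathMarked_isHereditary hΓ, gl, bl, h⟩

end Nodal

end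

theorem theorem1p6 {k : Type*} [Field k] [IsAlgClosed k] {A : Type*} [Ring A] [Algebra k A]
    [FiniteDimensional k A] (hA : Nodal.IsBasic k A) :
    (Nodal.IsNodal k A ↔ Nodal.IsObtainedFromHereditary k A) ∧
    (Nodal.IsNodal k A ↔
      ∃ (Γ : Nodal.FinQuiver) (rel : Γ.vert → Γ.vert → Prop),
        Γ.Acyclic ∧ (∀ i j, rel i j → rel j i) ∧ (∀ i, {j | rel i j}.encard ≤ 1) ∧
        Nodal.IsGivenBy k Γ rel A) := by
  refine ⟨⟨fun h => ?_, fun h => h.isNodal⟩, ⟨fun h => h.exists_isGivenBy hA, ?_⟩⟩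
  · obtain ⟨Γ, rel, hΓ, -, -, h⟩ := h.exists_isGivenBy hA
    exact h.isObtainedFromHereditary hΓ
  · rintro ⟨Γ, rel, hΓ, -, -, h⟩
    exact (h.isObtainedFromHereditary hΓ).isNodal
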